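/- Let $n\ge 3$ be an odd integer, let $\Bbbk$ be an algebraically closed field of characteristic $0$, and let $q\in\Bbbk$ be a primitive $n$th root of unity. Let $\mathsf D_n$ (the Drinfeld double of the Taft algebra) be the Hopf algebra over $\Bbbk$ with generators $a,b,c,d$, relations $$ba=qab,\quad db=qbd,\quad ca=qac,\quad dc=qcd,\quad bc=cb,\quad da-q\,ad=1-bc,\quad a^n=0=d^n,\quad b^n=1=c^n,$$ and coproduct $\Delta(a)=a\otimes b+1\otimes a$, $\Delta(d)=d\otimes c+1\otimes d$, $\Delta(b)=b\otimes b$, $\Delta(c)=c\otimes c$. For $1\le \ell\le n$ and $r\in\mathbb Z_n=\mathbb Z/n\mathbb Z$, let $\mathsf V(\ell,r)$ be the simple $\mathsf D_n$-module with basis $v_1,\dots,v_\ell$ and action $$a.v_i=v_{i+1}\ (i<\ell),\quad a.v_\ell=0,\quad b.v_i=q^{r+i-1}v_i,\quad c.v_i=q^{i-(r+\ell)}v_i,\quad d.v_i=\tfrac{(q^{i-1}-1)(1-q^{i-1-\ell})}{q-1}\,v_{i-1}\ (i>1),\quad d.v_1=0,$$ and let $\mathsf P(\ell,r)$ be its projective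 cover. For $1\le\ell\le n$ and $s\in\mathbb Z_n$, let $\mathsf M_{(\ell,s)}$ and $\mathsf Q_{(\ell,s)}$ be the $n^2\times n^2$ matrices, with rows and columns indexed lexicographically by the pairs $(\ell',r')$ with $1\le\ell'\le n$, $r'\in\mathbb Z_n$, whose $((\ell',r'),(\ell'',r''))$ entries are, respectively, the multiplicity of $\mathsf V(\ell'',r'')$ as a composition factor of $\mathsf V(\ell',r')\otimes \mathsf V(\ell,s)$, and the multiplicity of $\mathsf P(\ell'',r'')$ as a direct summand of $\mathsf P(\ell',r')\otimes\mathsf V(\ell,s)$. Let $\mathrm Z$ be the $n\times n$ cyclic permutation matrix with rows and columns indexed by $\mathbb Z_n$ and with $(i,i+1)$ entries $1$ and all other entries $0$, and let $\mathrm Z^{(s)}=\mathrm{diag}(\mathrm Z^s,\dots,\mathrm Z^s)$ ($n$ blocks). Let $\mathcal U_0=1$, $\mathcal U_1=t$, $\mathcal U_m=t\,\mathcal U_{m-1}-\mathcal U_{m-2}$ and $\mathcal L_0=2$, $\mathcal L_1=t$, $\mathcal L_m=t\,\mathcal L_{m-1}-\mathcal L_{m-2}$ for $m\ge2$. For $0\le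 j\le\frac{n-1}2$ and $r\in\mathbb Z_n$ define the following vectors, written in $n$ blocks of length $n$. * $\mathbf v_{j,r}=[\mathbf v_0\ \mathbf v_1\ \cdots\ \mathbf v_{n-1}]^{\tt T}$, where $\mathbf v_0=[1\ q^{2r}\ \cdots\ q^{(n-1)2r}]^{\tt T}$ and $\mathbf v_m=q^{mr}\,\mathcal U_m(q^j+q^{-j})\,\mathbf v_0$ for $1\le m\le n-1$. * $\mathbf w_{j,r}=[\mathbf w_{n-1}\ \cdots\ \mathbf w_1\ \mathbf w_0]$, where $\mathbf w_0\neq 0$ is any row vector with $\mathbf w_0\mathrm Z=q^{2r}\mathbf w_0$ and $\mathbf w_m=q^{mr}\,\mathcal L_m(q^j+q^{-j})\,\mathbf w_0$ for $1\le m\le n-1$. Then for all $1\le\ell\le n$, $s,r\in\mathbb Z_n$ and $0\le j\le\frac{n-1}{2}$: 1. $\mathsf M_{(\ell,s)}=\mathrm Z^{(s)}\mathsf M_{(\ell,0)}$, and $$\begin{aligned}\mathsf M_{(\ell,0)}\mathbf v_{j,r}&=\sum_{i=0}^{\lfloor\frac{\ell-1}2\rfloor}(-1)^i\binom{\ell-1-i}{i}q^{2ir}q^{(\ell-1-2i)r}(q^j+q^{-j})^{\ell-1-2i}\,\mathbf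 v_{j,r}\\&=q^{(\ell-1)r}\sum_{i=0}^{\lfloor\frac{\ell-1}2\rfloor}(-1)^i\binom{\ell-1-i}{i}(q^j+q^{-j})^{\ell-1-2i}\,\mathbf v_{j,r}=q^{(\ell-1)r}\,\mathcal U_{\ell-1}(q^j+q^{-j})\,\mathbf v_{j,r}.\end{aligned}$$ 2. If $j\ne0$, then $q^j-q^{-j}\neq0$ and $\mathcal U_{\ell-1}(q^j+q^{-j})=\dfrac{q^{j\ell}-q^{-j\ell}}{q^j-q^{-j}}$; if $j=0$, then $\mathcal U_{\ell-1}(q^j+q^{-j})=\ell$. 3. $\mathbf v_{j,r}$ is a right eigenvector, and $\mathbf w_{j,r}$ is a left eigenvector, of $\mathsf M_{(\ell,s)}$ with eigenvalue $q^{(\ell-1+2s)r}\,\mathcal U_{\ell-1}(q^j+q^{-j})$. 4. $\mathbf v_{j,r}^{\tt T}$ is a left eigenvector, and $\mathbf w_{j,r}^{\tt T}$ is a right eigenvector, of $\mathsf Q_{(\ell,s)}$ with eigenvalue $q^{(1-\ell-2s)r}\,\mathcal U_{\ell-1}(q^j+q^{-j})$. (Eigenvectors are nonzero by definition.) -/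

import Mathlib

open scoped TensorProduct Kronecker

namespace TaftDouble

/-! ### Powers of a root of unity with exponents in `ZMod n` -/

/-- `q ^ x` for an exponent `x` in `ZMod n` (meaningful when `q ^ n = 1`). -/
def qpow {k : Type*} [Field k] {n : ℕ} (q : k) (x : ZMod n) : k := q ^ x.val

section qpow

variable {k : Type*} [Field k] {n : ℕ} {q : k}

theorem qpow_natCast (hq : q ^ n = 1) (m : ℕ) : qpow q (m : ZMod n) = q ^ m := by
  unfold qpow
  rw [ZMod.val_natCast]
  conv_rhs => rw [← Nat.mod_add_div m n, pow_add, pow_mul, hq, one_pow, mul_one]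

theorem qpow_add [NeZero n] (hq : q ^ n = 1) (x y : ZMod n) : qpow q (x + y) = qpow q x * qpow q y := by
  have h := qpow_natCast (k := k) hq (x.val + y.val)
  rw [Nat.cast_add, ZMod.natCast_zmod_val, ZMod.natCast_zmod_val] at h
  rw [h, pow_add, qpow, qpow]

theorem qpow_pow (hq : q ^ n = 1) (x : ZMod n) : qpow q x ^ n = 1 := by
  rw [qpow, ← pow_mul, mul_comm, pow_mul, hq, one_pow]

theorem qpow_one (hq : q ^ n = 1) : qpow q (1 : ZMod n) = q := by
  simpa using qpow_natCast (n := n) hq 1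

end qpow

/-! ### The Drinfeld double `D_n` of the Taft algebra, by generators and relations -/

/-- The four generators. -/
inductive Gen : Type
  | a | b | c | d

/-- The defining relations of `D_n`, on the free algebra on `a, b, c, d`. -/
inductive Rel (k : Type*) [Field k] (n : ℕ) (q : k) :
    FreeAlgebra k Gen → FreeAlgebra k Gen → Prop
  | ba : Rel k n q (FreeAlgebra.ι k Gen.b * FreeAlgebra.ι k Gen.a)
      (q • (FreeAlgebra.ι k Gen.a * FreeAlgebra.ι k Gen.b))
  | db : Rel k n q (FreeAlgebra.ι k Gen.d * FreeAlgebra.ι k Gen.b)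
      (q • (FreeAlgebra.ι k Gen.b * FreeAlgebra.ι k Gen.d))
  | ca : Rel k n q (FreeAlgebra.ι k Gen.c * FreeAlgebra.ι k Gen.a)
      (q • (FreeAlgebra.ι k Gen.a * FreeAlgebra.ι k Gen.c))
  | dc : Rel k n q (FreeAlgebra.ι k Gen.d * FreeAlgebra.ι k Gen.c)
      (q • (FreeAlgebra.ι k Gen.c * FreeAlgebra.ι k Gen.d))
  | bc : Rel k n q (FreeAlgebra.ι k Gen.b * FreeAlgebra.ι k Gen.c)
      (FreeAlgebra.ι k Gen.c * FreeAlgebra.ι k Gen.b)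
  | da : Rel k n q (FreeAlgebra.ι k Gen.d * FreeAlgebra.ι k Gen.a
        - q • (FreeAlgebra.ι k Gen.a * FreeAlgebra.ι k Gen.d))
      (1 - FreeAlgebra.ι k Gen.b * FreeAlgebra.ι k Gen.c)
  | an : Rel k n q (FreeAlgebra.ι k Gen.a ^ n) 0
  | dn : Rel k n q (FreeAlgebra.ι k Gen.d ^ n) 0
  | bn : Rel k n q (FreeAlgebra.ι k Gen.b ^ n) 1
  | cn : Rel k n q (FreeAlgebra.ι k Gen.c ^ n) 1

/-- The algebra `D_n = D_n(q)` over `k`. -/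
def Dn (k : Type*) [Field k] (n : ℕ) (q : k) : Type _ := RingQuot (Rel k n q)

noncomputable instance (k : Type*) [Field k] (n : ℕ) (q : k) : Ring (Dn k n q) :=
  inferInstanceAs (Ring (RingQuot (Rel k n q)))

noncomputable instance (k : Type*) [Field k] (n : ℕ) (q : k) : Algebra k (Dn k n q) :=
  inferInstanceAs (Algebra k (RingQuot (Rel k n q)))

section Dn

variable {k : Type*} [Field k] {n : ℕ} {q : k}

/-- The image of a generator in `D_n`. -/
noncomputable def gen (k : Type*) [Field k] (n : ℕ) (q : k) (g : Gen) : Dn k n q :=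
  RingQuot.mkAlgHom k (Rel k n q) (FreeAlgebra.ι k g)

theorem gen_ba : gen k n q .b * gen k n q .a = q • (gen k n q .a * gen k n q .b) := by
  have h := RingQuot.mkAlgHom_rel k (Rel.ba (k := k) (n := n) (q := q))
  rw [map_mul, map_smul, map_mul] at h
  exact h

theorem gen_db : gen k n q .d * gen k n q .b = q • (gen k n q .b * gen k n q .d) := by
  have h := RingQuot.mkAlgHom_rel k (Rel.db (k := k) (n := n) (q := q))
  rw [map_mul, map_smul, map_mul] at h
  exact h

theorem gen_ca : gen k n q .c * gen k n q .a = q • (gen k n q .a * gen k n q .c) := by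
  have h := RingQuot.mkAlgHom_rel k (Rel.ca (k := k) (n := n) (q := q))
  rw [map_mul, map_smul, map_mul] at h
  exact h

theorem gen_dc : gen k n q .d * gen k n q .c = q • (gen k n q .c * gen k n q .d) := by
  have h := RingQuot.mkAlgHom_rel k (Rel.dc (k := k) (n := n) (q := q))
  rw [map_mul, map_smul, map_mul] at h
  exact h

theorem gen_bc : gen k n q .b * gen k n q .c = gen k n q .c * gen k n q .b := by
  have h := RingQuot.mkAlgHom_rel k (Rel.bc (k := k) (n := n) (q := q))
  rw [map_mul, map_mul] at h
  exact h

theorem gen_da : gen k n q .d * gen k n q .a - q • (gen k n q .a * gen k n q .d)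
    = 1 - gen k n q .b * gen k n q .c := by
  have h := RingQuot.mkAlgHom_rel k (Rel.da (k := k) (n := n) (q := q))
  rw [map_sub, map_sub, map_smul, map_mul, map_mul, map_mul, map_one] at h
  exact h

theorem gen_an : gen k n q .a ^ n = 0 := by
  have h := RingQuot.mkAlgHom_rel k (Rel.an (k := k) (n := n) (q := q))
  rw [map_pow, map_zero] at h
  exact h

theorem gen_dn : gen k n q .d ^ n = 0 := by
  have h := RingQuot.mkAlgHom_rel k (Rel.dn (k := k) (n := n) (q := q))
  rw [map_pow, map_zero] at h
  exact h

theorem gen_bn : gen k n q .b ^ n = 1 := by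
  have h := RingQuot.mkAlgHom_rel k (Rel.bn (k := k) (n := n) (q := q))
  rw [map_pow, map_one] at h
  exact h

theorem gen_cn : gen k n q .c ^ n = 1 := by
  have h := RingQuot.mkAlgHom_rel k (Rel.cn (k := k) (n := n) (q := q))
  rw [map_pow, map_one] at h
  exact h

/-- The elements `f a, f b, f c, f d` of an algebra satisfy the defining relations of `D_n`. -/
structure Satisfies {k : Type*} [Field k] (n : ℕ) (q : k) {R : Type*} [Ring R] [Algebra k R]
    (f : Gen → R) : Prop where
  ba : f .b * f .a = q • (f .a * f .b)
  db : f .d * f .b = q • (f .b * f .d)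
  ca : f .c * f .a = q • (f .a * f .c)
  dc : f .d * f .c = q • (f .c * f .d)
  bc : f .b * f .c = f .c * f .b
  da : f .d * f .a - q • (f .a * f .d) = 1 - f .b * f .c
  an : f .a ^ n = 0
  dn : f .d ^ n = 0
  bn : f .b ^ n = 1
  cn : f .c ^ n = 1

/-- The algebra homomorphism out of `D_n` with given images of the generators. -/
noncomputable def lift {R : Type*} [Ring R] [Algebra k R] (f : Gen → R) (hf : Satisfies n q f) :
    Dn k n q →ₐ[k] R :=
  RingQuot.liftAlgHom k ⟨FreeAlgebra.lift k f, by
    obtain ⟨_, _, _, _, _, _, _, _, _, _⟩ := hf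
    intro x y h
    cases h <;> simp only [map_mul, map_smul, map_sub, map_pow, map_one, map_zero,
      FreeAlgebra.lift_ι_apply] <;> assumption⟩

theorem lift_gen {R : Type*} [Ring R] [Algebra k R] (f : Gen → R) (hf : Satisfies n q f)
    (g : Gen) : lift f hf (gen k n q g) = f g := by
  unfold lift gen
  exact (RingQuot.liftAlgHom_mkAlgHom_apply k _ _ _).trans (FreeAlgebra.lift_ι_apply f g)

end Dn

/-! ### The coproduct -/

section Coproduct

/-- Gaussian binomial coefficients. -/
def gaussBinom {k : Type*} [Field k] (q : k) : ℕ → ℕ → k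
  | _, 0 => 1
  | 0, _ + 1 => 0
  | m + 1, i + 1 => gaussBinom q m i + q ^ (i + 1) * gaussBinom q m (i + 1)

variable {k : Type*} [Field k] {n : ℕ} {q : k}

theorem gaussBinom_eq_zero (m : ℕ) : ∀ i, m < i → gaussBinom q m i = 0 := by
  induction m with
  | zero => intro i hi; cases i with
    | zero => omega
    | succ i => rfl
  | succ m ih => intro i hi; cases i with
    | zero => omega
    | succ i => simp [gaussBinom, ih i (by omega), ih (i + 1) (by omega)]

theorem gaussBinom_self (m : ℕ) : gaussBinom q m m = 1 := by
  induction m with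
  | zero => rfl
  | succ m ih => simp [gaussBinom, ih, gaussBinom_eq_zero m (m + 1) (by omega)]

theorem gaussBinom_step (m : ℕ) : ∀ i, gaussBinom q m (i + 1) * ((q ^ (i + 1) - 1) * q ^ i)
    = gaussBinom q m i * (q ^ m - q ^ i) := by
  induction m with
  | zero => intro i; cases i with
    | zero => simp [gaussBinom]
    | succ i => simp [gaussBinom]
  | succ m ih =>
    intro i
    have h1 := ih i
    cases i with
    | zero =>
      have e1 : gaussBinom q (m + 1) (0 + 1) = 1 + q ^ (0 + 1) * gaussBinom q m (0 + 1) := by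
        simp [gaussBinom]
      have e0 : gaussBinom q m 0 = 1 := by cases m <;> rfl
      have e2 : gaussBinom q (m + 1) 0 = 1 := rfl
      rw [e1, e2]
      rw [e0] at h1
      linear_combination q * h1
    | succ i =>
      have h0 := ih i
      have e1 : gaussBinom q (m + 1) (i + 1 + 1)
        = gaussBinom q m (i + 1) + q ^ (i + 1 + 1) * gaussBinom q m (i + 1 + 1) := rfl
      have e2 : gaussBinom q (m + 1) (i + 1)
        = gaussBinom q m i + q ^ (i + 1) * gaussBinom q m (i + 1) := rfl
      rw [e1, e2]
      linear_combination q ^ (i + 1 + 1) * h1 + q * h0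

theorem gaussBinom_root (hq : IsPrimitiveRoot q n) :
    ∀ i, i + 1 < n → gaussBinom q n (i + 1) = 0 := by
  intro i hi
  have hq0 : q ≠ 0 := hq.ne_zero (by omega)
  have key := gaussBinom_step (q := q) n i
  have hne : (q ^ (i + 1) - 1) * q ^ i ≠ 0 :=
    mul_ne_zero (sub_ne_zero.mpr (hq.pow_ne_one_of_pos_of_lt (by omega) hi)) (pow_ne_zero _ hq0)
  have hz : gaussBinom q n i * (q ^ n - q ^ i) = 0 := by
    cases i with
    | zero => simp [hq.pow_eq_one]
    | succ i => rw [gaussBinom_root hq i (by omega), zero_mul]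
  rw [hz] at key
  exact (mul_eq_zero.mp key).resolve_right hne

theorem mul_pow_of_qcomm {R : Type*} [Ring R] [Algebra k R] {x y : R}
    (h : y * x = q • (x * y)) (i : ℕ) : y * x ^ i = q ^ i • (x ^ i * y) := by
  induction i with
  | zero => simp
  | succ i ih =>
    rw [pow_succ, ← mul_assoc, ih, smul_mul_assoc, mul_assoc, h, mul_smul_comm, smul_smul,
      mul_assoc, pow_succ q]

theorem add_pow_of_qcomm {R : Type*} [Ring R] [Algebra k R] {x y : R}
    (h : y * x = q • (x * y)) (m : ℕ) :
    (x + y) ^ m = ∑ i ∈ Finset.range (m + 1), gaussBinom q m i • (x ^ i * y ^ (m - i)) := by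
  induction m with
  | zero => simp [gaussBinom]
  | succ m ih =>
    have e0 : ∀ m : ℕ, gaussBinom q m 0 = 1 := by intro m; cases m <;> rfl
    have hx : x * ∑ i ∈ Finset.range (m + 1), gaussBinom q m i • (x ^ i * y ^ (m - i))
        = ∑ i ∈ Finset.range (m + 1), gaussBinom q m i • (x ^ (i + 1) * y ^ (m - i)) := by
      rw [Finset.mul_sum]
      refine Finset.sum_congr rfl fun i _ => ?_
      rw [mul_smul_comm, ← mul_assoc, ← pow_succ']
    have hy : y * ∑ i ∈ Finset.range (m + 1), gaussBinom q m i • (x ^ i * y ^ (m - i))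
        = ∑ i ∈ Finset.range (m + 2),
            (q ^ i * gaussBinom q m i) • (x ^ i * y ^ (m + 1 - i)) := by
      rw [Finset.sum_range_succ _ (m + 1), gaussBinom_eq_zero m (m + 1) (by omega), mul_zero,
        zero_smul, add_zero, Finset.mul_sum]
      refine Finset.sum_congr rfl fun i hi => ?_
      have hi' : i ≤ m := by simpa [Nat.lt_succ_iff] using hi
      rw [mul_smul_comm, ← mul_assoc, mul_pow_of_qcomm h, smul_mul_assoc, mul_assoc, ← pow_succ',
        smul_smul, mul_comm (gaussBinom q m i), Nat.succ_sub hi']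
    rw [pow_succ', ih, add_mul, hx, hy, Finset.sum_range_succ' _ (m + 1),
      Finset.sum_range_succ' _ (m + 1), ← add_assoc, ← Finset.sum_add_distrib]
    congr 1
    · refine Finset.sum_congr rfl fun i _ => ?_
      rw [← Nat.succ_sub_succ m i, ← add_smul]
      rfl
    · simp [e0]

/-- If `y x = q x y` with `q` a primitive `n`-th root of unity, then
`(x + y) ^ n = x ^ n + y ^ n`. -/
theorem add_pow_root {R : Type*} [Ring R] [Algebra k R] {x y : R} (hn : n ≠ 0)
    (hq : IsPrimitiveRoot q n) (h : y * x = q • (x * y)) : (x + y) ^ n = x ^ n + y ^ n := by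
  obtain ⟨m, rfl⟩ : ∃ m, n = m + 1 := ⟨n - 1, by omega⟩
  rw [add_pow_of_qcomm h, Finset.sum_range_succ, Finset.sum_range_succ', Finset.sum_eq_zero]
  · simp [gaussBinom_self]
    simp [gaussBinom, add_comm]
  · intro i hi
    rw [gaussBinom_root hq i (by simpa using hi), zero_smul]

/-- The values of the coproduct on the generators. -/
noncomputable def comulGen (k : Type*) [Field k] (n : ℕ) (q : k) :
    Gen → Dn k n q ⊗[k] Dn k n q
  | .a => gen k n q .a ⊗ₜ gen k n q .b + 1 ⊗ₜ gen k n q .a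
  | .b => gen k n q .b ⊗ₜ gen k n q .b
  | .c => gen k n q .c ⊗ₜ gen k n q .c
  | .d => gen k n q .d ⊗ₜ gen k n q .c + 1 ⊗ₜ gen k n q .d

theorem comulGen_satisfies [NeZero n] (hq : IsPrimitiveRoot q n) :
    Satisfies n q (comulGen k n q) where
  ba := by
    simp only [comulGen, mul_add, add_mul, Algebra.TensorProduct.tmul_mul_tmul, gen_ba, one_mul,
      mul_one, smul_add, TensorProduct.tmul_smul, TensorProduct.smul_tmul']
  db := by
    simp only [comulGen, mul_add, add_mul, Algebra.TensorProduct.tmul_mul_tmul, gen_db, one_mul,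
      mul_one, smul_add, TensorProduct.tmul_smul, TensorProduct.smul_tmul', gen_bc]
  ca := by
    simp only [comulGen, mul_add, add_mul, Algebra.TensorProduct.tmul_mul_tmul, gen_ca, one_mul,
      mul_one, smul_add, TensorProduct.tmul_smul, TensorProduct.smul_tmul', gen_bc]
  dc := by
    simp only [comulGen, mul_add, add_mul, Algebra.TensorProduct.tmul_mul_tmul, gen_dc, one_mul,
      mul_one, smul_add, TensorProduct.tmul_smul, TensorProduct.smul_tmul']
  bc := by simp only [comulGen, Algebra.TensorProduct.tmul_mul_tmul, gen_bc]
  da := by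
    have h : gen k n q .d * gen k n q .a
        = q • (gen k n q .a * gen k n q .d) + (1 - gen k n q .b * gen k n q .c) := by
      rw [← gen_da]; abel
    simp only [comulGen, mul_add, add_mul, Algebra.TensorProduct.tmul_mul_tmul, gen_ca, gen_db,
      h, one_mul, mul_one, smul_add, TensorProduct.tmul_smul, TensorProduct.smul_tmul',
      TensorProduct.add_tmul, TensorProduct.tmul_add, TensorProduct.sub_tmul,
      TensorProduct.tmul_sub, gen_bc, Algebra.TensorProduct.one_def]
    abel
  an := by
    rw [comulGen, add_comm, add_pow_root (NeZero.ne n) hq, Algebra.TensorProduct.tmul_pow,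
      Algebra.TensorProduct.tmul_pow, gen_an, TensorProduct.tmul_zero, TensorProduct.zero_tmul,
      add_zero]
    simp only [Algebra.TensorProduct.tmul_mul_tmul, gen_ba, one_mul, mul_one,
      TensorProduct.tmul_smul]
  dn := by
    rw [comulGen, add_pow_root (NeZero.ne n) hq, Algebra.TensorProduct.tmul_pow,
      Algebra.TensorProduct.tmul_pow, gen_dn, TensorProduct.tmul_zero, TensorProduct.zero_tmul,
      add_zero]
    simp only [Algebra.TensorProduct.tmul_mul_tmul, gen_dc, one_mul, mul_one,
      TensorProduct.tmul_smul]
  bn := by rw [comulGen, Algebra.TensorProduct.tmul_pow, gen_bn, Algebra.TensorProduct.one_def]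
  cn := by rw [comulGen, Algebra.TensorProduct.tmul_pow, gen_cn, Algebra.TensorProduct.one_def]

/-- The coproduct `Δ : D_n → D_n ⊗ D_n`, the algebra homomorphism with
`Δ a = a ⊗ b + 1 ⊗ a`, `Δ b = b ⊗ b`, `Δ c = c ⊗ c`, `Δ d = d ⊗ c + 1 ⊗ d`. -/
noncomputable def comul [NeZero n] (hq : IsPrimitiveRoot q n) :
    Dn k n q →ₐ[k] Dn k n q ⊗[k] Dn k n q :=
  lift (comulGen k n q) (comulGen_satisfies hq)

theorem comul_gen [NeZero n] (hq : IsPrimitiveRoot q n) (g : Gen) :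
    comul hq (gen k n q g) = comulGen k n q g := by
  rw [comul, lift_gen]

end Coproduct

/-! ### Modules as representations, and their tensor products -/

/-- The space `V` as a module over `A` through the representation `ρ : A → End V`. -/
def RepMod {k A V : Type*} [Field k] [Ring A] [Algebra k A] [AddCommGroup V] [Module k V]
    (_ρ : A →ₐ[k] Module.End k V) : Type _ := V

section RepMod

variable {k A V : Type*} [Field k] [Ring A] [Algebra k A] [AddCommGroup V] [Module k V]
  (ρ : A →ₐ[k] Module.End k V)

instance : AddCommGroup (RepMod ρ) := inferInstanceAs (AddCommGroup V)

noncomputable instance : Module A (RepMod ρ) := Module.compHom V (ρ : A →+* Module.End k V)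

end RepMod

/-- The tensor product of two representations of `D_n`: `x` acts on `U ⊗ V` by `Δ x`. -/
noncomputable def tensorRep {k : Type*} [Field k] {n : ℕ} [NeZero n] {q : k}
    (hq : IsPrimitiveRoot q n) {U V : Type*} [AddCommGroup U] [Module k U]
    [AddCommGroup V] [Module k V] (ρ : Dn k n q →ₐ[k] Module.End k U)
    (σ : Dn k n q →ₐ[k] Module.End k V) : Dn k n q →ₐ[k] Module.End k (U ⊗[k] V) :=
  ((Module.endTensorEndAlgHom (R := k) (S := k) (A := k) (M := U) (N := V)).comp
    (Algebra.TensorProduct.map ρ σ)).comp (comul hq)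

/-! ### The simple modules `V(ℓ, r)` -/

section Simple

variable {k : Type*} [Field k]

/-- `α_i(ℓ) = (q ^ i - 1) (1 - q ^ (i - ℓ)) / (q - 1)`. -/
noncomputable def alpha (q : k) (ℓ i : ℕ) : k :=
  (q ^ i - 1) * (1 - q ^ ((i : ℤ) - (ℓ : ℤ))) / (q - 1)

/-- The basis vector `v_{i+1}` of `k ^ ℓ` (zero unless `i < ℓ`). -/
def vec (k : Type*) [Field k] (ℓ i : ℕ) : Fin ℓ → k := fun t => if t.val = i then 1 else 0

/-- The linear endomorphism of `k ^ ℓ` with prescribed values on the basis vectors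
`v_1, …, v_ℓ`; the value at `v_{i+1}` is `f i`. -/
noncomputable def ofBasis (ℓ : ℕ) (f : ℕ → (Fin ℓ → k)) : Module.End k (Fin ℓ → k) :=
  (Pi.basisFun k (Fin ℓ)).constr k fun i => f i.val

/-- The action of the generators on `V(ℓ, r)`, with `j = i + 1` for the basis vector `v_j`:
`a v_j = v_{j+1}` (zero for `j = ℓ`), `b v_j = q ^ (r + j - 1) v_j`,
`c v_j = q ^ (j - (r + ℓ)) v_j`, `d v_j = α_{j-1}(ℓ) v_{j-1}` (zero for `j = 1`). -/
noncomputable def simpleGen {n : ℕ} (q : k) (ℓ : ℕ) (r : ZMod n) :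
    Gen → Module.End k (Fin ℓ → k)
  | .a => ofBasis ℓ fun i => vec k ℓ (i + 1)
  | .b => ofBasis ℓ fun i => qpow q (r + (i : ZMod n)) • vec k ℓ i
  | .c => ofBasis ℓ fun i => qpow q (((i + 1 : ℕ) : ZMod n) - (r + (ℓ : ZMod n))) • vec k ℓ i
  | .d => ofBasis ℓ fun i => if i = 0 then 0 else alpha q ℓ i • vec k ℓ (i - 1)

theorem vec_eq_zero {ℓ i : ℕ} (h : ℓ ≤ i) : vec k ℓ i = 0 := by
  funext t
  have : t.val ≠ i := by omega
  simp [vec, this]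

theorem ofBasis_vec {ℓ : ℕ} (f : ℕ → (Fin ℓ → k)) {i : ℕ} (hi : i < ℓ) :
    ofBasis ℓ f (vec k ℓ i) = f i := by
  have h : vec k ℓ i = Pi.basisFun k (Fin ℓ) ⟨i, hi⟩ := by
    funext t
    simp [vec, Pi.basisFun_apply, Pi.single_apply, Fin.ext_iff]
  rw [h, ofBasis, Module.Basis.constr_basis]

theorem end_ext {ℓ : ℕ} {f g : Module.End k (Fin ℓ → k)}
    (h : ∀ i, i < ℓ → f (vec k ℓ i) = g (vec k ℓ i)) : f = g := by
  refine (Pi.basisFun k (Fin ℓ)).ext fun i => ?_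
  have e : vec k ℓ i.val = Pi.basisFun k (Fin ℓ) i := by
    funext t
    simp [vec, Pi.basisFun_apply, Pi.single_apply, Fin.ext_iff]
  rw [← e]
  exact h i i.isLt

variable {n : ℕ} {q : k} {ℓ : ℕ} {r : ZMod n}

theorem simpleGen_a (i : ℕ) : simpleGen q ℓ r .a (vec k ℓ i) = vec k ℓ (i + 1) := by
  by_cases hi : i < ℓ
  · rw [simpleGen, ofBasis_vec _ hi]
  · rw [vec_eq_zero (not_lt.mp hi), vec_eq_zero (by omega), map_zero]

theorem simpleGen_b (i : ℕ) :
    simpleGen q ℓ r .b (vec k ℓ i) = qpow q (r + (i : ZMod n)) • vec k ℓ i := by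
  by_cases hi : i < ℓ
  · rw [simpleGen, ofBasis_vec _ hi]
  · rw [vec_eq_zero (not_lt.mp hi), map_zero, smul_zero]

theorem simpleGen_c (i : ℕ) : simpleGen q ℓ r .c (vec k ℓ i)
    = qpow q (((i + 1 : ℕ) : ZMod n) - (r + (ℓ : ZMod n))) • vec k ℓ i := by
  by_cases hi : i < ℓ
  · rw [simpleGen, ofBasis_vec _ hi]
  · rw [vec_eq_zero (not_lt.mp hi), map_zero, smul_zero]

theorem simpleGen_d_zero : simpleGen q ℓ r .d (vec k ℓ 0) = 0 := by
  by_cases hi : 0 < ℓ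
  · rw [simpleGen, ofBasis_vec _ hi, if_pos rfl]
  · rw [vec_eq_zero (not_lt.mp hi), map_zero]

theorem simpleGen_d_succ (i : ℕ) : simpleGen q ℓ r .d (vec k ℓ (i + 1))
    = alpha q ℓ (i + 1) • vec k ℓ i := by
  by_cases hi : i + 1 < ℓ
  · rw [simpleGen, ofBasis_vec _ hi, if_neg (Nat.succ_ne_zero i), Nat.add_sub_cancel]
  · rw [vec_eq_zero (not_lt.mp hi), map_zero]
    by_cases hl : i + 1 = ℓ
    · subst hl
      simp [alpha]
    · rw [vec_eq_zero (by omega), smul_zero]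

theorem alpha_step (hq0 : q ≠ 0) (hq1 : q ≠ 1) (ℓ i : ℕ) :
    alpha q ℓ (i + 1) - q * alpha q ℓ i = 1 - q ^ (2 * (i : ℤ) + 1 - ℓ) := by
  have h1 : q - 1 ≠ 0 := sub_ne_zero.mpr hq1
  have e1 : q ^ (((i + 1 : ℕ) : ℤ) - (ℓ : ℤ)) = q * (q ^ i * q ^ (-(ℓ : ℤ))) := by
    rw [← zpow_natCast q i, ← zpow_add₀ hq0, ← zpow_one_add₀ hq0]
    congr 1; push_cast; ring
  have e2 : q ^ ((i : ℤ) - (ℓ : ℤ)) = q ^ i * q ^ (-(ℓ : ℤ)) := by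
    rw [← zpow_natCast q i, ← zpow_add₀ hq0]
    congr 1
  have e3 : q ^ (2 * (i : ℤ) + 1 - ℓ) = q * (q ^ i * q ^ i * q ^ (-(ℓ : ℤ))) := by
    rw [← zpow_natCast q i, ← zpow_add₀ hq0, ← zpow_add₀ hq0, ← zpow_one_add₀ hq0]
    congr 1; ring
  rw [alpha, alpha, e1, e2, e3]
  field_simp
  ring

theorem qpow_bc [NeZero n] (hq : q ^ n = 1) (hq0 : q ≠ 0) (ℓ i : ℕ) (r : ZMod n) :
    qpow q (r + (i : ZMod n)) * qpow q (((i + 1 : ℕ) : ZMod n) - (r + (ℓ : ZMod n)))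
      = q ^ (2 * (i : ℤ) + 1 - ℓ) := by
  have hl : qpow q (ℓ : ZMod n) = q ^ ℓ := qpow_natCast hq ℓ
  have h2 : qpow q ((2 * i + 1 : ℕ) : ZMod n) = q ^ (2 * i + 1) := qpow_natCast hq _
  have e : r + (i : ZMod n) + (((i + 1 : ℕ) : ZMod n) - (r + (ℓ : ZMod n))) + (ℓ : ZMod n)
      = ((2 * i + 1 : ℕ) : ZMod n) := by push_cast; ring
  rw [← e, qpow_add hq, qpow_add hq, hl] at h2
  rw [zpow_sub₀ hq0, eq_div_iff (zpow_ne_zero _ hq0), zpow_natCast, h2, ← zpow_natCast]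
  push_cast
  rfl

theorem simpleGen_a_pow (t i : ℕ) :
    (simpleGen q ℓ r .a ^ t) (vec k ℓ i) = vec k ℓ (i + t) := by
  induction t generalizing i with
  | zero => simp
  | succ t ih => rw [pow_succ, Module.End.mul_apply, simpleGen_a, ih]; congr 1; omega

theorem simpleGen_d_pow (t : ℕ) :
    ∀ i, i < t → (simpleGen q ℓ r .d ^ t) (vec k ℓ i) = 0 := by
  induction t with
  | zero => intro i hi; omega
  | succ t ih =>
    intro i hi
    rw [pow_succ, Module.End.mul_apply]
    cases i with
    | zero => rw [simpleGen_d_zero, map_zero]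
    | succ i => rw [simpleGen_d_succ, map_smul, ih i (by omega), smul_zero]

theorem simpleGen_b_pow (t i : ℕ) : (simpleGen q ℓ r .b ^ t) (vec k ℓ i)
    = qpow q (r + (i : ZMod n)) ^ t • vec k ℓ i := by
  induction t with
  | zero => simp
  | succ t ih => rw [pow_succ, Module.End.mul_apply, simpleGen_b, map_smul, ih, smul_smul, pow_succ']

theorem simpleGen_c_pow (t i : ℕ) : (simpleGen q ℓ r .c ^ t) (vec k ℓ i)
    = qpow q (((i + 1 : ℕ) : ZMod n) - (r + (ℓ : ZMod n))) ^ t • vec k ℓ i := by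
  induction t with
  | zero => simp
  | succ t ih => rw [pow_succ, Module.End.mul_apply, simpleGen_c, map_smul, ih, smul_smul, pow_succ']

theorem simpleGen_satisfies [NeZero n] (hq : IsPrimitiveRoot q n) (hℓ : ℓ ≤ n) :
    Satisfies n q (simpleGen q ℓ r) where
  ba := by
    refine end_ext fun i _ => ?_
    have e : r + ((i + 1 : ℕ) : ZMod n) = 1 + (r + (i : ZMod n)) := by push_cast; ring
    simp only [Module.End.mul_apply, LinearMap.smul_apply, simpleGen_a, simpleGen_b, map_smul]
    rw [e, qpow_add hq.pow_eq_one, qpow_one hq.pow_eq_one, mul_smul]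
  db := by
    refine end_ext fun i _ => ?_
    cases i with
    | zero =>
      simp only [Module.End.mul_apply, LinearMap.smul_apply, simpleGen_b, map_smul,
        simpleGen_d_zero, map_zero, smul_zero]
    | succ i =>
      have e : r + ((i + 1 : ℕ) : ZMod n) = 1 + (r + (i : ZMod n)) := by push_cast; ring
      simp only [Module.End.mul_apply, LinearMap.smul_apply, simpleGen_b, map_smul,
        simpleGen_d_succ]
      rw [e, qpow_add hq.pow_eq_one, qpow_one hq.pow_eq_one, smul_smul, smul_smul, smul_smul]
      congr 1; ring
  ca := by
    refine end_ext fun i _ => ?_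
    have e : ((i + 1 + 1 : ℕ) : ZMod n) - (r + (ℓ : ZMod n))
        = 1 + (((i + 1 : ℕ) : ZMod n) - (r + (ℓ : ZMod n))) := by push_cast; ring
    simp only [Module.End.mul_apply, LinearMap.smul_apply, simpleGen_a, simpleGen_c, map_smul]
    rw [e, qpow_add hq.pow_eq_one, qpow_one hq.pow_eq_one, mul_smul]
  dc := by
    refine end_ext fun i _ => ?_
    cases i with
    | zero =>
      simp only [Module.End.mul_apply, LinearMap.smul_apply, simpleGen_c, map_smul,
        simpleGen_d_zero, map_zero, smul_zero]
    | succ i =>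
      have e : ((i + 1 + 1 : ℕ) : ZMod n) - (r + (ℓ : ZMod n))
          = 1 + (((i + 1 : ℕ) : ZMod n) - (r + (ℓ : ZMod n))) := by push_cast; ring
      simp only [Module.End.mul_apply, LinearMap.smul_apply, simpleGen_c, map_smul,
        simpleGen_d_succ]
      rw [e, qpow_add hq.pow_eq_one, qpow_one hq.pow_eq_one, smul_smul, smul_smul, smul_smul]
      congr 1; ring
  bc := by
    refine end_ext fun i _ => ?_
    simp only [Module.End.mul_apply, simpleGen_b, simpleGen_c, map_smul]
    rw [smul_comm]
  da := by
    refine end_ext fun i hi => ?_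
    simp only [Module.End.mul_apply, LinearMap.smul_apply, LinearMap.sub_apply,
      Module.End.one_apply, simpleGen_b, simpleGen_c, map_smul, simpleGen_a, simpleGen_d_succ]
    rw [smul_smul, mul_comm (qpow q _), qpow_bc hq.pow_eq_one (hq.ne_zero (NeZero.ne n))]
    by_cases hq1 : q = 1
    · have hn1 : n = 1 := hq.unique (hq1 ▸ IsPrimitiveRoot.one)
      obtain rfl : i = 0 := by omega
      obtain rfl : ℓ = 1 := by omega
      simp [simpleGen_d_zero, alpha, hq1]
    · have hs := alpha_step (hq.ne_zero (NeZero.ne n)) hq1 ℓ i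
      cases i with
      | zero =>
        have h0 : alpha q ℓ 0 = 0 := by simp [alpha]
        rw [h0, mul_zero, sub_zero] at hs
        rw [simpleGen_d_zero, map_zero, smul_zero, sub_zero, hs, sub_smul, one_smul]
      | succ i =>
        rw [simpleGen_d_succ, map_smul, simpleGen_a, smul_smul, ← sub_smul, hs, sub_smul,
          one_smul]
  an := by
    refine end_ext fun i _ => ?_
    rw [simpleGen_a_pow, vec_eq_zero (by omega), LinearMap.zero_apply]
  dn := by
    refine end_ext fun i hi => ?_
    rw [simpleGen_d_pow n i (by omega), LinearMap.zero_apply]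
  bn := by
    refine end_ext fun i _ => ?_
    rw [simpleGen_b_pow, qpow_pow hq.pow_eq_one, one_smul, Module.End.one_apply]
  cn := by
    refine end_ext fun i _ => ?_
    rw [simpleGen_c_pow, qpow_pow hq.pow_eq_one, one_smul, Module.End.one_apply]

/-- The simple `D_n`-module `V(ℓ, r)` of dimension `ℓ`, as a representation on `k ^ ℓ`. -/
noncomputable def simpleRep {k : Type*} [Field k] {n : ℕ} [NeZero n] {q : k}
    (hq : IsPrimitiveRoot q n) (ℓ : ℕ) (hℓ : ℓ ≤ n) (r : ZMod n) :
    Dn k n q →ₐ[k] Module.End k (Fin ℓ → k) :=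
  lift (simpleGen q ℓ r) (simpleGen_satisfies hq hℓ)

theorem simpleRep_gen {k : Type*} [Field k] {n : ℕ} [NeZero n] {q : k}
    (hq : IsPrimitiveRoot q n) (ℓ : ℕ) (hℓ : ℓ ≤ n) (r : ZMod n) (g : Gen) :
    simpleRep hq ℓ hℓ r (gen k n q g) = simpleGen q ℓ r g := by
  rw [simpleRep, lift_gen]

end Simple

/-! ### Multiplicities, projective covers and McKay matrices -/

/-- The multiplicity `[N : S]` of `S` as a composition factor of `N`: the number of factors
isomorphic to `S` in a composition series of `N` from `0` to `N`. By the Jordan-Hölder theorem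
all these series give the same number, so the set below has at most one element; it is empty only
if `N` is not of finite length. -/
noncomputable def compMult (A N S : Type*) [Ring A] [AddCommGroup N] [Module A N]
    [AddCommGroup S] [Module A S] : ℕ :=
  sSup {m : ℕ | ∃ s : CompositionSeries (Submodule A N), s.head = ⊥ ∧ s.last = ⊤ ∧
    m = Nat.card {i : Fin s.length //
      Nonempty ((s i.succ ⧸ (s i.castSucc).submoduleOf (s i.succ)) ≃ₗ[A] S)}}

/-- The multiplicity `[N : P]` of an indecomposable module `P` as a direct summand of `N`: the
largest `m` such that `P ^ m` is isomorphic to a direct summand of `N`. -/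
noncomputable def summandMult (A N P : Type*) [Ring A] [AddCommGroup N] [Module A N]
    [AddCommGroup P] [Module A P] : ℕ :=
  sSup {m : ℕ | ∃ (f : (Fin m → P) →ₗ[A] N) (g : N →ₗ[A] (Fin m → P)), g ∘ₗ f = LinearMap.id}

/-- `P` is a projective cover of `S`: it is projective, and there is a surjection `π : P → S` with
superfluous kernel. -/
def IsProjectiveCover (A P S : Type*) [Ring A] [AddCommGroup P] [Module A P]
    [AddCommGroup S] [Module A S] : Prop :=
  Module.Projective A P ∧ ∃ π : P →ₗ[A] S, Function.Surjective π ∧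
    ∀ K : Submodule A P, K ⊔ LinearMap.ker π = ⊤ → K = ⊤

section McKay

variable {k : Type*} [Field k] {n : ℕ} [NeZero n] {q : k}

/-- The simple modules, indexed by pairs: `(i, r)` in `Fin n × ZMod n` stands for `V(i + 1, r)`. -/
noncomputable abbrev simpleAt (hq : IsPrimitiveRoot q n) (x : Fin n × ZMod n) :
    Dn k n q →ₐ[k] Module.End k (Fin (x.1.val + 1) → k) :=
  simpleRep hq (x.1.val + 1) x.1.isLt x.2

/-- The projective cover `P(i + 1, r)` of `V(i + 1, r)`, realized as a left ideal of `D_n`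
(a projective cover of a simple module over a finite-dimensional algebra `A` is isomorphic to a
direct summand of `A`, and it is unique up to isomorphism). -/
noncomputable def projCover (hq : IsPrimitiveRoot q n) (x : Fin n × ZMod n) :
    Submodule (Dn k n q) (Dn k n q) :=
  Classical.epsilon fun P : Submodule (Dn k n q) (Dn k n q) =>
    IsProjectiveCover (Dn k n q) P (RepMod (simpleAt hq x))

/-- The McKay matrix `M_{(ℓ,s)}`, whose entries are the composition multiplicities
`[V(x) ⊗ V(ℓ,s) : V(y)]`. -/
noncomputable def mcKay (hq : IsPrimitiveRoot q n) (ℓ : ℕ) (hℓ : ℓ ≤ n) (s : ZMod n) :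
    Matrix (Fin n × ZMod n) (Fin n × ZMod n) ℕ :=
  Matrix.of fun x y => compMult (Dn k n q)
    (RepMod (tensorRep hq (simpleAt hq x) (simpleRep hq ℓ hℓ s))) (RepMod (simpleAt hq y))

/-- The projective McKay matrix `Q_{(ℓ,s)}`, whose entries are the multiplicities
`[P(x) ⊗ V(ℓ,s) : P(y)]` of indecomposable projectives. -/
noncomputable def projMcKay (hq : IsPrimitiveRoot q n) (ℓ : ℕ) (hℓ : ℓ ≤ n) (s : ZMod n) :
    Matrix (Fin n × ZMod n) (Fin n × ZMod n) ℕ :=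
  Matrix.of fun x y => summandMult (Dn k n q)
    (RepMod (tensorRep hq (Algebra.lsmul k k (projCover hq x)) (simpleRep hq ℓ hℓ s)))
    (projCover hq y)

end McKay

/-! ### Eigenvectors -/

/-- `M v = μ v` with `v ≠ 0`. -/
def IsRightEigenvector {ι k : Type*} [Fintype ι] [Field k] (M : Matrix ι ι k) (v : ι → k)
    (μ : k) : Prop := v ≠ 0 ∧ Matrix.mulVec M v = μ • v

/-- `w M = μ w` with `w ≠ 0`. -/
def IsLeftEigenvector {ι k : Type*} [Fintype ι] [Field k] (M : Matrix ι ι k) (w : ι → k)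
    (μ : k) : Prop := w ≠ 0 ∧ Matrix.vecMul w M = μ • w

/-- The matrix over `k` of a matrix of natural numbers. -/
def toField (k : Type*) [Field k] {ι : Type*} (M : Matrix ι ι ℕ) : Matrix ι ι k :=
  M.map (Nat.cast : ℕ → k)

/-- The cyclic permutation matrix `Z`: the entry at `(i, i + 1)` is `1`, indices modulo `n`. -/
def cyc (n : ℕ) (k : Type*) [Field k] : Matrix (ZMod n) (ZMod n) k :=
  Matrix.of fun i i' => if i' = i + 1 then 1 else 0

/-- The block diagonal matrix `Z^{(s)} = diag (Z ^ s, …, Z ^ s)`. -/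
def blockCyc (n : ℕ) [NeZero n] (k : Type*) [Field k] (s : ZMod n) :
    Matrix (Fin n × ZMod n) (Fin n × ZMod n) k :=
  (1 : Matrix (Fin n) (Fin n) k) ⊗ₖ (cyc n k ^ s.val)

/-- `q ^ j + q ^ (-j)`. -/
def chebArg {k : Type*} [Field k] (q : k) (j : ℕ) : k := q ^ (j : ℤ) + q ^ (-(j : ℤ))

/-- `𝒰_m (q ^ j + q ^ (-j))`, where `𝒰_0 = 1`, `𝒰_1 = t`, `𝒰_m = t 𝒰_{m-1} - 𝒰_{m-2}`. -/
noncomputable def chebU {k : Type*} [Field k] (q : k) (j m : ℕ) : k :=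
  (Polynomial.Chebyshev.S k (m : ℤ)).eval (chebArg q j)

/-- `ℒ_m (q ^ j + q ^ (-j))`, where `ℒ_0 = 2`, `ℒ_1 = t`, `ℒ_m = t ℒ_{m-1} - ℒ_{m-2}`. -/
noncomputable def chebL {k : Type*} [Field k] (q : k) (j m : ℕ) : k :=
  (Polynomial.Chebyshev.C k (m : ℤ)).eval (chebArg q j)

/-- The vector `v_{j,r} = [v_0, …, v_{n-1}]`, where `v_0 = [1, q^{2r}, …, q^{2r(n-1)}]` and
`v_m = q^{m r} 𝒰_m(q^j + q^{-j}) v_0`. -/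
noncomputable def vVec {k : Type*} [Field k] {n : ℕ} (q : k) (j : ℕ) (r : ZMod n) :
    Fin n × ZMod n → k :=
  fun x => qpow q ((x.1.val : ZMod n) * r) * chebU q j x.1.val * qpow q (2 * r * x.2)

/-- The blocks `w_m = q^{m r} ℒ_m(q^j + q^{-j}) w_0` for `m ≥ 1`, and `w_0` itself for `m = 0`. -/
noncomputable def wBlock {k : Type*} [Field k] {n : ℕ} (q : k) (j : ℕ) (r : ZMod n)
    (w₀ : ZMod n → k) (m : ℕ) : ZMod n → k :=
  if m = 0 then w₀ else (qpow q ((m : ZMod n) * r) * chebL q j m) • w₀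

/-- The row vector `w_{j,r} = [w_{n-1}, …, w_1, w_0]`. -/
noncomputable def wVec {k : Type*} [Field k] {n : ℕ} (q : k) (j : ℕ) (r : ZMod n)
    (w₀ : ZMod n → k) : Fin n × ZMod n → k :=
  fun x => wBlock q j r w₀ (n - 1 - x.1.val) x.2

end TaftDouble

/-! Multiplicities are turned into dimensions of Hom spaces. If `P` is a projective cover of a
simple module `S`, then `[N : S] = dim Hom(P, N)`, and `[N : P] = dim Hom(N, S)` when `N` is
projective (`compMult_eq_finrank`, `summandMult_eq_finrank`). The entries of `M` are therefore
additive on short exact sequences, and only classes in the Grothendieck group matter.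

Three facts in that group determine all the matrices `M`. Since `V(ℓ,s) ≅ V(1,s) ⊗ V(ℓ,0)` and `V(x)
⊗ V(1,s)` is `V(x)` with its second index shifted by `s`, one has `M_{(ℓ,s)} = Z^{(s)} M_{(ℓ,0)}`
(`toField_mcKay`). For `1 < ℓ < n`, `V(2,0) ⊗ V(ℓ,s) = V(ℓ+1,s) + V(ℓ-1,s+1)`, whence `M_{(2,0)}
M_{(ℓ,s)} = M_{(ℓ+1,s)} + M_{(ℓ-1,s+1)}` (`mcKay_two_mul`). This is the Chebyshev recursion up to
powers of `q^r`, so a common eigenvector of `Z^{(s)}` and `M_{(2,0)}` is an eigenvector of every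
`M_{(ℓ,s)}` with the stated eigenvalue (`mcKay_induction`).

The rows of `M_{(2,0)}` come from `V(ℓ,r) ⊗ V(2,0)`. Interior rows reproduce the three-term
recursion of `𝒰` or `ℒ`. The last row comes from `V(n,r) ⊗ V(2,0) = 2V(1,r) + 2V(n-1,r+1)`, and it
is compatible with the recursion because `ℒ_n(q^j + q^{-j}) = q^{jn} + q^{-jn} = 2`. Tensor products
are decomposed by finding highest weight vectors, killed by `d`, and following their strings under
`a`.

For `Q`, the module `V(ℓ, 1-ℓ-s)` is dual to `V(ℓ,s)`, so `dim Hom(P(x) ⊗ V(ℓ,s), V(y)) = dim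
Hom(P(x), V(y) ⊗ V(ℓ,1-ℓ-s))`. Thus `Q_{(ℓ,s)}` is the transpose of `M_{(ℓ,1-ℓ-s)}`
(`projMcKay_apply`), which exchanges left and right eigenvectors and changes the exponent `ℓ-1+2s`
into `1-ℓ-2s`. -/

namespace TaftDouble

/-! ### Projective covers and multiplicities over a finite-dimensional algebra -/

section ProjectiveCover

universe u

variable {A P S N : Type*} [Ring A] [AddCommGroup P] [Module A P]
  [AddCommGroup S] [Module A S] [AddCommGroup N] [Module A N]

/-- The kernel of the projection of a projective cover of a simple module lies in the kernel of
every map to a simple module. -/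
theorem ker_le_ker_of_superfluous {π : P →ₗ[A] S}
    (hπ : ∀ K : Submodule A P, K ⊔ LinearMap.ker π = ⊤ → K = ⊤) [IsSimpleModule A N]
    (f : P →ₗ[A] N) : LinearMap.ker π ≤ LinearMap.ker f := by
  rcases eq_or_ne f 0 with rfl | hf
  · simp
  · have hs := LinearMap.surjective_of_ne_zero hf
    have hc := LinearMap.isCoatom_ker_of_surjective hs
    by_contra hle
    -- Otherwise the sum of the two kernels strictly contains the maximal submodule `ker f`, so it
    -- is everything, and superfluity makes `ker f` everything.
    have h := hc.2 (LinearMap.ker f ⊔ LinearMap.ker π)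
      (lt_of_le_of_ne le_sup_left fun h => hle (h ▸ le_sup_right))
    exact hc.1 (hπ _ h)

/-- A nonzero map from a projective cover of `S` to a simple module `N` induces `S ≃ N`. -/
theorem nonempty_equiv_of_ne_zero {π : P →ₗ[A] S} (hs : Function.Surjective π)
    (hπ : ∀ K : Submodule A P, K ⊔ LinearMap.ker π = ⊤ → K = ⊤) [IsSimpleModule A S]
    [IsSimpleModule A N] {f : P →ₗ[A] N} (hf : f ≠ 0) : Nonempty (N ≃ₗ[A] S) := by
  have hfs := LinearMap.surjective_of_ne_zero hf
  have hle := ker_le_ker_of_superfluous hπ f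
  have hc := LinearMap.isCoatom_ker_of_surjective hs
  -- Both kernels are maximal submodules and one contains the other.
  have he : LinearMap.ker π = LinearMap.ker f := by
    by_contra hne
    have h1 := hc.2 _ (lt_of_le_of_ne hle hne)
    exact hf (LinearMap.ker_eq_top.mp h1)
  exact ⟨(f.quotKerEquivOfSurjective hfs).symm ≪≫ₗ (Submodule.quotEquivOfEq _ _ he.symm) ≪≫ₗ
    π.quotKerEquivOfSurjective hs⟩

/-- A simple module over an Artinian ring has a projective cover that is a left ideal. -/
theorem exists_projectiveCover [IsArtinianRing A] [IsSimpleModule A S] :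
    ∃ P : Submodule A A, IsProjectiveCover A P S := by
  have : Nontrivial S := IsSimpleModule.nontrivial A S
  obtain ⟨x, hx⟩ := exists_ne (0 : S)
  -- The cover is a minimal direct summand of `A` among those with a nonzero map to `S`; the
  -- Artinian condition provides one, and minimality will give superfluity of the kernel.
  let F : Set (Submodule A A) := {P | (∃ Q, IsCompl P Q) ∧ ∃ f : P →ₗ[A] S, f ≠ 0}
  have hne : F.Nonempty := by
    refine ⟨⊤, ⟨⊥, isCompl_top_bot⟩, (LinearMap.toSpanSingleton A S x).comp (Submodule.subtype ⊤),
      fun h => hx ?_⟩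
    simpa using congrArg (fun g => g ⟨1, trivial⟩) h
  obtain ⟨P, ⟨⟨Q, hPQ⟩, π, hπ⟩, hmin⟩ := WellFounded.has_min (wellFounded_lt) F hne
  have hs := LinearMap.surjective_of_ne_zero hπ
  have hproj : Module.Projective A P := by
    refine Module.Projective.of_split P.subtype (Submodule.projectionOnto P Q hPQ) ?_
    ext y
    simp
  refine ⟨P, hproj, π, hs, fun K hK => ?_⟩
  have hKs : Function.Surjective (π.comp K.subtype) := by
    rw [← LinearMap.range_eq_top, LinearMap.range_comp, Submodule.range_subtype]
    have := congrArg (Submodule.map π) hK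
    rw [Submodule.map_sup] at this
    have h0 : Submodule.map π (LinearMap.ker π) = ⊥ :=
      le_bot_iff.mp (Submodule.map_le_iff_le_comap.mpr le_rfl)
    rwa [h0, sup_bot_eq, Submodule.map_top, LinearMap.range_eq_top.mpr hs] at this
  -- `K` still maps onto `S`, so `π` lifts to an endomorphism `φ` of `P` with image in `K` and `π φ
  -- = π`.
  obtain ⟨φ', hφ'⟩ := Module.projective_lifting_property (π.comp K.subtype) π hKs
  let φ : Module.End A P := K.subtype.comp φ'
  have hφ : ∀ y, π (φ y) = π y := fun y => congrArg (fun g => g y) hφ'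
  have hφm : ∀ m y, π ((φ ^ m) y) = π y := by
    intro m
    induction m with
    | zero => intro y; simp
    | succ m ih => intro y; rw [pow_succ', Module.End.mul_apply, hφ, ih]
  -- Fitting's lemma. The condition `1 ≤ m` is what places the range of `φ ^ m` inside `K`.
  obtain ⟨m, hm1, hm⟩ : ∃ m, 1 ≤ m ∧ IsCompl (LinearMap.ker (φ ^ m)) (LinearMap.range (φ ^ m)) :=
    ((Filter.eventually_ge_atTop 1).and (LinearMap.eventually_isCompl_ker_pow_range_pow φ)).exists
  have hle : LinearMap.range (φ ^ m) ≤ K := by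
    obtain ⟨m, rfl⟩ : ∃ t, m = t + 1 := ⟨m - 1, by omega⟩
    rintro _ ⟨y, rfl⟩
    rw [pow_succ', Module.End.mul_apply]
    exact (φ' _).2
  -- The range is a summand of `P`, hence of `A`, and `π` is nonzero on it because `π φ ^ m = π`; a
  -- proper range would contradict the minimality of `P`.
  have htop : LinearMap.range (φ ^ m) = ⊤ := by
    by_contra hnt
    have hlt : (LinearMap.range (φ ^ m)).map P.subtype < P := by
      refine lt_of_le_of_ne (Submodule.map_subtype_le _ _) fun h => hnt ?_
      apply Submodule.map_injective_of_injective P.injective_subtype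
      rw [h, Submodule.map_top, Submodule.range_subtype]
    refine hmin _ ⟨⟨(LinearMap.ker (φ ^ m)).map P.subtype ⊔ Q, ?_⟩, ?_⟩ hlt
    · constructor
      · rw [Submodule.disjoint_def]
        rintro _ ⟨y, hy, rfl⟩ h2
        obtain ⟨_, ⟨z, hz, rfl⟩, w, hw, hzw⟩ := Submodule.mem_sup.mp h2
        have hw0 : w = ((y - z : P) : A) := by
          rw [← sub_eq_iff_eq_add'.mpr hzw.symm]; simp
        have hw1 : w = 0 := (Submodule.disjoint_def.mp hPQ.disjoint) w (hw0 ▸ (y - z).2) hw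
        have hyz : y = z := by
          rw [hw1] at hw0
          exact sub_eq_zero.mp (Subtype.ext hw0.symm)
        have := (Submodule.disjoint_def.mp hm.disjoint) y (hyz ▸ hz) hy
        simp [this]
      · rw [codisjoint_iff, ← sup_assoc, ← Submodule.map_sup, sup_comm (LinearMap.range _),
          hm.sup_eq_top, Submodule.map_top, Submodule.range_subtype, hPQ.sup_eq_top]
    · obtain ⟨y, hy⟩ := hs x
      refine ⟨π.comp (Submodule.inclusion (Submodule.map_subtype_le P _)), fun h => hx ?_⟩
      have := congrArg (fun g => g ⟨((φ ^ m) y : P), ⟨_, ⟨y, rfl⟩, rfl⟩⟩) h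
      rw [← hy, ← hφm m y]
      exact this
  exact top_le_iff.mp (htop ▸ hle)

end ProjectiveCover

/-! ### Multiplicities as dimensions of Hom spaces -/

section Multiplicity

variable {k A P S N : Type*} [Field k] [Ring A] [Algebra k A]
  [AddCommGroup P] [Module A P] [Module k P] [IsScalarTower k A P]
  [AddCommGroup S] [Module A S] [Module k S] [IsScalarTower k A S]
  [AddCommGroup N] [Module A N] [Module k N] [IsScalarTower k A N]

/-- Maps between finite-dimensional modules form a finite-dimensional space. -/
theorem finite_hom [FiniteDimensional k P] [FiniteDimensional k N] :
    FiniteDimensional k (P →ₗ[A] N) :=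
  Module.Finite.of_injective (LinearMap.restrictScalarsₗ k A P N k)
    (LinearMap.restrictScalars_injective k)

/-- Submodules of a finite-dimensional module are finite-dimensional. -/
theorem finite_submodule [FiniteDimensional k N] (K : Submodule A N) : FiniteDimensional k K :=
  Module.Finite.of_injective (K.subtype.restrictScalars k) K.injective_subtype

variable {M : Type*} [AddCommGroup M] [Module A M] [Module k M] [IsScalarTower k A M]

/-- Postcomposition as a `k`-linear map. -/
def postcomp (k : Type*) {A N M : Type*} (P : Type*) [Field k] [Ring A] [Algebra k A]
    [AddCommGroup P] [Module A P] [AddCommGroup N] [Module A N] [Module k N] [IsScalarTower k A N]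
    [AddCommGroup M] [Module A M] [Module k M] [IsScalarTower k A M]
    (f : N →ₗ[A] M) : (P →ₗ[A] N) →ₗ[k] (P →ₗ[A] M) where
  toFun g := f.comp g
  map_add' g h := LinearMap.comp_add g h f
  map_smul' c g := by
    ext x
    exact (f.restrictScalars k).map_smul c (g x)

/-- `dim Hom(P, -)` is additive on short exact sequences if `P` is projective. -/
theorem finrank_hom_of_exact {N₁ N₃ : Type*} [AddCommGroup N₁] [Module A N₁] [Module k N₁]
    [IsScalarTower k A N₁] [AddCommGroup N₃] [Module A N₃] [Module k N₃] [IsScalarTower k A N₃]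
    [FiniteDimensional k P] [FiniteDimensional k N] [Module.Projective A P]
    (i : N₁ →ₗ[A] N) (p : N →ₗ[A] N₃) (hi : Function.Injective i) (hp : Function.Surjective p)
    (he : Function.Exact i p) :
    Module.finrank k (P →ₗ[A] N) = Module.finrank k (P →ₗ[A] N₁) + Module.finrank k (P →ₗ[A] N₃) := by
  have := finite_hom (k := k) (A := A) (P := P) (N := N)
  -- Rank-nullity for composition with `p`: its kernel is `Hom(P, N₁)` by exactness, and it is onto
  -- because `P` is projective.
  rw [← LinearMap.finrank_range_add_finrank_ker (postcomp k P p), add_comm]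
  congr 1
  · have hinj : Function.Injective (postcomp k P i) := by
      intro f g h
      ext x
      exact hi (DFunLike.congr_fun h x)
    rw [← LinearMap.finrank_range_of_inj hinj]
    have : LinearMap.ker (postcomp k P p) = LinearMap.range (postcomp k P i) := by
      ext f
      constructor
      · intro hf
        have hf' : ∀ x, p (f x) = 0 := fun x => DFunLike.congr_fun hf x
        have hr : ∀ x, f x ∈ LinearMap.range i := fun x => (he (f x)).mp (hf' x)
        refine ⟨(LinearEquiv.ofInjective i hi).symm.toLinearMap.comp (f.codRestrict _ hr), ?_⟩
        ext x
        have := LinearEquiv.apply_symm_apply (LinearEquiv.ofInjective i hi) ⟨f x, hr x⟩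
        exact congrArg Subtype.val this
      · rintro ⟨g, rfl⟩
        exact LinearMap.ext fun x => he.apply_apply_eq_zero (g x)
    rw [this]
  · have hsurj : LinearMap.range (postcomp k P p) = ⊤ := by
      rw [LinearMap.range_eq_top]
      intro f
      obtain ⟨g, hg⟩ := Module.projective_lifting_property p f hp
      exact ⟨g, hg⟩
    rw [hsurj, finrank_top]

omit [Module k P] [IsScalarTower k A P] in
/-- `dim Hom` depends on the target only up to isomorphism. -/
theorem finrank_hom_congr_right (e : N ≃ₗ[A] M) :
    Module.finrank k (P →ₗ[A] N) = Module.finrank k (P →ₗ[A] M) :=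
  LinearEquiv.finrank_eq (LinearEquiv.ofLinearMap (postcomp k P e.toLinearMap)
    (postcomp k P e.symm.toLinearMap) (by ext f x; exact e.apply_symm_apply _)
    (by ext f x; exact e.symm_apply_apply _))

variable [IsAlgClosed k] [FiniteDimensional k S] [IsSimpleModule A S]

omit [Module k P] [IsScalarTower k A P] in
/-- For a projective cover `P` of a simple module `S`, the space `Hom(P, S)` has dimension one. -/
theorem finrank_hom_self (hP : IsProjectiveCover A P S) : Module.finrank k (P →ₗ[A] S) = 1 := by
  obtain ⟨-, π, hs, hπ⟩ := hP
  have : Nontrivial S := IsSimpleModule.nontrivial A S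
  refine finrank_eq_one π (fun h => ?_) fun f => ?_
  · obtain ⟨x, hx⟩ := exists_ne (0 : S)
    obtain ⟨y, hy⟩ := hs x
    rw [h] at hy
    exact hx hy.symm
  · have hle := ker_le_ker_of_superfluous hπ f
    -- `f` kills `ker π`, hence factors through `π` as an endomorphism of `S`, which is a scalar by
    -- Schur's lemma.
    let g : Module.End A S := ((LinearMap.ker π).liftQ f hle).comp
      (π.quotKerEquivOfSurjective hs).symm.toLinearMap
    have hg : ∀ x, g (π x) = f x := by
      intro x
      have : (π.quotKerEquivOfSurjective hs).symm (π x) = Submodule.Quotient.mk x := by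
        rw [LinearEquiv.symm_apply_eq]; rfl
      simp [g, this]
    obtain ⟨c, hc⟩ := (IsSimpleModule.algebraMap_end_bijective_of_isAlgClosed k (A := A) (V := S)).2 g
    refine ⟨c, ?_⟩
    ext x
    rw [← hg, ← hc]
    simp [Module.algebraMap_end_apply]

omit [Module k P] [IsScalarTower k A P] in
/-- For a projective cover `P` of a simple module `S`, there are no nonzero maps to other simple
modules. -/
theorem finrank_hom_simple [IsSimpleModule A N] (hP : IsProjectiveCover A P S)
    [Decidable (Nonempty (N ≃ₗ[A] S))] :
    Module.finrank k (P →ₗ[A] N) = if Nonempty (N ≃ₗ[A] S) then 1 else 0 := by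
  split_ifs with h
  · obtain ⟨e⟩ := h
    rw [finrank_hom_congr_right e, finrank_hom_self hP]
  · obtain ⟨-, π, hs, hπ⟩ := hP
    have : Subsingleton (P →ₗ[A] N) := by
      refine ⟨fun f g => ?_⟩
      rw [← sub_eq_zero]
      by_contra hne
      exact h (nonempty_equiv_of_ne_zero hs hπ hne)
    exact Module.finrank_zero_of_subsingleton

/-- Composition multiplicities are dimensions of spaces of maps from a projective cover. -/
theorem compMult_eq_finrank [FiniteDimensional k A] [FiniteDimensional k P] [FiniteDimensional k N]
    (hP : IsProjectiveCover A P S) : compMult A N S = Module.finrank k (P →ₗ[A] N) := by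
  classical
  have hproj := hP.1
  -- Along the series, `dim Hom(P, s j)` counts the factors isomorphic to `S` below `j`: each simple
  -- factor adds one or nothing.
  have key : ∀ s : CompositionSeries (Submodule A N), s.head = ⊥ → ∀ j : Fin (s.length + 1),
      Module.finrank k (P →ₗ[A] s j) = (Finset.univ.filter fun i : Fin s.length => i.castSucc < j ∧
        Nonempty ((s i.succ ⧸ (s i.castSucc).submoduleOf (s i.succ)) ≃ₗ[A] S)).card := by
    intro s hs j
    induction j using Fin.induction with
    | zero =>
      have h0 : s 0 = ⊥ := hs
      have : Subsingleton (s 0) := by rw [h0]; infer_instance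
      have : Subsingleton (P →ₗ[A] s 0) := ⟨fun f g => by ext x; rw [Subsingleton.elim (f x) (g x)]⟩
      rw [Module.finrank_zero_of_subsingleton]
      symm
      rw [Finset.card_eq_zero]
      ext i
      simp
    | succ i ih =>
      have hcov : s i.castSucc ⋖ s i.succ := s.step i
      have hsimple : IsSimpleModule A (s i.succ ⧸ (s i.castSucc).submoduleOf (s i.succ)) :=
        (covBy_iff_quot_is_simple hcov.le).mp hcov
      have := finite_submodule (k := k) (s i.succ)
      have he := finrank_hom_of_exact (k := k) (P := P)
        (Submodule.inclusion hcov.le) ((s i.castSucc).submoduleOf (s i.succ)).mkQ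
        (Submodule.inclusion_injective hcov.le) (Submodule.mkQ_surjective _) (by
          rw [LinearMap.exact_iff, Submodule.ker_mkQ, Submodule.range_inclusion]
          rfl)
      rw [he, ih, finrank_hom_simple hP]
      have hsplit : (Finset.univ.filter fun t : Fin s.length => t.castSucc < i.succ ∧
          Nonempty ((s t.succ ⧸ (s t.castSucc).submoduleOf (s t.succ)) ≃ₗ[A] S))
          = (Finset.univ.filter fun t : Fin s.length => t.castSucc < i.castSucc ∧
          Nonempty ((s t.succ ⧸ (s t.castSucc).submoduleOf (s t.succ)) ≃ₗ[A] S)) ∪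
          (if Nonempty ((s i.succ ⧸ (s i.castSucc).submoduleOf (s i.succ)) ≃ₗ[A] S) then {i} else ∅) := by
        ext t
        have hlt : t.castSucc < i.succ ↔ t.castSucc < i.castSucc ∨ t = i := by
          simp only [Fin.lt_def, Fin.ext_iff, Fin.val_castSucc, Fin.val_succ]; omega
        rw [Finset.mem_union, Finset.mem_filter, Finset.mem_filter, hlt]
        by_cases hti : t = i
        · subst hti
          split_ifs with h <;> simp [h]
        · split_ifs with h <;> simp [hti]
      rw [hsplit, Finset.card_union_of_disjoint]
      · split_ifs <;> simp
      · split_ifs <;> simp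
  have : IsNoetherian A N := isNoetherian_of_tower k inferInstance
  have : IsArtinian A N := isArtinian_of_tower k inferInstance
  -- Equality with a singleton includes the existence of a composition series; the supremum of the
  -- empty set would be `0`.
  have hset : {m : ℕ | ∃ s : CompositionSeries (Submodule A N), s.head = ⊥ ∧ s.last = ⊤ ∧
    m = Nat.card {i : Fin s.length //
      Nonempty ((s i.succ ⧸ (s i.castSucc).submoduleOf (s i.succ)) ≃ₗ[A] S)}}
      = {Module.finrank k (P →ₗ[A] N)} := by
    have hval : ∀ s : CompositionSeries (Submodule A N), s.head = ⊥ → s.last = ⊤ →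
        Nat.card {i : Fin s.length //
          Nonempty ((s i.succ ⧸ (s i.castSucc).submoduleOf (s i.succ)) ≃ₗ[A] S)}
          = Module.finrank k (P →ₗ[A] N) := by
      intro s h1 h2
      have h3 := key s h1 (Fin.last _)
      have h4 : s (Fin.last _) = ⊤ := h2
      have e : s (Fin.last _) ≃ₗ[A] N := (LinearEquiv.ofEq _ _ h4) ≪≫ₗ Submodule.topEquiv
      rw [finrank_hom_congr_right e] at h3
      rw [h3, Nat.card_eq_fintype_card, Fintype.card_subtype]
      congr 1
      ext i
      simp [Fin.castSucc_lt_last]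
    ext m
    constructor
    · rintro ⟨s, h1, h2, rfl⟩
      exact hval s h1 h2
    · rintro rfl
      obtain ⟨s, h1, h2⟩ := exists_compositionSeries_of_isNoetherian_isArtinian A N
      exact ⟨s, h1, h2, (hval s h1 h2).symm⟩
  rw [compMult, hset, csSup_singleton]

/-- The multiplicity of the projective cover of `S` as a direct summand of a projective module `N`
is the dimension of `Hom(N, S)`. -/
theorem summandMult_eq_finrank [FiniteDimensional k P] [FiniteDimensional k N]
    [Module.Projective A N] (hP : IsProjectiveCover A P S) :
    summandMult A N P = Module.finrank k (N →ₗ[A] S) := by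
  classical
  obtain ⟨hproj, π, hs, hπ⟩ := hP
  have : FiniteDimensional k (N →ₗ[A] S) := finite_hom
  have : Nontrivial S := IsSimpleModule.nontrivial A S
  obtain ⟨x, hx⟩ := exists_ne (0 : S)
  obtain ⟨y, hy⟩ := hs x
  apply IsGreatest.csSup_eq
  constructor
  · set m := Module.finrank k (N →ₗ[A] S) with hm
    let φ := Module.finBasis k (N →ₗ[A] S)
    let Φ : N →ₗ[A] (Fin m → S) := LinearMap.pi fun i => φ i
    -- If the range had a nonzero complement in the semisimple module `S ^ m`, some nonzero map `ψ :
    -- S ^ m → S` would kill the range. By Schur `ψ` is a linear combination of coordinates, so the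
    -- basis `φ` would be linearly dependent.
    have hΦ : Function.Surjective Φ := by
      rw [← LinearMap.range_eq_top]
      by_contra hne
      obtain ⟨C, hC⟩ := exists_isCompl (LinearMap.range Φ)
      have hC0 : C ≠ ⊥ := fun h => hne (by rw [← hC.sup_eq_top, h, sup_bot_eq])
      obtain ⟨c, hcC, hc0⟩ := Submodule.exists_mem_ne_zero_of_ne_bot hC0
      obtain ⟨i, hi⟩ := Function.ne_iff.mp hc0
      let ψ : (Fin m → S) →ₗ[A] S := (LinearMap.proj i).comp
        (C.subtype.comp (Submodule.projectionOnto C _ hC.symm))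
      have hψ : ∀ z ∈ LinearMap.range Φ, ψ z = 0 := by
        intro z hz
        have := (Submodule.projectionOnto_apply_eq_zero_iff hC.symm).mpr hz
        simp [ψ, this]
      have hψc : ψ c = c i := by
        have := Submodule.projectionOnto_apply_left hC.symm ⟨c, hcC⟩
        simp only [ψ, LinearMap.comp_apply]
        rw [this]; rfl
      choose b hb using fun t : Fin m =>
        (IsSimpleModule.algebraMap_end_bijective_of_isAlgClosed k (A := A) (V := S)).2
          (ψ.comp (LinearMap.single A (fun _ : Fin m => S) t))
      have hb' : ∀ t z, ψ (Pi.single t z) = b t • z := by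
        intro t z
        have := congrArg (fun g => g z) (hb t)
        simpa [Module.algebraMap_end_apply] using this.symm
      have hψs : ∀ z, ψ z = ∑ t, b t • z t := by
        intro z
        conv_lhs => rw [← Finset.univ_sum_single z]
        rw [map_sum]
        exact Finset.sum_congr rfl fun t _ => hb' t _
      have hlin : ∑ t, b t • φ t = 0 := by
        ext z
        have := hψ (Φ z) ⟨z, rfl⟩
        rw [hψs] at this
        rw [LinearMap.sum_apply]
        exact this
      have hb0 := Fintype.linearIndependent_iff.mp φ.linearIndependent b hlin
      apply hi
      rw [← hψc, hψs]
      simp [hb0]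
    let Ψ : (Fin m → P) →ₗ[A] (Fin m → S) := LinearMap.pi fun i => π.comp (LinearMap.proj i)
    have hΨ : Function.Surjective Ψ := by
      intro z
      choose w hw using fun i => hs (z i)
      exact ⟨w, funext hw⟩
    obtain ⟨g, hg⟩ := Module.projective_lifting_property Ψ Φ hΨ
    -- A Nakayama argument: a proper range lies in a maximal submodule `L`. Every map from `P` to a
    -- simple module kills `ker π`, so `L` contains `ker Ψ`; as `Ψ g = Φ` is onto, `L` is
    -- everything. Then `g` splits, since `P ^ m` is projective.
    have hgs : Function.Surjective g := by
      rw [← LinearMap.range_eq_top]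
      by_contra hne
      have hfin : Module.Finite A (Fin m → P) :=
        Module.Finite.of_restrictScalars_finite k A (Fin m → P)
      obtain ⟨L, hL, hgL⟩ := (eq_top_or_exists_le_coatom (LinearMap.range g)).resolve_left hne
      have hsim : IsSimpleModule A ((Fin m → P) ⧸ L) := isSimpleModule_iff_isCoatom.mpr hL
      have hker : LinearMap.ker Ψ ≤ L := by
        intro z hz
        rw [← Submodule.Quotient.mk_eq_zero, ← Submodule.mkQ_apply]
        rw [← Finset.univ_sum_single z, map_sum]
        refine Finset.sum_eq_zero fun i _ => ?_
        have h1 : z i ∈ LinearMap.ker π := congrFun hz i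
        exact ker_le_ker_of_superfluous hπ
          (L.mkQ.comp (LinearMap.single A (fun _ : Fin m => P) i)) h1
      apply hL.1
      rw [eq_top_iff]
      intro z _
      obtain ⟨w, hw⟩ := hΦ (Ψ z)
      have hd : z - g w ∈ LinearMap.ker Ψ := by
        rw [LinearMap.mem_ker, map_sub, ← hw, ← hg]
        simp
      have := L.add_mem (hker hd) (hgL ⟨w, rfl⟩)
      simpa using this
    have : Module.Projective A (Fin m → P) :=
      Module.Projective.of_equiv (DFinsupp.linearEquivFunOnFintype (R := A) (M := fun _ : Fin m => P))
    obtain ⟨f, hf⟩ := Module.projective_lifting_property g LinearMap.id hgs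
    exact ⟨f, g, hf⟩
  · rintro m ⟨f, g, hfg⟩
    -- The upper bound: a summand `P ^ m` yields `m` maps to `S`, whose independence is tested on
    -- the images under `f` of the vectors `Pi.single i y`, where `π y = x ≠ 0`.
    let ψ : Fin m → (N →ₗ[A] S) := fun i => π.comp ((LinearMap.proj i).comp g)
    have hψ : LinearIndependent k ψ := by
      rw [Fintype.linearIndependent_iff]
      intro c hc i
      have h1 := congrArg (fun t => t (f (Pi.single i y))) hc
      have hgf : g (f (Pi.single i y)) = Pi.single i y := congrArg (fun t => t (Pi.single i y)) hfg
      simp only [ψ, LinearMap.sum_apply, LinearMap.smul_apply, LinearMap.comp_apply,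
        LinearMap.proj_apply, hgf, LinearMap.zero_apply] at h1
      rw [Finset.sum_eq_single i] at h1
      · rw [Pi.single_eq_same, hy] at h1
        exact (smul_eq_zero.mp h1).resolve_right hx
      · intro t _ ht
        rw [Pi.single_eq_of_ne ht, map_zero, smul_zero]
      · simp
    simpa using hψ.fintype_card_le_finrank

end Multiplicity


/-! ### Generation and finite-dimensionality of `D_n` -/

section Generation

variable {k : Type*} [Field k] {n : ℕ} {q : k}

/-- A subalgebra of `D_n` containing the generators is everything. -/
theorem subalgebra_eq_top (T : Subalgebra k (Dn k n q)) (h : ∀ g, gen k n q g ∈ T) : T = ⊤ := by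
  rw [eq_top_iff]
  intro x _
  let π : FreeAlgebra k Gen →ₐ[k] Dn k n q := RingQuot.mkAlgHom k (Rel k n q)
  obtain ⟨y, rfl⟩ : ∃ y, π y = x := RingQuot.mkAlgHom_surjective k (Rel k n q) x
  have hle : Algebra.adjoin k (Set.range (FreeAlgebra.ι k (X := Gen))) ≤ T.comap π := by
    rw [Algebra.adjoin_le_iff]
    rintro _ ⟨g, rfl⟩
    exact h g
  rw [FreeAlgebra.adjoin_range_ι] at hle
  exact hle trivial

/-- A subspace of a representation stable under the generators is stable under `D_n`. -/
theorem apply_mem_of_gen {U : Type*} [AddCommGroup U] [Module k U]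
    (ρ : Dn k n q →ₐ[k] Module.End k U) (T : Submodule k U)
    (h : ∀ g, ∀ u ∈ T, ρ (gen k n q g) u ∈ T) (x : Dn k n q) {u : U} (hu : u ∈ T) : ρ x u ∈ T := by
  let B : Subalgebra k (Dn k n q) :=
    { carrier := {x | ∀ u ∈ T, ρ x u ∈ T}
      mul_mem' := fun {x y} hx hy u hu => by
        rw [map_mul, Module.End.mul_apply]; exact hx _ (hy _ hu)
      add_mem' := fun {x y} hx hy u hu => by
        rw [map_add, LinearMap.add_apply]; exact T.add_mem (hx _ hu) (hy _ hu)
      algebraMap_mem' := fun c u hu => by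
        rw [AlgHom.commutes, Module.algebraMap_end_apply]; exact T.smul_mem _ hu }
  have hB := subalgebra_eq_top B h
  have : x ∈ B := hB ▸ trivial
  exact this u hu

/-- The relation `da = q ad + 1 - bc` lets `d` pass the factors of `a ^ i` one at a time; the
leftover terms stay in `T` by stability under `a`, `b` and `c`. -/
theorem gen_d_mul_pow_a_mem (T : Submodule k (Dn k n q))
    (h : ∀ g ∈ ({.a, .b, .c} : Set Gen), ∀ x ∈ T, gen k n q g * x ∈ T) (y : Dn k n q)
    (hy : y ∈ T) (hd : gen k n q .d * y ∈ T) (i : ℕ) :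
    gen k n q .a ^ i * y ∈ T ∧ gen k n q .d * (gen k n q .a ^ i * y) ∈ T := by
  induction i with
  | zero => simpa using ⟨hy, hd⟩
  | succ i ih =>
    obtain ⟨h1, h2⟩ := ih
    have e : gen k n q .d * gen k n q .a
        = q • (gen k n q .a * gen k n q .d) + (1 - gen k n q .b * gen k n q .c) := by
      rw [← gen_da]; abel
    refine ⟨?_, ?_⟩
    · rw [pow_succ', mul_assoc]
      exact h _ (by simp) _ h1
    · rw [pow_succ', mul_assoc, ← mul_assoc, e, add_mul, sub_mul, one_mul, smul_mul_assoc,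
        mul_assoc, mul_assoc]
      exact T.add_mem (T.smul_mem _ (h _ (by simp) _ h2))
        (T.sub_mem h1 (h _ (by simp) _ (h _ (by simp) _ h1)))

/-- The monomials `a ^ i b ^ j c ^ m d ^ l` span `D_n`. -/
theorem span_monomials : Submodule.span k (Set.range fun e : ℕ × ℕ × ℕ × ℕ =>
    gen k n q .a ^ e.1 * (gen k n q .b ^ e.2.1 * (gen k n q .c ^ e.2.2.1 *
      gen k n q .d ^ e.2.2.2))) = ⊤ := by
  set T := Submodule.span k (Set.range fun e : ℕ × ℕ × ℕ × ℕ =>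
    gen k n q .a ^ e.1 * (gen k n q .b ^ e.2.1 * (gen k n q .c ^ e.2.2.1 *
      gen k n q .d ^ e.2.2.2))) with hT
  have hmon : ∀ i j m l, gen k n q .a ^ i * (gen k n q .b ^ j * (gen k n q .c ^ m *
      gen k n q .d ^ l)) ∈ T := fun i j m l => Submodule.subset_span ⟨(i, j, m, l), rfl⟩
  -- Since `T` contains `1`, it suffices that left multiplication by each generator preserves `T`,
  -- and this can be tested on monomials.
  have hclosed : ∀ z : Dn k n q, (∀ i j m l, z * (gen k n q .a ^ i * (gen k n q .b ^ j *
      (gen k n q .c ^ m * gen k n q .d ^ l))) ∈ T) → ∀ x ∈ T, z * x ∈ T := by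
    intro z hz x hx
    have hle : T ≤ T.comap (LinearMap.mulLeft k z) := by
      rw [hT, Submodule.span_le]
      rintro _ ⟨e, rfl⟩
      exact hz _ _ _ _
    exact hle hx
  have ha : ∀ x ∈ T, gen k n q .a * x ∈ T := hclosed _ fun i j m l => by
    rw [← mul_assoc, ← pow_succ']; exact hmon _ _ _ _
  have hb : ∀ x ∈ T, gen k n q .b * x ∈ T := hclosed _ fun i j m l => by
    rw [← mul_assoc, mul_pow_of_qcomm gen_ba, smul_mul_assoc, mul_assoc,
      ← mul_assoc (gen k n q .b), ← pow_succ']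
    exact T.smul_mem _ (hmon _ _ _ _)
  have hc : ∀ x ∈ T, gen k n q .c * x ∈ T := hclosed _ fun i j m l => by
    have hcomm : Commute (gen k n q .c) (gen k n q .b ^ j) :=
      Commute.pow_right (gen_bc (k := k) (n := n) (q := q)).symm j
    rw [← mul_assoc, mul_pow_of_qcomm gen_ca, smul_mul_assoc, mul_assoc,
      ← mul_assoc (gen k n q .c), hcomm.eq, mul_assoc, ← mul_assoc (gen k n q .c), ← pow_succ']
    exact T.smul_mem _ (hmon _ _ _ _)
  have hd : ∀ x ∈ T, gen k n q .d * x ∈ T := hclosed _ fun i j m l => by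
    refine (gen_d_mul_pow_a_mem T ?_ _ (by simpa using hmon 0 j m l) ?_ i).2
    · rintro g (rfl | rfl | rfl)
      exacts [ha, hb, hc]
    · rw [← mul_assoc, mul_pow_of_qcomm gen_db, smul_mul_assoc, mul_assoc,
        ← mul_assoc (gen k n q .d), mul_pow_of_qcomm gen_dc, smul_mul_assoc, mul_assoc, ← pow_succ',
        mul_smul_comm]
      refine T.smul_mem _ (T.smul_mem _ ?_)
      simpa using hmon 0 j m (l + 1)
  rw [eq_top_iff]
  intro x _
  have h1 : (1 : Dn k n q) ∈ T := by simpa using hmon 0 0 0 0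
  have := apply_mem_of_gen (Algebra.lmul k (Dn k n q)) T (fun g u hu => by
    cases g
    exacts [ha u hu, hb u hu, hc u hu, hd u hu]) x h1
  simpa using this

/-- The exponents of `b` and `c` count only modulo `n`, and those of `a` and `d` must be below `n`.
Only spanning is needed, so the independence of the monomials plays no role. -/
theorem finiteDimensional_Dn [NeZero n] : FiniteDimensional k (Dn k n q) := by
  classical
  refine ⟨⟨(Finset.univ : Finset (Fin n × Fin n × Fin n × Fin n)).image (fun e =>
    gen k n q .a ^ e.1.val * (gen k n q .b ^ e.2.1.val * (gen k n q .c ^ e.2.2.1.val *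
      gen k n q .d ^ e.2.2.2.val))), ?_⟩⟩
  rw [eq_top_iff, ← span_monomials, Submodule.span_le]
  rintro _ ⟨⟨i, j, m, l⟩, rfl⟩
  have hpos : 0 < n := NeZero.pos n
  by_cases hi : i < n
  · by_cases hl : l < n
    · refine Submodule.subset_span ?_
      simp only [Finset.coe_image, Finset.coe_univ, Set.image_univ, Set.mem_range]
      refine ⟨(⟨i, hi⟩, ⟨j % n, Nat.mod_lt _ hpos⟩, ⟨m % n, Nat.mod_lt _ hpos⟩, ⟨l, hl⟩), ?_⟩
      have hb : gen k n q .b ^ (j % n) = gen k n q .b ^ j := by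
        conv_rhs => rw [← Nat.mod_add_div j n, pow_add, pow_mul, gen_bn, one_pow, mul_one]
      have hc : gen k n q .c ^ (m % n) = gen k n q .c ^ m := by
        conv_rhs => rw [← Nat.mod_add_div m n, pow_add, pow_mul, gen_cn, one_pow, mul_one]
      simp only [hb, hc]
    · have : gen k n q .d ^ l = 0 := pow_eq_zero_of_le (not_lt.mp hl) gen_dn
      simp [this]
  · have : gen k n q .a ^ i = 0 := pow_eq_zero_of_le (not_lt.mp hi) gen_an
    simp [this]

end Generation

/-! ### Intertwining maps -/

section Intertwines

variable {k : Type*} [Field k] {n : ℕ} {q : k}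

noncomputable instance {A V : Type*} [Ring A] [Algebra k A] [AddCommGroup V] [Module k V]
    (ρ : A →ₐ[k] Module.End k V) : Module k (RepMod ρ) := inferInstanceAs (Module k V)

instance {A V : Type*} [Ring A] [Algebra k A] [AddCommGroup V] [Module k V]
    (ρ : A →ₐ[k] Module.End k V) : IsScalarTower k A (RepMod ρ) :=
  ⟨fun c x v => by
    change ρ (c • x) v = c • ρ x v
    rw [map_smul]; rfl⟩

instance {A V : Type*} [Ring A] [Algebra k A] [AddCommGroup V] [Module k V]
    (ρ : A →ₐ[k] Module.End k V) [h : FiniteDimensional k V] : FiniteDimensional k (RepMod ρ) := h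

variable {U V W : Type*} [AddCommGroup U] [Module k U] [AddCommGroup V] [Module k V]
  [AddCommGroup W] [Module k W]
  {ρ : Dn k n q →ₐ[k] Module.End k U} {σ : Dn k n q →ₐ[k] Module.End k V}
  {τ : Dn k n q →ₐ[k] Module.End k W}

/-- The linear map `φ` commutes with the action of the generators. -/
def Intertwines (ρ : Dn k n q →ₐ[k] Module.End k U) (σ : Dn k n q →ₐ[k] Module.End k V)
    (φ : U →ₗ[k] V) : Prop :=
  ∀ g u, φ (ρ (gen k n q g) u) = σ (gen k n q g) (φ u)

theorem Intertwines.apply {φ : U →ₗ[k] V} (h : Intertwines ρ σ φ) (x : Dn k n q) (u : U) :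
    φ (ρ x u) = σ x (φ u) := by
  let B : Subalgebra k (Dn k n q) :=
    { carrier := {x | ∀ u, φ (ρ x u) = σ x (φ u)}
      mul_mem' := fun {x y} hx hy u => by
        rw [map_mul, map_mul, Module.End.mul_apply, Module.End.mul_apply, hx, hy]
      add_mem' := fun {x y} hx hy u => by
        rw [map_add, map_add, LinearMap.add_apply, LinearMap.add_apply, map_add, hx, hy]
      algebraMap_mem' := fun c u => by
        rw [AlgHom.commutes, AlgHom.commutes, Module.algebraMap_end_apply,
          Module.algebraMap_end_apply, map_smul] }
  have hB := subalgebra_eq_top B h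
  have : x ∈ B := hB ▸ trivial
  exact this u

/-- The map of `D_n`-modules defined by an intertwining map. -/
noncomputable def Intertwines.toHom {φ : U →ₗ[k] V} (h : Intertwines ρ σ φ) : RepMod ρ →ₗ[Dn k n q] RepMod σ where
  toFun := φ
  map_add' := φ.map_add
  map_smul' x u := h.apply x u

/-- A map of `D_n`-modules as a linear map. -/
noncomputable def homToLinear (f : RepMod ρ →ₗ[Dn k n q] RepMod σ) : U →ₗ[k] V := f.restrictScalars k

theorem homToLinear_intertwines (f : RepMod ρ →ₗ[Dn k n q] RepMod σ) :
    Intertwines ρ σ (homToLinear f) := fun g u => f.map_smul (gen k n q g) u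

/-- A short exact sequence of representations. -/
def ShortExact (ρ : Dn k n q →ₐ[k] Module.End k U) (σ : Dn k n q →ₐ[k] Module.End k V)
    (τ : Dn k n q →ₐ[k] Module.End k W) : Prop :=
  ∃ (i : U →ₗ[k] V) (p : V →ₗ[k] W), Intertwines ρ σ i ∧ Intertwines σ τ p ∧
    Function.Injective i ∧ Function.Surjective p ∧ Function.Exact i p

/-- Isomorphism of representations. -/
def Isomorphic (ρ : Dn k n q →ₐ[k] Module.End k U) (σ : Dn k n q →ₐ[k] Module.End k V) : Prop :=
  ∃ e : U ≃ₗ[k] V, Intertwines ρ σ e.toLinearMap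

/-- The quotient of a representation by a submodule of the associated module. -/
noncomputable def quotRep (ρ : Dn k n q →ₐ[k] Module.End k U) (K : Submodule (Dn k n q) (RepMod ρ)) :
    Dn k n q →ₐ[k] Module.End k (RepMod ρ ⧸ K) := Algebra.lsmul k k (RepMod ρ ⧸ K)

/-- The representation on a submodule of the module associated to a representation. -/
noncomputable def subRep (ρ : Dn k n q →ₐ[k] Module.End k U) (K : Submodule (Dn k n q) (RepMod ρ)) :
    Dn k n q →ₐ[k] Module.End k K := Algebra.lsmul k k K

/-- The quotient map as a linear map. -/
noncomputable def quotMk (ρ : Dn k n q →ₐ[k] Module.End k U) (K : Submodule (Dn k n q) (RepMod ρ)) :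
    U →ₗ[k] RepMod ρ ⧸ K := K.mkQ.restrictScalars k

theorem quotMk_intertwines (ρ : Dn k n q →ₐ[k] Module.End k U)
    (K : Submodule (Dn k n q) (RepMod ρ)) : Intertwines ρ (quotRep ρ K) (quotMk ρ K) :=
  fun _ _ => rfl

theorem quotMk_surjective (ρ : Dn k n q →ₐ[k] Module.End k U)
    (K : Submodule (Dn k n q) (RepMod ρ)) : Function.Surjective (quotMk ρ K) := K.mkQ_surjective

theorem quotMk_eq_zero (ρ : Dn k n q →ₐ[k] Module.End k U)
    (K : Submodule (Dn k n q) (RepMod ρ)) {u : U} : quotMk ρ K u = 0 ↔ (u : RepMod ρ) ∈ K :=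
  Submodule.Quotient.mk_eq_zero K

theorem shortExact_quot (ρ : Dn k n q →ₐ[k] Module.End k U)
    (K : Submodule (Dn k n q) (RepMod ρ)) : ShortExact (subRep ρ K) ρ (quotRep ρ K) :=
  ⟨K.subtype.restrictScalars k, quotMk ρ K, fun _ _ => rfl, quotMk_intertwines ρ K,
    K.injective_subtype, quotMk_surjective ρ K, fun u => by
      rw [quotMk_eq_zero]
      exact ⟨fun h => ⟨⟨u, h⟩, rfl⟩, fun ⟨x, hx⟩ => hx ▸ x.2⟩⟩

end Intertwines

/-! ### Additive functions -/

section Additive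

universe u

variable {k : Type u} [Field k] {n : ℕ} {q : k}

/-- A function on finite-dimensional representations that is additive on short exact sequences. -/
def IsAdditive (f : ∀ (U : Type u) [AddCommGroup U] [Module k U],
    (Dn k n q →ₐ[k] Module.End k U) → ℕ) : Prop :=
  ∀ (U V W : Type u) [AddCommGroup U] [Module k U] [AddCommGroup V] [Module k V]
    [AddCommGroup W] [Module k W] [FiniteDimensional k U] [FiniteDimensional k V]
    [FiniteDimensional k W] (ρ : Dn k n q →ₐ[k] Module.End k U)
    (σ : Dn k n q →ₐ[k] Module.End k V) (τ : Dn k n q →ₐ[k] Module.End k W),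
    ShortExact ρ σ τ → f V σ = f U ρ + f W τ

variable {f : ∀ (U : Type u) [AddCommGroup U] [Module k U], (Dn k n q →ₐ[k] Module.End k U) → ℕ}
  {U V W : Type u} [AddCommGroup U] [Module k U] [AddCommGroup V] [Module k V]
  [AddCommGroup W] [Module k W] [FiniteDimensional k U] [FiniteDimensional k V]
  {ρ : Dn k n q →ₐ[k] Module.End k U} {σ : Dn k n q →ₐ[k] Module.End k V}

/-- The zero module is an extension of itself by itself, so its value equals twice its value. -/
theorem IsAdditive.eq_zero (hf : IsAdditive f) [Subsingleton U] : f U ρ = 0 := by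
  have := hf U U U ρ ρ ρ ⟨LinearMap.id, LinearMap.id, fun _ _ => rfl, fun _ _ => rfl,
    fun _ _ h => h, fun x => ⟨x, rfl⟩, fun x => ⟨fun _ => ⟨x, rfl⟩, fun _ => Subsingleton.elim _ _⟩⟩
  omega

/-- An isomorphism is a short exact sequence whose third term is zero. -/
theorem IsAdditive.eq_of_isomorphic (hf : IsAdditive f) (h : Isomorphic ρ σ) : f U ρ = f V σ := by
  obtain ⟨e, he⟩ := h
  let τ : Dn k n q →ₐ[k] Module.End k PUnit.{u + 1} :=
    (Algebra.lsmul k k (PUnit.{u+1}))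
  have h0 := hf.eq_zero (ρ := τ)
  have := hf U V PUnit.{u + 1} ρ σ τ ⟨e.toLinearMap, 0, he, fun _ _ => rfl, e.injective,
    fun x => ⟨0, Subsingleton.elim _ _⟩, fun x => ⟨fun _ => e.surjective x, fun _ => rfl⟩⟩
  omega

/-- The function `dim Hom(P, -)` for a projective `D_n`-module `P` is additive. -/
theorem isAdditive_finrank_hom [NeZero n] (P : Type*) [AddCommGroup P] [Module (Dn k n q) P]
    [Module k P] [IsScalarTower k (Dn k n q) P] [FiniteDimensional k P]
    [Module.Projective (Dn k n q) P] :
    IsAdditive (n := n) (q := q) fun _ _ _ ρ => Module.finrank k (P →ₗ[Dn k n q] RepMod ρ) := by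
  intro U V W _ _ _ _ _ _ _ _ _ ρ σ τ ⟨i, p, hi, hp, h1, h2, h3⟩
  exact finrank_hom_of_exact hi.toHom hp.toHom h1 h2 h3

end Additive


/-! ### Highest weight vectors and the simple modules -/

section HighestWeight

variable {k : Type*} [Field k] {n : ℕ} {q : k}

theorem qpow_injective [NeZero n] (hq : IsPrimitiveRoot q n) :
    Function.Injective (qpow q : ZMod n → k) := fun x y h =>
  ZMod.val_injective n (hq.pow_inj (ZMod.val_lt x) (ZMod.val_lt y) h)

theorem qpow_ne_zero [NeZero n] (hq : IsPrimitiveRoot q n) (x : ZMod n) : qpow q x ≠ 0 :=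
  pow_ne_zero _ (hq.ne_zero (NeZero.ne n))

theorem qpow_zero : qpow q (0 : ZMod n) = 1 := by
  simp [qpow]

theorem qpow_neg [NeZero n] (hq : IsPrimitiveRoot q n) (x : ZMod n) :
    qpow q (-x) = (qpow q x)⁻¹ := by
  apply eq_inv_of_mul_eq_one_left
  rw [← qpow_add hq.pow_eq_one, neg_add_cancel, qpow_zero]

/-- This nonvanishing is why `d` descends all the way to the highest weight vector, and hence why
the modules `V(ℓ, r)` with `ℓ ≤ n` are simple. -/
theorem alpha_ne_zero (hq : IsPrimitiveRoot q n) {ℓ i : ℕ} (hℓ : ℓ ≤ n) (h0 : 0 < i)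
    (hi : i < ℓ) : alpha q ℓ i ≠ 0 := by
  have hq0 : q ≠ 0 := hq.ne_zero (by omega)
  have hq1 : q ≠ 1 := by
    rintro rfl
    have := hq.unique IsPrimitiveRoot.one
    omega
  refine div_ne_zero (mul_ne_zero ?_ ?_) (sub_ne_zero.mpr hq1)
  · exact sub_ne_zero.mpr (hq.pow_ne_one_of_pos_of_lt h0.ne' (by omega))
  · rw [sub_ne_zero]
    intro h
    have h2 : q ^ (ℓ - i) = 1 := by
      rw [show (i : ℤ) - ℓ = -((ℓ - i : ℕ) : ℤ) by omega, zpow_neg, zpow_natCast] at h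
      rw [← inv_inv (q ^ (ℓ - i)), ← h, inv_one]
    exact hq.pow_ne_one_of_pos_of_lt (by omega) (by omega) h2

variable {U V : Type*} [AddCommGroup U] [Module k U] [AddCommGroup V] [Module k V]

/-- `v` is a highest weight vector with the weight of the generating vector of `V(ℓ, r)`. -/
structure IsHighestWeight (ρ : Dn k n q →ₐ[k] Module.End k U) (ℓ : ℕ) (r : ZMod n) (v : U) :
    Prop where
  b : ρ (gen k n q .b) v = qpow q r • v
  c : ρ (gen k n q .c) v = qpow q (1 - (r + (ℓ : ZMod n))) • v
  d : ρ (gen k n q .d) v = 0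

variable {ρ : Dn k n q →ₐ[k] Module.End k U} {σ : Dn k n q →ₐ[k] Module.End k V} {ℓ : ℕ}
  {r : ZMod n} {v : U}

theorem IsHighestWeight.map {φ : U →ₗ[k] V} (h : IsHighestWeight ρ ℓ r v)
    (hφ : Intertwines ρ σ φ) : IsHighestWeight σ ℓ r (φ v) where
  b := by rw [← hφ, h.b, map_smul]
  c := by rw [← hφ, h.c, map_smul]
  d := by rw [← hφ, h.d, map_zero]

theorem apply_ba (ρ : Dn k n q →ₐ[k] Module.End k U) (u : U) :
    ρ (gen k n q .b) (ρ (gen k n q .a) u) = q • ρ (gen k n q .a) (ρ (gen k n q .b) u) := by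
  rw [← Module.End.mul_apply, ← map_mul, gen_ba, map_smul, map_mul]; rfl

theorem apply_ca (ρ : Dn k n q →ₐ[k] Module.End k U) (u : U) :
    ρ (gen k n q .c) (ρ (gen k n q .a) u) = q • ρ (gen k n q .a) (ρ (gen k n q .c) u) := by
  rw [← Module.End.mul_apply, ← map_mul, gen_ca, map_smul, map_mul]; rfl

theorem apply_da (ρ : Dn k n q →ₐ[k] Module.End k U) (u : U) :
    ρ (gen k n q .d) (ρ (gen k n q .a) u) = q • ρ (gen k n q .a) (ρ (gen k n q .d) u)
      + (u - ρ (gen k n q .b) (ρ (gen k n q .c) u)) := by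
  have e : gen k n q .d * gen k n q .a
      = q • (gen k n q .a * gen k n q .d) + (1 - gen k n q .b * gen k n q .c) := by
    rw [← gen_da]; abel
  rw [← Module.End.mul_apply, ← map_mul, e, map_add, map_smul, map_sub, map_mul, map_mul, map_one]
  rfl

theorem apply_a_pow_n (ρ : Dn k n q →ₐ[k] Module.End k U) : ρ (gen k n q .a) ^ n = 0 := by
  rw [← map_pow, gen_an, map_zero]

theorem b_pow_a (hq : q ^ n = 1) [NeZero n] (hb : ρ (gen k n q .b) v = qpow q r • v) (i : ℕ) :
    ρ (gen k n q .b) ((ρ (gen k n q .a) ^ i) v)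
      = qpow q (r + (i : ZMod n)) • (ρ (gen k n q .a) ^ i) v := by
  induction i with
  | zero => simpa using hb
  | succ i ih =>
    rw [pow_succ', Module.End.mul_apply, apply_ba, ih, map_smul, smul_smul]
    congr 1
    rw [Nat.cast_succ, ← add_assoc, qpow_add hq _ 1, qpow_one hq, mul_comm]

theorem c_pow_a (hq : q ^ n = 1) [NeZero n]
    (hc : ρ (gen k n q .c) v = qpow q (1 - (r + (ℓ : ZMod n))) • v) (i : ℕ) :
    ρ (gen k n q .c) ((ρ (gen k n q .a) ^ i) v)
      = qpow q (((i + 1 : ℕ) : ZMod n) - (r + (ℓ : ZMod n))) • (ρ (gen k n q .a) ^ i) v := by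
  induction i with
  | zero => simpa using hc
  | succ i ih =>
    rw [pow_succ', Module.End.mul_apply, apply_ca, ih, map_smul, smul_smul]
    congr 1
    rw [show ((i + 1 + 1 : ℕ) : ZMod n) - (r + (ℓ : ZMod n))
      = ((i + 1 : ℕ) : ZMod n) - (r + (ℓ : ZMod n)) + 1 by push_cast; ring, qpow_add hq _ 1,
      qpow_one hq, mul_comm]

/-- Passing `d` through one more `a` gives scalars with the recursion of `alpha_step`. The string `a
^ i v` of any highest weight vector thus behaves as in `V(ℓ, r)`, except that `a ^ ℓ v` need not
vanish. -/
theorem IsHighestWeight.d_pow_a [NeZero n] (hq : IsPrimitiveRoot q n) (hq1 : q ≠ 1)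
    (h : IsHighestWeight ρ ℓ r v) (i : ℕ) :
    ρ (gen k n q .d) ((ρ (gen k n q .a) ^ (i + 1)) v)
      = alpha q ℓ (i + 1) • (ρ (gen k n q .a) ^ i) v := by
  have key : ∀ i, ρ (gen k n q .a) ((ρ (gen k n q .d)) ((ρ (gen k n q .a) ^ i) v))
      = alpha q ℓ i • (ρ (gen k n q .a) ^ i) v → ρ (gen k n q .d) ((ρ (gen k n q .a) ^ (i + 1)) v)
      = alpha q ℓ (i + 1) • (ρ (gen k n q .a) ^ i) v := by
    intro i hi
    rw [pow_succ', Module.End.mul_apply, apply_da, hi, c_pow_a hq.pow_eq_one h.c, map_smul,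
      b_pow_a hq.pow_eq_one h.b, smul_smul, smul_smul, mul_comm (qpow q _),
      qpow_bc hq.pow_eq_one (hq.ne_zero (NeZero.ne n))]
    have hs := alpha_step (hq.ne_zero (NeZero.ne n)) hq1 ℓ i
    rw [sub_eq_iff_eq_add] at hs
    rw [hs]
    module
  induction i with
  | zero => exact key 0 (by simp [h.d, alpha])
  | succ i ih =>
    refine key _ ?_
    rw [ih, map_smul, pow_succ' _ i, Module.End.mul_apply]

/-- The linear map `k ^ ℓ → U` sending the basis vector `v_{i+1}` to `a ^ i v`. -/
noncomputable def hwMap (ρ : Dn k n q →ₐ[k] Module.End k U) (ℓ : ℕ) (v : U) : (Fin ℓ → k) →ₗ[k] U :=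
  (Pi.basisFun k (Fin ℓ)).constr k fun i => (ρ (gen k n q .a) ^ i.val) v

theorem vec_eq_basisFun {ℓ i : ℕ} (hi : i < ℓ) : vec k ℓ i = Pi.basisFun k (Fin ℓ) ⟨i, hi⟩ := by
  funext t
  simp [vec, Pi.basisFun_apply, Pi.single_apply, Fin.ext_iff]

theorem hwMap_vec_of_lt {i : ℕ} (hi : i < ℓ) :
    hwMap ρ ℓ v (vec k ℓ i) = (ρ (gen k n q .a) ^ i) v := by
  rw [vec_eq_basisFun hi, hwMap, Module.Basis.constr_basis]

theorem linearMap_ext {ℓ : ℕ} {f g : (Fin ℓ → k) →ₗ[k] U}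
    (h : ∀ i, i < ℓ → f (vec k ℓ i) = g (vec k ℓ i)) : f = g := by
  refine (Pi.basisFun k (Fin ℓ)).ext fun i => ?_
  rw [← vec_eq_basisFun i.isLt]
  exact h i i.isLt

/-- Beyond `ℓ` both sides vanish, so the end of the string needs no separate treatment afterwards.
-/
theorem hwMap_vec (h0 : (ρ (gen k n q .a) ^ ℓ) v = 0) (i : ℕ) :
    hwMap ρ ℓ v (vec k ℓ i) = (ρ (gen k n q .a) ^ i) v := by
  by_cases hi : i < ℓ
  · exact hwMap_vec_of_lt hi
  · rw [vec_eq_zero (not_lt.mp hi), map_zero, ← Nat.sub_add_cancel (not_lt.mp hi), pow_add,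
      Module.End.mul_apply, h0, map_zero]

theorem intertwines_of_vec {ℓ : ℕ} {ρ : Dn k n q →ₐ[k] Module.End k (Fin ℓ → k)}
    {φ : (Fin ℓ → k) →ₗ[k] U} {σ : Dn k n q →ₐ[k] Module.End k U}
    (h : ∀ g i, i < ℓ → φ (ρ (gen k n q g) (vec k ℓ i)) = σ (gen k n q g) (φ (vec k ℓ i))) :
    Intertwines ρ σ φ := fun g u => by
  have : φ.comp (ρ (gen k n q g)) = (σ (gen k n q g)).comp φ := linearMap_ext (h g)
  exact DFunLike.congr_fun this u

theorem hwMap_intertwines [NeZero n] (hq : IsPrimitiveRoot q n) (hq1 : q ≠ 1) (hℓ : ℓ ≤ n)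
    (h : IsHighestWeight ρ ℓ r v) (h0 : (ρ (gen k n q .a) ^ ℓ) v = 0) :
    Intertwines (simpleRep hq ℓ hℓ r) ρ (hwMap ρ ℓ v) := by
  refine intertwines_of_vec fun g i _ => ?_
  rw [simpleRep_gen]
  cases g with
  | a => rw [simpleGen_a, hwMap_vec h0, hwMap_vec h0, pow_succ', Module.End.mul_apply]
  | b => rw [simpleGen_b, map_smul, hwMap_vec h0, b_pow_a hq.pow_eq_one h.b]
  | c => rw [simpleGen_c, map_smul, hwMap_vec h0, c_pow_a hq.pow_eq_one h.c]
  | d =>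
    cases i with
    | zero => rw [simpleGen_d_zero, map_zero, hwMap_vec h0, pow_zero, Module.End.one_apply, h.d]
    | succ i => rw [simpleGen_d_succ, map_smul, hwMap_vec h0, hwMap_vec h0, h.d_pow_a hq hq1]

theorem isHighestWeight_vec [NeZero n] (hq : IsPrimitiveRoot q n) (hℓ : ℓ ≤ n) (r : ZMod n) :
    IsHighestWeight (simpleRep hq ℓ hℓ r) ℓ r (vec k ℓ 0) where
  b := by rw [simpleRep_gen, simpleGen_b]; simp
  c := by rw [simpleRep_gen, simpleGen_c]; simp
  d := by rw [simpleRep_gen, simpleGen_d_zero]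

theorem apply_eq_sum_vec {ℓ : ℕ} (x : Fin ℓ → k) : x = ∑ i : Fin ℓ, x i • vec k ℓ i.val := by
  conv_lhs => rw [← (Pi.basisFun k (Fin ℓ)).sum_repr x]
  refine Finset.sum_congr rfl fun i _ => ?_
  rw [vec_eq_basisFun i.isLt]
  simp

theorem simpleGen_d_apply (x : Fin ℓ → k) (i : ℕ) (hi : i + 1 < ℓ) :
    simpleGen q ℓ r .d x ⟨i, by omega⟩ = alpha q ℓ (i + 1) * x ⟨i + 1, hi⟩ := by
  conv_lhs => rw [apply_eq_sum_vec x]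
  rw [map_sum, Finset.sum_apply, Finset.sum_eq_single ⟨i + 1, hi⟩]
  · rw [map_smul, simpleGen_d_succ]
    simp [vec, mul_comm]
  · rintro ⟨t, ht⟩ _ hne
    rw [map_smul]
    cases t with
    | zero => simp [simpleGen_d_zero]
    | succ t =>
      rw [simpleGen_d_succ]
      have : i ≠ t := fun h => hne (by simp [h])
      simp [vec, this]
  · simp

/-- The kernel of `d` on `V(ℓ, r)` is spanned by the highest weight vector. -/
theorem eq_smul_of_d_eq_zero (hq : IsPrimitiveRoot q n) (hℓ : ℓ ≤ n) (h1 : 0 < ℓ) {x : Fin ℓ → k}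
    (hx : simpleGen q ℓ r .d x = 0) : x = x ⟨0, h1⟩ • vec k ℓ 0 := by
  funext t
  obtain ⟨t, ht⟩ := t
  cases t with
  | zero => simp [vec]
  | succ t =>
    have := simpleGen_d_apply (q := q) (r := r) x t ht
    rw [hx] at this
    have h0 := (mul_eq_zero.mp this.symm).resolve_left (alpha_ne_zero hq hℓ (Nat.succ_pos t) ht)
    simp [vec, h0]

/-- Every nonzero subspace of `V(ℓ, r)` stable under `d` contains the highest weight vector. -/
theorem vec_zero_mem_of_d_stable (hq : IsPrimitiveRoot q n) (hℓ : ℓ ≤ n)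
    (T : Submodule k (Fin ℓ → k)) (hT : ∀ x ∈ T, simpleGen q ℓ r .d x ∈ T) {x : Fin ℓ → k}
    (hx : x ∈ T) (hx0 : x ≠ 0) : vec k ℓ 0 ∈ T := by
  have h1 : 0 < ℓ := by
    rcases Nat.eq_zero_or_pos ℓ with rfl | h
    · exact absurd (Subsingleton.elim x 0) hx0
    · exact h
  -- Induction on a bound `m` for the support of `x`. Applying `d` lowers the bound by one; if `d`
  -- kills `x`, then `x` is already a multiple of `vec k ℓ 0`.
  have key : ∀ m, ∀ x ∈ T, x ≠ 0 → (∀ t : Fin ℓ, m < t.val → x t = 0) → vec k ℓ 0 ∈ T := by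
    intro m
    induction m with
    | zero =>
      intro x hx hx0 hm
      have e : x = x ⟨0, h1⟩ • vec k ℓ 0 := by
        funext t
        obtain ⟨t, ht⟩ := t
        cases t with
        | zero => simp [vec]
        | succ t => simp [vec, hm ⟨t + 1, ht⟩ (Nat.succ_pos t)]
      have hne : x ⟨0, h1⟩ ≠ 0 := fun h => hx0 (by rw [e, h, zero_smul])
      rw [e] at hx
      exact (T.smul_mem_iff hne).mp hx
    | succ m ih =>
      intro x hx hx0 hm
      by_cases hd : simpleGen q ℓ r .d x = 0
      · refine ih x hx hx0 fun t ht => ?_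
        rw [eq_smul_of_d_eq_zero hq hℓ h1 hd]
        simp [vec, show t.val ≠ 0 by omega]
      · refine ih _ (hT x hx) hd fun t ht => ?_
        by_cases hlt : t.val + 1 < ℓ
        · rw [simpleGen_d_apply x t.val hlt, hm _ (by simpa using ht), mul_zero]
        · have : simpleGen q ℓ r .d x t = 0 := by
            conv_lhs => rw [apply_eq_sum_vec x]
            rw [map_sum, Finset.sum_apply]
            refine Finset.sum_eq_zero fun s _ => ?_
            rw [map_smul]
            obtain ⟨s, hs⟩ := s
            cases s with
            | zero => simp [simpleGen_d_zero]
            | succ s => rw [simpleGen_d_succ]; simp [vec, show t.val ≠ s by omega]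
          exact this
  exact key ℓ x hx hx0 fun t ht => absurd t.isLt (by omega)

/-- An intertwining map out of `V(ℓ, r)` that does not kill the highest weight vector is
injective. -/
theorem injective_of_apply_vec_zero [NeZero n] (hq : IsPrimitiveRoot q n) (hℓ : ℓ ≤ n)
    {φ : (Fin ℓ → k) →ₗ[k] U} (hφ : Intertwines (simpleRep hq ℓ hℓ r) ρ φ)
    (h0 : φ (vec k ℓ 0) ≠ 0) : Function.Injective φ := by
  rw [← LinearMap.ker_eq_bot, Submodule.eq_bot_iff]
  intro x hx
  by_contra hx0
  refine h0 (vec_zero_mem_of_d_stable (r := r) hq hℓ (LinearMap.ker φ) (fun y hy => ?_) hx hx0)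
  have := hφ .d y
  rw [simpleRep_gen, LinearMap.mem_ker.mp hy, map_zero] at this
  exact this

/-- A nonzero submodule contains `vec k ℓ 0`, obtained by lowering with `d`, and `a` raises this
vector to all the others. -/
theorem isSimpleModule_simpleRep [NeZero n] (hq : IsPrimitiveRoot q n) (hℓ : ℓ ≤ n) (h1 : 0 < ℓ)
    (r : ZMod n) : IsSimpleModule (Dn k n q) (RepMod (simpleRep hq ℓ hℓ r)) := by
  have hv : vec k ℓ 0 ≠ 0 := fun h => by
    have := congrFun h ⟨0, h1⟩
    simp [vec] at this
  have : Nontrivial (RepMod (simpleRep hq ℓ hℓ r)) := ⟨⟨_, _, hv⟩⟩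
  refine { eq_bot_or_eq_top := fun K => ?_ }
  by_cases hK : K = ⊥
  · exact Or.inl hK
  · right
    obtain ⟨x, hx, hx0⟩ := Submodule.exists_mem_ne_zero_of_ne_bot hK
    let T : Submodule k (Fin ℓ → k) := K.restrictScalars k
    have hT : ∀ g, ∀ y ∈ T, simpleGen q ℓ r g y ∈ T := by
      intro g y hy
      rw [← simpleRep_gen hq ℓ hℓ r g]
      exact K.smul_mem (gen k n q g) hy
    have h0 : vec k ℓ 0 ∈ T := vec_zero_mem_of_d_stable hq hℓ T (hT .d) hx hx0
    have hi : ∀ i, vec k ℓ i ∈ T := by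
      intro i
      induction i with
      | zero => exact h0
      | succ i ih => rw [← simpleGen_a (q := q) (r := r)]; exact hT .a _ ih
    rw [eq_top_iff]
    intro y _
    have : (y : Fin ℓ → k) ∈ T := by
      rw [apply_eq_sum_vec y]
      exact T.sum_mem fun i _ => T.smul_mem _ (hi i)
    exact this

/-- The image of `V(ℓ, r)` does not contain nonzero vectors killed by `d` of other weights. -/
theorem notMem_range_of_weight_ne [NeZero n] (hq : IsPrimitiveRoot q n) (hℓ : ℓ ≤ n) (h1 : 0 < ℓ)
    {φ : (Fin ℓ → k) →ₗ[k] U} (hφ : Intertwines (simpleRep hq ℓ hℓ r) ρ φ)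
    (hinj : Function.Injective φ) {r' : ZMod n} (hr : r' ≠ r) {u : U} (hu : u ≠ 0)
    (hb : ρ (gen k n q .b) u = qpow q r' • u) (hd : ρ (gen k n q .d) u = 0) :
    u ∉ LinearMap.range φ := by
  rintro ⟨x, rfl⟩
  -- A preimage is also killed by `d`, so it lies on the line of `vec k ℓ 0`, where `b` acts by `q ^
  -- r`; exponents modulo `n` are determined by these powers.
  have hx : simpleGen q ℓ r .d x = 0 := by
    apply hinj
    rw [map_zero, ← hd, ← hφ, simpleRep_gen]
  have e := eq_smul_of_d_eq_zero hq hℓ h1 hx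
  have hb' : simpleGen q ℓ r .b x = qpow q r' • x := by
    apply hinj
    rw [map_smul, ← hb, ← hφ, simpleRep_gen]
  have hb2 : simpleGen q ℓ r .b x = qpow q r • x := by
    have h := congrArg (simpleGen q ℓ r .b) e
    rwa [map_smul, simpleGen_b, smul_comm, Nat.cast_zero, add_zero, ← e] at h
  have hx0 : x ≠ 0 := fun h => hu (by rw [h, map_zero])
  rw [hb2] at hb'
  exact hr (qpow_injective hq (smul_left_injective k hx0 hb').symm)

/-- The modules `V(ℓ, r)` are pairwise non-isomorphic. -/
theorem eq_of_nonempty_equiv [NeZero n] (hq : IsPrimitiveRoot q n) {x y : Fin n × ZMod n}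
    (h : Nonempty (RepMod (simpleAt hq x) ≃ₗ[Dn k n q] RepMod (simpleAt hq y))) : x = y := by
  obtain ⟨e⟩ := h
  -- The dimension determines the first index; the weight of the vector killed by `d` then
  -- determines the second.
  have h1 : x.1 = y.1 := by
    have := LinearEquiv.finrank_eq (e.restrictScalars k)
    have h2 : Module.finrank k (Fin (x.1.val + 1) → k) = Module.finrank k (Fin (y.1.val + 1) → k) :=
      this
    simp only [Module.finrank_fintype_fun_eq_card, Fintype.card_fin] at h2
    exact Fin.ext (by omega)
  refine Prod.ext h1 ?_
  by_contra hne
  have hv : vec k (y.1.val + 1) 0 ≠ 0 := fun h => by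
    have := congrFun h ⟨0, Nat.succ_pos _⟩
    simp [vec] at this
  have hw := isHighestWeight_vec hq y.1.isLt y.2
  exact notMem_range_of_weight_ne hq x.1.isLt (Nat.succ_pos _)
    (homToLinear_intertwines e.toLinearMap) e.injective (Ne.symm hne) hv hw.b hw.d
    (e.surjective _)

end HighestWeight


/-! ### Tensor products of representations -/

section Tensor

variable {k : Type*} [Field k] {n : ℕ} [NeZero n] {q : k} (hq : IsPrimitiveRoot q n)
  {U V W X : Type*} [AddCommGroup U] [Module k U] [AddCommGroup V] [Module k V]
  [AddCommGroup W] [Module k W] [AddCommGroup X] [Module k X]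
  (ρ : Dn k n q →ₐ[k] Module.End k U) (σ : Dn k n q →ₐ[k] Module.End k V)
  (τ : Dn k n q →ₐ[k] Module.End k W) (υ : Dn k n q →ₐ[k] Module.End k X)

theorem tensorRep_a (u : U) (v : V) : tensorRep hq ρ σ (gen k n q .a) (u ⊗ₜ v)
    = ρ (gen k n q .a) u ⊗ₜ σ (gen k n q .b) v + u ⊗ₜ σ (gen k n q .a) v := by
  simp [tensorRep, comul_gen, comulGen]
  rfl

theorem tensorRep_b (u : U) (v : V) : tensorRep hq ρ σ (gen k n q .b) (u ⊗ₜ v)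
    = ρ (gen k n q .b) u ⊗ₜ σ (gen k n q .b) v := by
  simp [tensorRep, comul_gen, comulGen]
  rfl

theorem tensorRep_c (u : U) (v : V) : tensorRep hq ρ σ (gen k n q .c) (u ⊗ₜ v)
    = ρ (gen k n q .c) u ⊗ₜ σ (gen k n q .c) v := by
  simp [tensorRep, comul_gen, comulGen]
  rfl

theorem tensorRep_d (u : U) (v : V) : tensorRep hq ρ σ (gen k n q .d) (u ⊗ₜ v)
    = ρ (gen k n q .d) u ⊗ₜ σ (gen k n q .c) v + u ⊗ₜ σ (gen k n q .d) v := by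
  simp [tensorRep, comul_gen, comulGen]
  rfl

variable {ρ σ τ υ}

/-- Intertwining can be checked on pure tensors. -/
theorem intertwines_of_tmul {φ : U ⊗[k] V →ₗ[k] W}
    (h : ∀ g u v, φ (tensorRep hq ρ σ (gen k n q g) (u ⊗ₜ v)) = τ (gen k n q g) (φ (u ⊗ₜ v))) :
    Intertwines (tensorRep hq ρ σ) τ φ := fun g z => by
  have : φ.comp (tensorRep hq ρ σ (gen k n q g)) = (τ (gen k n q g)).comp φ :=
    TensorProduct.ext' (h g)
  exact DFunLike.congr_fun this z

theorem Intertwines.map {φ : U →ₗ[k] W} {ψ : V →ₗ[k] X} (hφ : Intertwines ρ τ φ)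
    (hψ : Intertwines σ υ ψ) :
    Intertwines (tensorRep hq ρ σ) (tensorRep hq τ υ) (TensorProduct.map φ ψ) := by
  refine intertwines_of_tmul hq fun g u v => ?_
  cases g <;> simp only [tensorRep_a, tensorRep_b, tensorRep_c, tensorRep_d, map_add,
    TensorProduct.map_tmul, hφ _ _, hψ _ _]

omit [NeZero n] in
theorem intertwines_id : Intertwines ρ ρ LinearMap.id := fun _ _ => rfl

theorem Intertwines.rTensor {φ : U →ₗ[k] W} (hφ : Intertwines ρ τ φ) :
    Intertwines (tensorRep hq ρ σ) (tensorRep hq τ σ) (φ.rTensor V) :=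
  hφ.map hq intertwines_id

theorem Intertwines.lTensor {ψ : V →ₗ[k] X} (hψ : Intertwines σ υ ψ) :
    Intertwines (tensorRep hq ρ σ) (tensorRep hq ρ υ) (ψ.lTensor U) :=
  intertwines_id.map hq hψ

theorem ShortExact.rTensor (h : ShortExact ρ σ τ) :
    ShortExact (tensorRep hq ρ υ) (tensorRep hq σ υ) (tensorRep hq τ υ) := by
  obtain ⟨i, p, hi, hp, h1, h2, h3⟩ := h
  exact ⟨i.rTensor X, p.rTensor X, hi.rTensor hq, hp.rTensor hq,
    Module.Flat.rTensor_preserves_injective_linearMap i h1, LinearMap.rTensor_surjective X h2,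
    rTensor_exact X h3 h2⟩

theorem ShortExact.lTensor (h : ShortExact ρ σ τ) :
    ShortExact (tensorRep hq υ ρ) (tensorRep hq υ σ) (tensorRep hq υ τ) := by
  obtain ⟨i, p, hi, hp, h1, h2, h3⟩ := h
  exact ⟨i.lTensor X, p.lTensor X, hi.lTensor hq, hp.lTensor hq,
    Module.Flat.lTensor_preserves_injective_linearMap i h1, LinearMap.lTensor_surjective X h2,
    lTensor_exact X h3 h2⟩

variable (ρ σ τ)

/-- The tensor product of representations is associative. -/
theorem isomorphic_assoc : Isomorphic (tensorRep hq (tensorRep hq ρ σ) τ)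
    (tensorRep hq ρ (tensorRep hq σ τ)) := by
  refine ⟨TensorProduct.assoc k U V W, intertwines_of_tmul hq fun g z w => ?_⟩
  induction z using TensorProduct.induction_on with
  | zero => simp
  | add x y hx hy => rw [TensorProduct.add_tmul, map_add, map_add, hx, hy, map_add, map_add]
  | tmul u v =>
    cases g <;> simp [tensorRep_a, tensorRep_b, tensorRep_c, tensorRep_d, TensorProduct.add_tmul,
      TensorProduct.tmul_add, add_assoc]

end Tensor

/-! ### Additive functions composed with tensor products -/

section AdditiveTensor

universe u

variable {k : Type u} [Field k] {n : ℕ} [NeZero n] {q : k} (hq : IsPrimitiveRoot q n)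
  {f : ∀ (U : Type u) [AddCommGroup U] [Module k U], (Dn k n q →ₐ[k] Module.End k U) → ℕ}
  {X : Type u} [AddCommGroup X] [Module k X] [FiniteDimensional k X]

theorem IsAdditive.rTensor (hf : IsAdditive f) (υ : Dn k n q →ₐ[k] Module.End k X) :
    IsAdditive (n := n) (q := q) fun U _ _ ρ => f (U ⊗[k] X) (tensorRep hq ρ υ) := by
  intro U V W _ _ _ _ _ _ _ _ _ ρ σ τ h
  exact hf _ _ _ _ _ _ (h.rTensor hq)

theorem IsAdditive.lTensor (hf : IsAdditive f) (υ : Dn k n q →ₐ[k] Module.End k X) :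
    IsAdditive (n := n) (q := q) fun U _ _ ρ => f (X ⊗[k] U) (tensorRep hq υ ρ) := by
  intro U V W _ _ _ _ _ _ _ _ _ ρ σ τ h
  exact hf _ _ _ _ _ _ (h.lTensor hq)

end AdditiveTensor

/-! ### Duality -/

section Duality

variable {k : Type*} [Field k] {n : ℕ} [NeZero n] {q : k} (hq : IsPrimitiveRoot q n)
  {U V V' W X : Type*} [AddCommGroup U] [Module k U] [AddCommGroup V] [Module k V]
  [AddCommGroup V'] [Module k V'] [AddCommGroup W] [Module k W] [AddCommGroup X] [Module k X]

/-- The pairing `V' × V → k` given by `B` is invariant, so that `V'` is dual to `V`. -/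
structure IsInvariant (σ' : Dn k n q →ₐ[k] Module.End k V') (σ : Dn k n q →ₐ[k] Module.End k V)
    (B : V' →ₗ[k] V →ₗ[k] k) : Prop where
  b : ∀ x y, B (σ' (gen k n q .b) x) (σ (gen k n q .b) y) = B x y
  c : ∀ x y, B (σ' (gen k n q .c) x) (σ (gen k n q .c) y) = B x y
  a : ∀ x y, B (σ' (gen k n q .a) x) (σ (gen k n q .b) y) + B x (σ (gen k n q .a) y) = 0
  d : ∀ x y, B (σ' (gen k n q .d) x) (σ (gen k n q .c) y) + B x (σ (gen k n q .d) y) = 0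

variable [FiniteDimensional k V]

/-- The isomorphism `W ⊗ V' ≃ Hom(V, W)` for `V'` dual to `V`. -/
noncomputable def tensorDualEquiv (W : Type*) [AddCommGroup W] [Module k W]
    (B : V' ≃ₗ[k] Module.Dual k V) : W ⊗[k] V' ≃ₗ[k] (V →ₗ[k] W) :=
  TensorProduct.comm k W V' ≪≫ₗ TensorProduct.congr B (LinearEquiv.refl k W) ≪≫ₗ
    dualTensorHomEquiv k V W

theorem tensorDualEquiv_tmul (B : V' ≃ₗ[k] Module.Dual k V) (w : W) (x : V') (y : V) :
    tensorDualEquiv W B (w ⊗ₜ x) y = B x y • w := by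
  simp [tensorDualEquiv]

theorem tensorDualEquiv_rTensor (B : V' ≃ₗ[k] Module.Dual k V) (φ : W →ₗ[k] X) (z : W ⊗[k] V')
    (y : V) : tensorDualEquiv X B (φ.rTensor V' z) y = φ (tensorDualEquiv W B z y) := by
  induction z using TensorProduct.induction_on with
  | zero => simp
  | add x y hx hy => simp only [map_add, LinearMap.add_apply, hx, hy]
  | tmul w x => simp [tensorDualEquiv_tmul]

variable {ρ : Dn k n q →ₐ[k] Module.End k U} {σ : Dn k n q →ₐ[k] Module.End k V}
  {σ' : Dn k n q →ₐ[k] Module.End k V'} {τ : Dn k n q →ₐ[k] Module.End k W}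
  {B : V' ≃ₗ[k] Module.Dual k V}

/-- This identity and its analogues for `c`, `a`, `d` describe the action on `W ⊗ V'` inside `Hom(V,
W)`. The argument is `b y` or `c y` because the coproducts of `a` and `d` carry `b` and `c` in the
second factor; in this form neither an antipode nor inverses are needed. -/
theorem tensorDualEquiv_b (hB : IsInvariant σ' σ B.toLinearMap) (z : W ⊗[k] V') (y : V) :
    tensorDualEquiv W B (tensorRep hq τ σ' (gen k n q .b) z) (σ (gen k n q .b) y)
      = τ (gen k n q .b) (tensorDualEquiv W B z y) := by
  induction z using TensorProduct.induction_on with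
  | zero => simp
  | add x y hx hy => simp only [map_add, LinearMap.add_apply, hx, hy]
  | tmul w x =>
    have := hB.b x y
    simp only [LinearEquiv.coe_coe] at this
    simp [tensorRep_b, tensorDualEquiv_tmul, this]

theorem tensorDualEquiv_c (hB : IsInvariant σ' σ B.toLinearMap) (z : W ⊗[k] V') (y : V) :
    tensorDualEquiv W B (tensorRep hq τ σ' (gen k n q .c) z) (σ (gen k n q .c) y)
      = τ (gen k n q .c) (tensorDualEquiv W B z y) := by
  induction z using TensorProduct.induction_on with
  | zero => simp
  | add x y hx hy => simp only [map_add, LinearMap.add_apply, hx, hy]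
  | tmul w x =>
    have := hB.c x y
    simp only [LinearEquiv.coe_coe] at this
    simp [tensorRep_c, tensorDualEquiv_tmul, this]

theorem tensorDualEquiv_a (hB : IsInvariant σ' σ B.toLinearMap) (z : W ⊗[k] V') (y : V) :
    tensorDualEquiv W B (tensorRep hq τ σ' (gen k n q .a) z) (σ (gen k n q .b) y)
      + tensorDualEquiv W B z (σ (gen k n q .a) y)
      = τ (gen k n q .a) (tensorDualEquiv W B z y) := by
  induction z using TensorProduct.induction_on with
  | zero => simp
  | add x y hx hy => simp only [map_add, LinearMap.add_apply, ← hx, ← hy]; abel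
  | tmul w x =>
    have h1 := hB.a x y
    have h2 := hB.b x y
    simp only [LinearEquiv.coe_coe] at h1 h2
    rw [tensorRep_a, map_add, LinearMap.add_apply, tensorDualEquiv_tmul, tensorDualEquiv_tmul,
      tensorDualEquiv_tmul, tensorDualEquiv_tmul, h2, add_assoc, ← add_smul, h1, zero_smul,
      add_zero, map_smul]

theorem tensorDualEquiv_d (hB : IsInvariant σ' σ B.toLinearMap) (z : W ⊗[k] V') (y : V) :
    tensorDualEquiv W B (tensorRep hq τ σ' (gen k n q .d) z) (σ (gen k n q .c) y)
      + tensorDualEquiv W B z (σ (gen k n q .d) y)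
      = τ (gen k n q .d) (tensorDualEquiv W B z y) := by
  induction z using TensorProduct.induction_on with
  | zero => simp
  | add x y hx hy => simp only [map_add, LinearMap.add_apply, ← hx, ← hy]; abel
  | tmul w x =>
    have h1 := hB.d x y
    have h2 := hB.c x y
    simp only [LinearEquiv.coe_coe] at h1 h2
    rw [tensorRep_d, map_add, LinearMap.add_apply, tensorDualEquiv_tmul, tensorDualEquiv_tmul,
      tensorDualEquiv_tmul, tensorDualEquiv_tmul, h2, add_assoc, ← add_smul, h1, zero_smul,
      add_zero, map_smul]

/-- The adjunction between `- ⊗ V` and `- ⊗ V'` on linear maps. -/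
noncomputable def adjunction (U W : Type*) [AddCommGroup U] [Module k U] [AddCommGroup W]
    [Module k W] (B : V' ≃ₗ[k] Module.Dual k V) :
    (U →ₗ[k] W ⊗[k] V') ≃ₗ[k] (U ⊗[k] V →ₗ[k] W) :=
  LinearEquiv.congrRight (tensorDualEquiv W B) ≪≫ₗ TensorProduct.lift.equiv (RingHom.id k) U V W

theorem adjunction_tmul (g : U →ₗ[k] W ⊗[k] V') (u : U) (y : V) :
    adjunction U W B g (u ⊗ₜ y) = tensorDualEquiv W B (g u) y := rfl

omit [FiniteDimensional k V] in
theorem gen_surjective_of_pow_eq_one (σ : Dn k n q →ₐ[k] Module.End k V) {x : Dn k n q}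
    (hx : x ^ n = 1) : Function.Surjective (σ x) := fun y => by
  refine ⟨σ (x ^ (n - 1)) y, ?_⟩
  rw [← Module.End.mul_apply, ← map_mul, ← pow_succ', Nat.sub_add_cancel (NeZero.one_le), hx,
    map_one, Module.End.one_apply]

/-- Intertwining maps correspond to each other under the adjunction. -/
theorem adjunction_intertwines_iff (hB : IsInvariant σ' σ B.toLinearMap)
    (g : U →ₗ[k] W ⊗[k] V') : Intertwines (tensorRep hq ρ σ) τ (adjunction U W B g) ↔
      Intertwines ρ (tensorRep hq τ σ') g := by
  -- Every vector of `V` is of the form `b y` and of the form `c y`, so the identities for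
  -- `tensorDualEquiv` determine the actions completely.
  have hbs := gen_surjective_of_pow_eq_one σ (gen_bn (k := k) (n := n) (q := q))
  have hcs := gen_surjective_of_pow_eq_one σ (gen_cn (k := k) (n := n) (q := q))
  constructor
  · intro h x u
    apply (tensorDualEquiv W B).injective
    ext y
    cases x with
    | a =>
      obtain ⟨y, rfl⟩ := hbs y
      have := h .a (u ⊗ₜ y)
      rw [tensorRep_a, map_add, adjunction_tmul, adjunction_tmul, adjunction_tmul,
        ← tensorDualEquiv_a hq hB] at this
      exact add_right_cancel this
    | b =>
      obtain ⟨y, rfl⟩ := hbs y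
      have := h .b (u ⊗ₜ y)
      rwa [tensorRep_b, adjunction_tmul, adjunction_tmul, ← tensorDualEquiv_b hq hB] at this
    | c =>
      obtain ⟨y, rfl⟩ := hcs y
      have := h .c (u ⊗ₜ y)
      rwa [tensorRep_c, adjunction_tmul, adjunction_tmul, ← tensorDualEquiv_c hq hB] at this
    | d =>
      obtain ⟨y, rfl⟩ := hcs y
      have := h .d (u ⊗ₜ y)
      rw [tensorRep_d, map_add, adjunction_tmul, adjunction_tmul, adjunction_tmul,
        ← tensorDualEquiv_d hq hB] at this
      exact add_right_cancel this
  · intro h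
    refine intertwines_of_tmul hq fun x u y => ?_
    cases x with
    | a => rw [tensorRep_a, map_add, adjunction_tmul, adjunction_tmul, adjunction_tmul, h,
        tensorDualEquiv_a hq hB]
    | b => rw [tensorRep_b, adjunction_tmul, adjunction_tmul, h, tensorDualEquiv_b hq hB]
    | c => rw [tensorRep_c, adjunction_tmul, adjunction_tmul, h, tensorDualEquiv_c hq hB]
    | d => rw [tensorRep_d, map_add, adjunction_tmul, adjunction_tmul, adjunction_tmul, h,
        tensorDualEquiv_d hq hB]

/-- `Hom(U, W ⊗ V')` and `Hom(U ⊗ V, W)` have the same dimension. -/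
theorem finrank_hom_tensor (hB : IsInvariant σ' σ B.toLinearMap) :
    Module.finrank k (RepMod ρ →ₗ[Dn k n q] RepMod (tensorRep hq τ σ'))
      = Module.finrank k (RepMod (tensorRep hq ρ σ) →ₗ[Dn k n q] RepMod τ) := by
  let Θ : (RepMod ρ →ₗ[Dn k n q] RepMod (tensorRep hq τ σ')) →ₗ[k]
      (RepMod (tensorRep hq ρ σ) →ₗ[Dn k n q] RepMod τ) :=
    { toFun := fun f => ((adjunction_intertwines_iff hq hB _).mpr
        (homToLinear_intertwines f)).toHom
      map_add' := fun f g => LinearMap.ext fun z =>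
        DFunLike.congr_fun ((adjunction U W B).map_add (homToLinear f) (homToLinear g)) z
      map_smul' := fun c f => LinearMap.ext fun z =>
        DFunLike.congr_fun ((adjunction U W B).map_smul c (homToLinear f)) z }
  refine LinearEquiv.finrank_eq (LinearEquiv.ofBijective Θ ⟨?_, ?_⟩)
  · intro f g h
    have h1 : adjunction U W B (homToLinear f) = adjunction U W B (homToLinear g) :=
      LinearMap.ext fun z => DFunLike.congr_fun h z
    have h2 := (adjunction U W B).injective h1
    exact LinearMap.ext fun u => DFunLike.congr_fun h2 u
  · intro f
    have h1 := (adjunction U W B).apply_symm_apply (homToLinear f)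
    have h2 : Intertwines ρ (tensorRep hq τ σ') ((adjunction U W B).symm (homToLinear f)) := by
      rw [← adjunction_intertwines_iff hq hB, h1]
      exact homToLinear_intertwines f
    exact ⟨h2.toHom, LinearMap.ext fun z => DFunLike.congr_fun h1 z⟩

/-- The tensor product of a projective module with a module that has a dual is projective. -/
theorem projective_tensorRep (hB : IsInvariant σ' σ B.toLinearMap)
    [Module.Projective (Dn k n q) (RepMod ρ)] :
    Module.Projective (Dn k n q) (RepMod (tensorRep hq ρ σ)) := by
  refine Module.Projective.of_lifting_property'' fun p hp => ?_
  -- To split the map `p` from a free module onto `U ⊗ V`, the identity of `U ⊗ V` is transposed to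
  -- a map `U → (U ⊗ V) ⊗ V'`, lifted along `p ⊗ V'` because `U` is projective, and transposed back.
  let τ : Dn k n q →ₐ[k] Module.End k (RepMod (tensorRep hq ρ σ) →₀ Dn k n q) :=
    Algebra.lsmul k k _
  let π : (RepMod (tensorRep hq ρ σ) →₀ Dn k n q) →ₗ[k] U ⊗[k] V := p.restrictScalars k
  have hπ : Intertwines τ (tensorRep hq ρ σ) π := fun g u => p.map_smul (gen k n q g) u
  have h1 := (adjunction U (U ⊗[k] V) B).apply_symm_apply LinearMap.id
  have h2 : Intertwines ρ (tensorRep hq (tensorRep hq ρ σ) σ')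
      ((adjunction U (U ⊗[k] V) B).symm LinearMap.id) := by
    rw [← adjunction_intertwines_iff hq hB, h1]
    exact intertwines_id
  obtain ⟨g, hg⟩ := Module.projective_lifting_property (hπ.rTensor hq (σ := σ')).toHom h2.toHom
    (LinearMap.rTensor_surjective V' hp)
  have hg1 := (adjunction_intertwines_iff hq hB _).mpr (homToLinear_intertwines g)
  refine ⟨hg1.toHom, ?_⟩
  have key : π.comp (adjunction U _ B (homToLinear g)) = LinearMap.id := by
    rw [← h1]
    refine TensorProduct.ext' fun u y => ?_
    rw [LinearMap.comp_apply, adjunction_tmul, adjunction_tmul, ← tensorDualEquiv_rTensor]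
    exact congrArg (fun z => tensorDualEquiv (U ⊗[k] V) B z y) (DFunLike.congr_fun hg u)
  exact LinearMap.ext fun z => DFunLike.congr_fun key z

end Duality

/-! ### The dual of `V(ℓ, s)` -/

section SimpleDual

variable {k : Type*} [Field k] {n : ℕ} [NeZero n] {q : k}

/-- The coefficients of the invariant pairing of `V(ℓ, 1 - ℓ - s)` and `V(ℓ, s)`. -/
noncomputable def pairCoeff (q : k) (s : ZMod n) : ℕ → k
  | 0 => 1
  | i + 1 => -(qpow q (s + (i : ZMod n)) * pairCoeff q s i)

theorem pairCoeff_ne_zero (hq : IsPrimitiveRoot q n) (s : ZMod n) (i : ℕ) :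
    pairCoeff q s i ≠ 0 := by
  induction i with
  | zero => exact one_ne_zero
  | succ i ih => exact neg_ne_zero.mpr (mul_ne_zero (qpow_ne_zero hq _) ih)

/-- The pairing of `V(ℓ, 1 - ℓ - s)` and `V(ℓ, s)`. -/
noncomputable def simplePairing (q : k) (s : ZMod n) (ℓ : ℕ) :
    (Fin ℓ → k) →ₗ[k] Module.Dual k (Fin ℓ → k) :=
  (dotProductEquiv k (Fin ℓ)).toLinearMap.comp
    (LinearMap.pi fun i => pairCoeff q s i.val • LinearMap.proj i.rev)

omit [NeZero n] in
theorem simplePairing_apply (s : ZMod n) {ℓ : ℕ} (x y : Fin ℓ → k) :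
    simplePairing q s ℓ x y = ∑ i : Fin ℓ, pairCoeff q s i.val * x i.rev * y i := rfl

-- The pairing is antidiagonal: lowest vectors are paired with highest ones. Invariance under `a`
-- forces the recursion of `pairCoeff`.
omit [NeZero n] in
theorem simplePairing_vec (s : ZMod n) (ℓ i j : ℕ) :
    simplePairing q s ℓ (vec k ℓ j) (vec k ℓ i) = if i + j + 1 = ℓ then pairCoeff q s i else 0 := by
  by_cases hi : i < ℓ
  · rw [simplePairing_apply, Finset.sum_eq_single ⟨i, hi⟩]
    · have : ℓ - (i + 1) = j ↔ i + j + 1 = ℓ := by omega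
      simp [vec, Fin.val_rev, this]
    · intro t _ ht
      have : t.val ≠ i := fun h => ht (Fin.ext h)
      simp [vec, this]
    · simp
  · rw [vec_eq_zero (not_lt.mp hi), map_zero, if_neg (by omega)]

theorem simplePairing_injective (hq : IsPrimitiveRoot q n) (s : ZMod n) (ℓ : ℕ) :
    Function.Injective (simplePairing q s ℓ) := by
  rw [← LinearMap.ker_eq_bot, Submodule.eq_bot_iff]
  intro x hx
  have h0 := (dotProductEquiv k (Fin ℓ)).injective
    ((LinearMap.mem_ker.mp hx).trans (map_zero _).symm)
  funext i
  have := congrFun h0 i.rev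
  simp only [LinearMap.pi_apply, LinearMap.smul_apply, LinearMap.proj_apply, Fin.rev_rev,
    Pi.zero_apply, smul_eq_mul] at this
  exact (mul_eq_zero.mp this).resolve_left (pairCoeff_ne_zero hq s _)

/-- The pairing of `V(ℓ, 1 - ℓ - s)` and `V(ℓ, s)` as an isomorphism onto the dual space. -/
noncomputable def simpleDualEquiv (hq : IsPrimitiveRoot q n) (s : ZMod n) (ℓ : ℕ) :
    (Fin ℓ → k) ≃ₗ[k] Module.Dual k (Fin ℓ → k) :=
  LinearEquiv.ofInjectiveOfFinrankEq (simplePairing q s ℓ) (simplePairing_injective hq s ℓ)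
    Subspace.dual_finrank_eq.symm

theorem bilin_ext_vec {U : Type*} [AddCommGroup U] [Module k U] {ℓ : ℕ}
    {B C : (Fin ℓ → k) →ₗ[k] (Fin ℓ → k) →ₗ[k] U}
    (h : ∀ j i, j < ℓ → i < ℓ → B (vec k ℓ j) (vec k ℓ i) = C (vec k ℓ j) (vec k ℓ i))
    (x y : Fin ℓ → k) : B x y = C x y := by
  have : B = C := linearMap_ext fun j hj => linearMap_ext fun i hi => h j i hj hi
  rw [this]

/-- The symmetry of `alpha` under `i ↔ ℓ - i`, up to a power of `q`; it makes the pairing, already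
fixed by invariance under `a`, invariant under `d` as well. -/
theorem alpha_reflect (hq0 : q ≠ 0) (i j : ℕ) :
    alpha q (i + j) j * q ^ ((i : ℤ) - j) = alpha q (i + j) i := by
  have e1 : (j : ℤ) - ((i + j : ℕ) : ℤ) = -(i : ℤ) := by push_cast; ring
  have e2 : (i : ℤ) - ((i + j : ℕ) : ℤ) = -(j : ℤ) := by push_cast; ring
  rw [alpha, alpha, e1, e2, zpow_sub₀ hq0, zpow_neg, zpow_neg, zpow_natCast, zpow_natCast]
  field_simp

theorem isInvariant_simplePairing (hq : IsPrimitiveRoot q n) {ℓ : ℕ} (hℓ : ℓ ≤ n) (s : ZMod n) :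
    IsInvariant (simpleRep hq ℓ hℓ (1 - (ℓ : ZMod n) - s)) (simpleRep hq ℓ hℓ s)
      (simplePairing q s ℓ) where
  b := by
    refine bilin_ext_vec (B := (simplePairing q s ℓ).compl₁₂ _ _) fun j i _ _ => ?_
    simp only [LinearMap.compl₁₂_apply, simpleRep_gen, simpleGen_b, map_smul,
      LinearMap.smul_apply, simplePairing_vec]
    split_ifs with h
    · rw [smul_smul, ← qpow_add hq.pow_eq_one]
      subst h
      push_cast
      ring_nf
      rw [qpow_zero]
      simp
    · simp
  c := by
    refine bilin_ext_vec (B := (simplePairing q s ℓ).compl₁₂ _ _) fun j i _ _ => ?_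
    simp only [LinearMap.compl₁₂_apply, simpleRep_gen, simpleGen_c, map_smul,
      LinearMap.smul_apply, simplePairing_vec]
    split_ifs with h
    · rw [smul_smul, ← qpow_add hq.pow_eq_one]
      subst h
      push_cast
      ring_nf
      rw [qpow_zero]
      simp
    · simp
  a := by
    refine bilin_ext_vec (B := (simplePairing q s ℓ).compl₁₂
      (simpleRep hq ℓ hℓ (1 - (ℓ : ZMod n) - s) (gen k n q .a)) (simpleRep hq ℓ hℓ s (gen k n q .b))
      + (simplePairing q s ℓ).compl₂ (simpleRep hq ℓ hℓ s (gen k n q .a))) (C := 0) fun j i _ _ => ?_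
    simp only [LinearMap.add_apply, LinearMap.compl₁₂_apply, LinearMap.compl₂_apply, simpleRep_gen,
      simpleGen_b, simpleGen_a, map_smul, simplePairing_vec, LinearMap.zero_apply]
    have e : i + 1 + j + 1 = i + (j + 1) + 1 := by ring
    rw [e]
    split_ifs with h
    · simp [pairCoeff]
    · simp
  d := by
    refine bilin_ext_vec (B := (simplePairing q s ℓ).compl₁₂
      (simpleRep hq ℓ hℓ (1 - (ℓ : ZMod n) - s) (gen k n q .d)) (simpleRep hq ℓ hℓ s (gen k n q .c))
      + (simplePairing q s ℓ).compl₂ (simpleRep hq ℓ hℓ s (gen k n q .d))) (C := 0) fun j i hj hi => ?_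
    simp only [LinearMap.add_apply, LinearMap.compl₁₂_apply, LinearMap.compl₂_apply, simpleRep_gen,
      simpleGen_c, map_smul, LinearMap.zero_apply]
    -- If one index is `0`, the only term that can survive pairs vectors whose indices add up to
    -- less than `ℓ - 1`, so it vanishes too.
    cases j with
    | zero =>
      cases i with
      | zero => simp [simpleGen_d_zero]
      | succ i => simp [simpleGen_d_zero, simpleGen_d_succ, simplePairing_vec, hi.ne]
    | succ j =>
      cases i with
      | zero => simp [simpleGen_d_zero, simpleGen_d_succ, simplePairing_vec, hj.ne]
      | succ i =>
        simp only [simpleGen_d_succ, map_smul, LinearMap.smul_apply, simplePairing_vec]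
        have e : i + (j + 1) + 1 = i + 1 + j + 1 := by ring
        rw [e]
        split_ifs with h
        · have hq0 : q ≠ 0 := hq.ne_zero (NeZero.ne n)
          have h1 : qpow q (((i + 1 + 1 : ℕ) : ZMod n) - (s + (ℓ : ZMod n))) *
              qpow q (s + (i : ZMod n)) = q ^ ((i : ℤ) - j) := by
            rw [← qpow_add hq.pow_eq_one, zpow_sub₀ hq0, eq_div_iff (zpow_ne_zero _ hq0),
              zpow_natCast, zpow_natCast, ← qpow_natCast (n := n) hq.pow_eq_one j,
              ← qpow_natCast (n := n) hq.pow_eq_one i, ← qpow_add hq.pow_eq_one]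
            congr 1
            rw [← h]
            push_cast
            ring
          have h2 := alpha_reflect hq0 (i + 1) (j + 1)
          rw [show i + 1 + (j + 1) = ℓ by omega] at h2
          have h3 : ((i + 1 : ℕ) : ℤ) - ((j + 1 : ℕ) : ℤ) = (i : ℤ) - j := by push_cast; ring
          rw [h3] at h2
          rw [← h2, ← h1, pairCoeff]
          simp only [smul_eq_mul]
          ring
        · simp

end SimpleDual


/-! ### Multiplicities of the simple modules -/

section Mult

universe u

variable {k : Type u} [Field k] {n : ℕ} [NeZero n] {q : k} (hq : IsPrimitiveRoot q n)

/-- The dimension of the space of maps from the projective cover of `V(y)`. -/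
noncomputable def mult (y : Fin n × ZMod n) (U : Type u) [AddCommGroup U] [Module k U]
    (ρ : Dn k n q →ₐ[k] Module.End k U) : ℕ :=
  Module.finrank k (projCover hq y →ₗ[Dn k n q] RepMod ρ)

theorem isSimpleModule_simpleAt (x : Fin n × ZMod n) :
    IsSimpleModule (Dn k n q) (RepMod (simpleAt hq x)) :=
  isSimpleModule_simpleRep hq x.1.isLt (Nat.succ_pos _) x.2

/-- The choice made by `Classical.epsilon` is meaningful because a covering left ideal exists. -/
theorem isProjectiveCover_projCover (x : Fin n × ZMod n) :
    IsProjectiveCover (Dn k n q) (projCover hq x) (RepMod (simpleAt hq x)) := by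
  have := isSimpleModule_simpleAt hq x
  have := finiteDimensional_Dn (k := k) (n := n) (q := q)
  have : IsArtinianRing (Dn k n q) := IsArtinianRing.of_finite k _
  exact Classical.epsilon_spec (exists_projectiveCover (A := Dn k n q)
    (S := RepMod (simpleAt hq x)))

theorem isAdditive_mult (y : Fin n × ZMod n) : IsAdditive (mult hq y) := by
  have := finiteDimensional_Dn (k := k) (n := n) (q := q)
  have := (isProjectiveCover_projCover hq y).1
  have := finite_submodule (k := k) (projCover hq y)
  exact isAdditive_finrank_hom (projCover hq y)

theorem mult_simpleAt [IsAlgClosed k] (x y : Fin n × ZMod n) :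
    mult hq y _ (simpleAt hq x) = if x = y then 1 else 0 := by
  classical
  have := isSimpleModule_simpleAt hq x
  have := isSimpleModule_simpleAt hq y
  rw [mult, finrank_hom_simple (isProjectiveCover_projCover hq y)]
  by_cases h : x = y
  · subst h
    rw [if_pos ⟨LinearEquiv.refl _ _⟩, if_pos rfl]
  · rw [if_neg h, if_neg fun hxy => h (eq_of_nonempty_equiv hq hxy)]

theorem mcKay_apply [IsAlgClosed k] (ℓ : ℕ) (hℓ : ℓ ≤ n) (s : ZMod n) (x y : Fin n × ZMod n) :
    mcKay hq ℓ hℓ s x y = mult hq y _ (tensorRep hq (simpleAt hq x) (simpleRep hq ℓ hℓ s)) := by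
  have := isSimpleModule_simpleAt hq y
  have := finiteDimensional_Dn (k := k) (n := n) (q := q)
  have := finite_submodule (k := k) (projCover hq y)
  exact compMult_eq_finrank (isProjectiveCover_projCover hq y)

/-- `P(x) ⊗ V(ℓ,s)` is projective, so the multiplicity of `P(y)` is the dimension of `Hom(P(x) ⊗
V(ℓ,s), V(y))`. Moving `V(ℓ,s)` to the other side replaces it by its dual `V(ℓ, 1-ℓ-s)` and leaves a
composition multiplicity of `V(x)`. -/
theorem projMcKay_apply [IsAlgClosed k] (ℓ : ℕ) (hℓ : ℓ ≤ n) (s : ZMod n) (x y : Fin n × ZMod n) :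
    projMcKay hq ℓ hℓ s x y = mcKay hq ℓ hℓ (1 - (ℓ : ZMod n) - s) y x := by
  have := isSimpleModule_simpleAt hq y
  have := finiteDimensional_Dn (k := k) (n := n) (q := q)
  have := finite_submodule (k := k) (projCover hq x)
  have := finite_submodule (k := k) (projCover hq y)
  have hB : IsInvariant (simpleRep hq ℓ hℓ (1 - (ℓ : ZMod n) - s)) (simpleRep hq ℓ hℓ s)
      (simpleDualEquiv hq s ℓ).toLinearMap := isInvariant_simplePairing hq hℓ s
  let ρ : Dn k n q →ₐ[k] Module.End k (projCover hq x) := Algebra.lsmul k k (projCover hq x)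
  have hproj : Module.Projective (Dn k n q) (RepMod ρ) := (isProjectiveCover_projCover hq x).1
  have := projective_tensorRep hq (ρ := ρ) hB
  rw [mcKay_apply]
  exact (summandMult_eq_finrank (isProjectiveCover_projCover hq y)).trans
    (finrank_hom_tensor hq (ρ := ρ) (τ := simpleAt hq y) hB).symm

end Mult

/-! ### Recognizing simple modules and their extensions -/

section Recognition

universe u

variable {k : Type u} [Field k] {n : ℕ} [NeZero n] {q : k} (hq : IsPrimitiveRoot q n)
  {U : Type u} [AddCommGroup U] [Module k U] {ρ : Dn k n q →ₐ[k] Module.End k U}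

omit [NeZero n] in
theorem Intertwines.apply_pow {V : Type*} [AddCommGroup V] [Module k V]
    {σ : Dn k n q →ₐ[k] Module.End k V} {φ : U →ₗ[k] V} (h : Intertwines ρ σ φ) (g : Gen) (i : ℕ)
    (u : U) : φ ((ρ (gen k n q g) ^ i) u) = (σ (gen k n q g) ^ i) (φ u) := by
  rw [← map_pow, h.apply, map_pow]

variable [FiniteDimensional k U]

/-- A module of dimension at most `ℓ` with a highest weight vector `u` of weight `(ℓ, r)` and
`a ^ ℓ u = 0` is isomorphic to `V(ℓ, r)`. -/
theorem isomorphic_of_isHighestWeight (hq1 : q ≠ 1) {ℓ : ℕ} (h1 : 0 < ℓ) (hℓ : ℓ ≤ n) {r : ZMod n}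
    {u : U} (hu : IsHighestWeight ρ ℓ r u) (hu0 : u ≠ 0) (ha : (ρ (gen k n q .a) ^ ℓ) u = 0)
    (hdim : Module.finrank k U ≤ ℓ) : Isomorphic (simpleRep hq ℓ hℓ r) ρ := by
  have hi := hwMap_intertwines hq hq1 hℓ hu ha
  have hinj : Function.Injective (hwMap ρ ℓ u) :=
    injective_of_apply_vec_zero hq hℓ hi (by rwa [hwMap_vec_of_lt h1])
  have hle := LinearMap.finrank_le_finrank_of_injective hinj
  refine ⟨LinearEquiv.ofInjectiveOfFinrankEq _ hinj (le_antisymm hle ?_), hi⟩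
  simpa using hdim

variable {f : ∀ (U : Type u) [AddCommGroup U] [Module k U], (Dn k n q →ₐ[k] Module.End k U) → ℕ}

/-- A module of dimension `ℓ₁ + ℓ₂` with two suitable highest weight vectors is an extension of two
simple modules. -/
theorem IsAdditive.eq_add_of_isHighestWeight (hf : IsAdditive f) (hq1 : q ≠ 1) {ℓ₁ ℓ₂ : ℕ}
    (h₁ : 0 < ℓ₁) (h₂ : 0 < ℓ₂) (hℓ₁ : ℓ₁ ≤ n) (hℓ₂ : ℓ₂ ≤ n) {r₁ r₂ : ZMod n} (hr : r₂ ≠ r₁)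
    {u₁ u₂ : U} (hu₁ : IsHighestWeight ρ ℓ₁ r₁ u₁) (hu₂ : IsHighestWeight ρ ℓ₂ r₂ u₂)
    (h0₁ : u₁ ≠ 0) (h0₂ : u₂ ≠ 0) (ha₁ : (ρ (gen k n q .a) ^ ℓ₁) u₁ = 0)
    (ha₂ : ∃ c : k, (ρ (gen k n q .a) ^ ℓ₂) u₂ = c • u₁)
    (hdim : Module.finrank k U ≤ ℓ₁ + ℓ₂) :
    f U ρ = f _ (simpleRep hq ℓ₁ hℓ₁ r₁) + f _ (simpleRep hq ℓ₂ hℓ₂ r₂) := by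
  have hi := hwMap_intertwines hq hq1 hℓ₁ hu₁ ha₁
  have hinj : Function.Injective (hwMap ρ ℓ₁ u₁) :=
    injective_of_apply_vec_zero hq hℓ₁ hi (by rwa [hwMap_vec_of_lt h₁])
  let K : Submodule (Dn k n q) (RepMod ρ) := LinearMap.range hi.toHom
  have hK : ∀ u : U, (u : RepMod ρ) ∈ K ↔ u ∈ LinearMap.range (hwMap ρ ℓ₁ u₁) := fun _ => Iff.rfl
  have hu₁K : u₁ ∈ LinearMap.range (hwMap ρ ℓ₁ u₁) := ⟨vec k ℓ₁ 0, by rw [hwMap_vec_of_lt h₁]; rfl⟩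
  have hex : ShortExact (simpleRep hq ℓ₁ hℓ₁ r₁) ρ (quotRep ρ K) :=
    ⟨hwMap ρ ℓ₁ u₁, quotMk ρ K, hi, quotMk_intertwines ρ K, hinj, quotMk_surjective ρ K, fun u => by
      rw [quotMk_eq_zero, hK]; rfl⟩
  have hmk := quotMk_intertwines ρ K
  -- The image of `u₂` in the quotient is nonzero since its weight is not that of `u₁`, its string
  -- stops after `ℓ₂` steps, and the quotient has dimension at most `ℓ₂`.
  have hiso : Isomorphic (simpleRep hq ℓ₂ hℓ₂ r₂) (quotRep ρ K) := by
    refine isomorphic_of_isHighestWeight hq hq1 h₂ hℓ₂ (hu₂.map hmk) ?_ ?_ ?_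
    · rw [Ne, quotMk_eq_zero, hK]
      exact notMem_range_of_weight_ne hq hℓ₁ h₁ hi hinj hr h0₂ hu₂.b hu₂.d
    · obtain ⟨c, hc⟩ := ha₂
      rw [← hmk.apply_pow, hc, quotMk_eq_zero, hK]
      exact Submodule.smul_mem _ _ hu₁K
    · have h1 := (K.restrictScalars k).finrank_quotient_add_finrank
      have h2 : Module.finrank k (K.restrictScalars k) = ℓ₁ := by
        have := LinearMap.finrank_range_of_inj hinj
        rw [Module.finrank_fintype_fun_eq_card, Fintype.card_fin] at this
        exact this
      rw [h2] at h1
      have h3 : Module.finrank k (RepMod ρ) = Module.finrank k U := rfl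
      have h4 : Module.finrank k (RepMod ρ ⧸ K) = Module.finrank k (RepMod ρ ⧸ K.restrictScalars k) :=
        rfl
      omega
  rw [hf _ _ _ _ _ _ hex, hf.eq_of_isomorphic hiso]

/-- A module of dimension at most `n` with a highest weight vector `u` of weight `(ℓ, r)` and
`a ^ ℓ u ≠ 0` is an extension of `V(ℓ, r)` by `V(n - ℓ, r + ℓ)`. -/
theorem IsAdditive.eq_add_of_pow_ne_zero (hf : IsAdditive f) (hq1 : q ≠ 1) {ℓ ℓ' : ℕ}
    (h : 0 < ℓ) (h' : 0 < ℓ') (hn : ℓ' + ℓ = n) {r : ZMod n} {u : U}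
    (hu : IsHighestWeight ρ ℓ r u) (h0 : (ρ (gen k n q .a) ^ ℓ) u ≠ 0)
    (hdim : Module.finrank k U ≤ n) :
    f U ρ = f _ (simpleRep hq ℓ' (by omega) (r + (ℓ : ZMod n)))
      + f _ (simpleRep hq ℓ (by omega) r) := by
  have hcast : (ℓ' : ZMod n) + ℓ = 0 := by
    rw [← Nat.cast_add, hn, ZMod.natCast_self]
  -- The second highest weight vector is `a ^ ℓ u`: it is killed by `d` because `alpha q ℓ ℓ = 0`,
  -- its weight differs since `0 < ℓ < n`, and its string stops after `n - ℓ` steps because `a ^ n =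
  -- 0`.
  refine hf.eq_add_of_isHighestWeight hq hq1 h' h (by omega) (by omega) ?_
    (u₁ := (ρ (gen k n q .a) ^ ℓ) u) (u₂ := u) ⟨?_, ?_, ?_⟩ hu h0 ?_ ?_ ⟨1, (one_smul _ _).symm⟩
    (by omega)
  · intro hr
    have hz : (ℓ : ZMod n) = 0 := by simpa using hr.symm
    rw [ZMod.natCast_eq_zero_iff] at hz
    exact absurd (Nat.le_of_dvd h hz) (by omega)
  · exact b_pow_a hq.pow_eq_one hu.b ℓ
  · rw [c_pow_a hq.pow_eq_one hu.c ℓ]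
    congr 2
    push_cast
    linear_combination hcast
  · obtain ⟨m, rfl⟩ : ∃ m, ℓ = m + 1 := ⟨ℓ - 1, by omega⟩
    rw [hu.d_pow_a hq hq1]
    simp [alpha]
  · intro hu0
    rw [hu0, map_zero] at h0
    exact h0 rfl
  · rw [← Module.End.mul_apply, ← pow_add, hn, apply_a_pow_n, LinearMap.zero_apply]

/-- The submodule generated by a highest weight vector. -/
noncomputable def hwSubmodule (hq1 : q ≠ 1) {ℓ : ℕ} {r : ZMod n} {u : U}
    (hu : IsHighestWeight ρ ℓ r u) : Submodule (Dn k n q) (RepMod ρ) where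
  carrier := {y | (y : U) ∈ LinearMap.range (hwMap ρ n u)}
  zero_mem' := (LinearMap.range (hwMap ρ n u)).zero_mem
  add_mem' := (LinearMap.range (hwMap ρ n u)).add_mem
  smul_mem' x y hy := by
    -- The string is taken up to `n` and not up to `ℓ`: `a ^ n = 0` always, whereas `a ^ ℓ u` may be
    -- nonzero.
    have h0 : (ρ (gen k n q .a) ^ n) u = 0 := by rw [apply_a_pow_n, LinearMap.zero_apply]
    have hv : ∀ i, (ρ (gen k n q .a) ^ i) u ∈ LinearMap.range (hwMap ρ n u) := fun i =>
      ⟨vec k n i, hwMap_vec h0 i⟩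
    refine apply_mem_of_gen ρ (LinearMap.range (hwMap ρ n u)) (fun g y hy => ?_) x hy
    obtain ⟨z, rfl⟩ := hy
    rw [apply_eq_sum_vec z, map_sum, map_sum]
    refine Submodule.sum_mem _ fun i _ => ?_
    rw [map_smul, map_smul, hwMap_vec h0]
    refine Submodule.smul_mem _ _ ?_
    obtain ⟨i, _⟩ := i
    cases g with
    | a =>
      rw [← Module.End.mul_apply, ← pow_succ']
      exact hv _
    | b =>
      rw [b_pow_a hq.pow_eq_one hu.b]
      exact Submodule.smul_mem _ _ (hv _)
    | c =>
      rw [c_pow_a hq.pow_eq_one hu.c]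
      exact Submodule.smul_mem _ _ (hv _)
    | d =>
      cases i with
      | zero => simp [hu.d]
      | succ i =>
        rw [hu.d_pow_a hq hq1]
        exact Submodule.smul_mem _ _ (hv _)

end Recognition

/-! ### Tensor products with `V(1, s)` and `V(2, 0)` -/

section TensorSimple

universe u

variable {k : Type u} [Field k] {n : ℕ} [NeZero n] {q : k} (hq : IsPrimitiveRoot q n)
  {ℓ ℓ' : ℕ} (hℓ : ℓ ≤ n) (hℓ' : ℓ' ≤ n) (r s : ZMod n)

/-- A coordinate of a tensor. -/
noncomputable def tensorCoord (k : Type*) [Field k] {ℓ ℓ' : ℕ} (i : Fin ℓ) (j : Fin ℓ') :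
    (Fin ℓ → k) ⊗[k] (Fin ℓ' → k) →ₗ[k] k :=
  TensorProduct.lift ((LinearMap.mul k k).compl₁₂ (LinearMap.proj i) (LinearMap.proj j))

theorem tensorCoord_tmul (i : Fin ℓ) (j : Fin ℓ') (x : Fin ℓ → k) (y : Fin ℓ' → k) :
    tensorCoord k i j (x ⊗ₜ y) = x i * y j := by
  simp [tensorCoord]

theorem vec_tmul_vec_ne_zero {i j : ℕ} (hi : i < ℓ) (hj : j < ℓ') :
    vec k ℓ i ⊗ₜ[k] vec k ℓ' j ≠ 0 := fun h => by
  have := congrArg (tensorCoord k ⟨i, hi⟩ ⟨j, hj⟩) h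
  simp [tensorCoord_tmul, vec] at this

theorem tensor_vec_a (i j : ℕ) : tensorRep hq (simpleRep hq ℓ hℓ r) (simpleRep hq ℓ' hℓ' s)
    (gen k n q .a) (vec k ℓ i ⊗ₜ vec k ℓ' j) = qpow q (s + (j : ZMod n)) •
      (vec k ℓ (i + 1) ⊗ₜ[k] vec k ℓ' j) + vec k ℓ i ⊗ₜ vec k ℓ' (j + 1) := by
  rw [tensorRep_a, simpleRep_gen, simpleRep_gen, simpleRep_gen, simpleGen_a, simpleGen_a,
    simpleGen_b, TensorProduct.tmul_smul]

theorem tensor_vec_b (i j : ℕ) : tensorRep hq (simpleRep hq ℓ hℓ r) (simpleRep hq ℓ' hℓ' s)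
    (gen k n q .b) (vec k ℓ i ⊗ₜ vec k ℓ' j) = qpow q (r + s + ((i + j : ℕ) : ZMod n)) •
      (vec k ℓ i ⊗ₜ[k] vec k ℓ' j) := by
  rw [tensorRep_b, simpleRep_gen, simpleRep_gen, simpleGen_b, simpleGen_b, TensorProduct.tmul_smul,
    TensorProduct.smul_tmul', smul_smul, ← qpow_add hq.pow_eq_one]
  congr 2
  push_cast
  ring_nf

theorem tensor_vec_c (i j : ℕ) : tensorRep hq (simpleRep hq ℓ hℓ r) (simpleRep hq ℓ' hℓ' s)
    (gen k n q .c) (vec k ℓ i ⊗ₜ vec k ℓ' j) = qpow q (((i + j + 2 : ℕ) : ZMod n) - (r + s + ((ℓ + ℓ' : ℕ) : ZMod n))) •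
      (vec k ℓ i ⊗ₜ[k] vec k ℓ' j) := by
  rw [tensorRep_c, simpleRep_gen, simpleRep_gen, simpleGen_c, simpleGen_c, TensorProduct.tmul_smul,
    TensorProduct.smul_tmul', smul_smul, ← qpow_add hq.pow_eq_one]
  congr 2
  push_cast
  ring_nf

theorem tensor_vec_d_zero_zero : tensorRep hq (simpleRep hq ℓ hℓ r) (simpleRep hq ℓ' hℓ' s)
    (gen k n q .d) (vec k ℓ 0 ⊗ₜ vec k ℓ' 0) = 0 := by
  rw [tensorRep_d, simpleRep_gen, simpleRep_gen, simpleRep_gen, simpleGen_d_zero, simpleGen_d_zero,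
    TensorProduct.zero_tmul, TensorProduct.tmul_zero, add_zero]

theorem tensor_vec_d_zero_succ (j : ℕ) : tensorRep hq (simpleRep hq ℓ hℓ r)
    (simpleRep hq ℓ' hℓ' s) (gen k n q .d) (vec k ℓ 0 ⊗ₜ vec k ℓ' (j + 1))
      = alpha q ℓ' (j + 1) • (vec k ℓ 0 ⊗ₜ[k] vec k ℓ' j) := by
  rw [tensorRep_d, simpleRep_gen, simpleRep_gen, simpleRep_gen, simpleGen_d_zero, simpleGen_d_succ,
    TensorProduct.zero_tmul, TensorProduct.tmul_smul, zero_add]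

theorem tensor_vec_d_succ_zero (i : ℕ) : tensorRep hq (simpleRep hq ℓ hℓ r)
    (simpleRep hq ℓ' hℓ' s) (gen k n q .d) (vec k ℓ (i + 1) ⊗ₜ vec k ℓ' 0)
      = (alpha q ℓ (i + 1) * qpow q (1 - (s + (ℓ' : ZMod n)))) •
        (vec k ℓ i ⊗ₜ[k] vec k ℓ' 0) := by
  rw [tensorRep_d, simpleRep_gen, simpleRep_gen, simpleRep_gen, simpleGen_d_zero, simpleGen_d_succ,
    simpleGen_c, TensorProduct.tmul_zero, TensorProduct.tmul_smul, TensorProduct.smul_tmul',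
    smul_smul, add_zero, mul_comm, Nat.cast_add, Nat.cast_zero, zero_add, Nat.cast_one]
  rfl

/-- The tensor product of highest weight vectors. -/
theorem isHighestWeight_tmul (m : ℕ) (hm : (m : ZMod n) + 1 = ℓ + ℓ') :
    IsHighestWeight (tensorRep hq (simpleRep hq ℓ hℓ r) (simpleRep hq ℓ' hℓ' s)) m (r + s)
      (vec k ℓ 0 ⊗ₜ vec k ℓ' 0) where
  b := by simp [tensor_vec_b]
  -- Only the class of `m` modulo `n` enters; for `ℓ = n` and `ℓ' = 2` this allows `m = 1`.
  c := by
    rw [tensor_vec_c]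
    congr 2
    push_cast
    linear_combination hm
  d := tensor_vec_d_zero_zero hq hℓ hℓ' r s

/-- `V(ℓ, r) ⊗ V(1, s) ≅ V(ℓ, r + s)`. -/
theorem isomorphic_tensor_one (hq1 : q ≠ 1) (h : 0 < ℓ) (h1 : 1 ≤ n) :
    Isomorphic (simpleRep hq ℓ hℓ (r + s))
      (tensorRep hq (simpleRep hq ℓ hℓ r) (simpleRep hq 1 h1 s)) := by
  refine isomorphic_of_isHighestWeight hq hq1 h hℓ (isHighestWeight_tmul hq hℓ h1 r s ℓ (by simp))
    (vec_tmul_vec_ne_zero h one_pos) ?_ (by simp)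
  have key : ∀ i, (tensorRep hq (simpleRep hq ℓ hℓ r) (simpleRep hq 1 h1 s) (gen k n q .a) ^ i)
      (vec k ℓ 0 ⊗ₜ vec k 1 0) = qpow q s ^ i • (vec k ℓ i ⊗ₜ[k] vec k 1 0) := by
    intro i
    induction i with
    | zero => simp
    | succ i ih =>
      rw [pow_succ', Module.End.mul_apply, ih, map_smul, tensor_vec_a,
        vec_eq_zero (k := k) (ℓ := 1) (i := 0 + 1) le_rfl, TensorProduct.tmul_zero, add_zero, smul_smul, pow_succ]
      simp
  rw [key, vec_eq_zero le_rfl, TensorProduct.zero_tmul, smul_zero]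

/-- `V(1, s) ⊗ V(ℓ, 0) ≅ V(ℓ, s)`. -/
theorem isomorphic_one_tensor (hq1 : q ≠ 1) (h : 0 < ℓ) (h1 : 1 ≤ n) :
    Isomorphic (simpleRep hq ℓ hℓ s)
      (tensorRep hq (simpleRep hq 1 h1 s) (simpleRep hq ℓ hℓ 0)) := by
  have hw := isHighestWeight_tmul hq h1 hℓ s 0 ℓ (by simp [add_comm])
  rw [add_zero] at hw
  refine isomorphic_of_isHighestWeight hq hq1 h hℓ hw (vec_tmul_vec_ne_zero one_pos h) ?_ (by simp)
  have key : ∀ i, (tensorRep hq (simpleRep hq 1 h1 s) (simpleRep hq ℓ hℓ 0) (gen k n q .a) ^ i)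
      (vec k 1 0 ⊗ₜ vec k ℓ 0) = vec k 1 0 ⊗ₜ[k] vec k ℓ i := by
    intro i
    induction i with
    | zero => simp
    | succ i ih =>
      rw [pow_succ', Module.End.mul_apply, ih, tensor_vec_a,
        vec_eq_zero (k := k) (ℓ := 1) (i := 0 + 1) le_rfl, TensorProduct.zero_tmul, smul_zero, zero_add]
  rw [key, vec_eq_zero le_rfl, TensorProduct.tmul_zero]

/-- Powers of `a` on `V(ℓ, r) ⊗ V(2, 0)`. -/
theorem pow_a_tensor_two_one (h2 : 2 ≤ n) (i j : ℕ) :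
    (tensorRep hq (simpleRep hq ℓ hℓ r) (simpleRep hq 2 h2 0) (gen k n q .a) ^ i)
      (vec k ℓ j ⊗ₜ vec k 2 1) = q ^ i • (vec k ℓ (i + j) ⊗ₜ[k] vec k 2 1) := by
  induction i with
  | zero => simp
  | succ i ih =>
    rw [pow_succ', Module.End.mul_apply, ih, map_smul, tensor_vec_a, vec_eq_zero (k := k) (ℓ := 2) (i := 1 + 1) le_rfl,
      TensorProduct.tmul_zero, add_zero, smul_smul, zero_add, Nat.cast_one,
      qpow_one hq.pow_eq_one, pow_succ, show i + 1 + j = i + j + 1 by ring]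

/-- Among the factors `a ⊗ b + 1 ⊗ a`, the second summand can be used at most once on `V(2, 0)`. The
place where it is used contributes a power of `q`, and these powers add up to the `q`-integer. -/
theorem pow_a_tensor_two_zero (hq1 : q ≠ 1) (h2 : 2 ≤ n) (i j : ℕ) :
    (tensorRep hq (simpleRep hq ℓ hℓ r) (simpleRep hq 2 h2 0) (gen k n q .a) ^ (i + 1))
      (vec k ℓ j ⊗ₜ vec k 2 0) = vec k ℓ (i + 1 + j) ⊗ₜ[k] vec k 2 0
        + ((q ^ (i + 1) - 1) / (q - 1)) • (vec k ℓ (i + j) ⊗ₜ[k] vec k 2 1) := by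
  have hq1' : q - 1 ≠ 0 := sub_ne_zero.mpr hq1
  induction i with
  | zero =>
    rw [zero_add, pow_one, pow_one, tensor_vec_a, div_self hq1', zero_add, zero_add, Nat.cast_zero,
      zero_add, qpow_zero, add_comm 1 j]
    simp
  | succ i ih =>
    rw [pow_succ', Module.End.mul_apply, ih, map_add, map_smul, tensor_vec_a, tensor_vec_a,
      vec_eq_zero (k := k) (ℓ := 2) (i := 1 + 1) le_rfl, TensorProduct.tmul_zero, add_zero,
      smul_smul, Nat.cast_zero, add_zero, qpow_zero, Nat.cast_one, zero_add (1 : ZMod n),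
      qpow_one hq.pow_eq_one, one_smul, add_assoc, show i + 1 + j + 1 = i + 1 + 1 + j by ring,
      show i + j + 1 = i + 1 + j by ring]
    congr 1
    nth_rewrite 1 [← one_smul k (vec k ℓ (i + 1 + j) ⊗ₜ[k] vec k 2 1)]
    rw [← add_smul]
    congr 1
    field_simp
    ring

/-- Powers of `a` on `V(2, 0) ⊗ V(ℓ, s)`. -/
theorem pow_a_two_one_tensor (h2 : 2 ≤ n) (i j : ℕ) :
    (tensorRep hq (simpleRep hq 2 h2 0) (simpleRep hq ℓ hℓ s) (gen k n q .a) ^ i)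
      (vec k 2 1 ⊗ₜ vec k ℓ j) = vec k 2 1 ⊗ₜ[k] vec k ℓ (i + j) := by
  induction i with
  | zero => simp
  | succ i ih =>
    rw [pow_succ', Module.End.mul_apply, ih, tensor_vec_a,
      vec_eq_zero (k := k) (ℓ := 2) (i := 1 + 1) le_rfl,
      TensorProduct.zero_tmul, smul_zero, zero_add, show i + 1 + j = i + j + 1 by ring]

/-- Here `a ⊗ b` is used at most once, and the eigenvalue of `b` at that moment is `q ^ (s + j)`
times a power of `q`; the powers again add up to a `q`-integer. -/
theorem pow_a_two_zero_tensor (hq1 : q ≠ 1) (h2 : 2 ≤ n) (i j : ℕ) :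
    (tensorRep hq (simpleRep hq 2 h2 0) (simpleRep hq ℓ hℓ s) (gen k n q .a) ^ (i + 1))
      (vec k 2 0 ⊗ₜ vec k ℓ j) = vec k 2 0 ⊗ₜ[k] vec k ℓ (i + 1 + j)
        + (qpow q (s + (j : ZMod n)) * ((q ^ (i + 1) - 1) / (q - 1))) •
          (vec k 2 1 ⊗ₜ[k] vec k ℓ (i + j)) := by
  have hq1' : q - 1 ≠ 0 := sub_ne_zero.mpr hq1
  induction i with
  | zero =>
    rw [zero_add, pow_one, pow_one, tensor_vec_a, div_self hq1', zero_add, zero_add, mul_one,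
      add_comm 1 j, add_comm]
  | succ i ih =>
    rw [pow_succ', Module.End.mul_apply, ih, map_add, map_smul, tensor_vec_a, tensor_vec_a,
      vec_eq_zero (k := k) (ℓ := 2) (i := 1 + 1) le_rfl, TensorProduct.zero_tmul, smul_zero,
      zero_add, zero_add, add_comm (_ • _) (_ ⊗ₜ _), add_assoc,
      show i + 1 + j + 1 = i + 1 + 1 + j by ring,
      show i + j + 1 = i + 1 + j by ring, ← add_smul]
    congr 2
    have e : s + ((i + 1 + j : ℕ) : ZMod n) = s + (j : ZMod n) + ((i + 1 : ℕ) : ZMod n) := by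
      push_cast; ring
    rw [e, qpow_add hq.pow_eq_one _ ((i + 1 : ℕ) : ZMod n), qpow_natCast hq.pow_eq_one]
    field_simp
    ring

end TensorSimple

/-! ### Products with `V(2, 0)` in the Grothendieck group -/

section TensorTwo

universe u

variable {k : Type u} [Field k] {n : ℕ} [NeZero n] {q : k} (hq : IsPrimitiveRoot q n) (r s : ZMod n)
  {f : ∀ (U : Type u) [AddCommGroup U] [Module k U], (Dn k n q →ₐ[k] Module.End k U) → ℕ}

/-- `V(1, r) ⊗ V(2, 0) ≅ V(2, r)`. -/
theorem IsAdditive.one_tensor_two (hf : IsAdditive f) (hq1 : q ≠ 1) (h2 : 2 ≤ n) (h1 : 1 ≤ n) :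
    f _ (tensorRep hq (simpleRep hq 1 h1 r) (simpleRep hq 2 h2 0)) = f _ (simpleRep hq 2 h2 r) :=
  (hf.eq_of_isomorphic (isomorphic_one_tensor hq h2 r hq1 two_pos h1)).symm

theorem alpha_one (hq1 : q ≠ 1) (m : ℕ) : alpha q (m + 1) 1 = 1 - q ^ (-(m : ℤ)) := by
  have hq1' : q - 1 ≠ 0 := sub_ne_zero.mpr hq1
  rw [alpha, pow_one, mul_div_assoc, mul_comm, div_mul_cancel₀ _ hq1']
  congr 2
  push_cast
  ring

/-- In the Grothendieck group, `V(ℓ, r) ⊗ V(2, 0) = V(ℓ + 1, r) + V(ℓ - 1, r + 1)` for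
`1 < ℓ < n`. -/
theorem IsAdditive.tensor_two (hf : IsAdditive f) (hq1 : q ≠ 1) (i : ℕ) (hi : i + 3 ≤ n) :
    f _ (tensorRep hq (simpleRep hq (i + 2) (by omega) r) (simpleRep hq 2 (by omega) 0))
      = f _ (simpleRep hq (i + 3) hi r) + f _ (simpleRep hq (i + 1) (by omega) (r + 1)) := by
  have hq0 : q ≠ 0 := hq.ne_zero (NeZero.ne n)
  have hq1' : q - 1 ≠ 0 := sub_ne_zero.mpr hq1
  have : Fact (1 < n) := ⟨by omega⟩
  have hw := isHighestWeight_tmul hq (ℓ := i + 2) (ℓ' := 2) (by omega) (by omega) r 0 (i + 3)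
    (by push_cast; ring)
  rw [add_zero] at hw
  -- The coefficient in `u₂` is forced by `d u₂ = 0`, as `d` sends both tensors to multiples of the
  -- product of highest weight vectors. With this value `a ^ (i + 1) u₂ = 0` as well, hence the
  -- witness `0`.
  refine hf.eq_add_of_isHighestWeight hq hq1 (by omega) (by omega) hi (by omega) (by simp) hw
    (u₂ := vec k (i + 2) 1 ⊗ₜ vec k 2 0
      - ((1 - q ^ (-((i + 1 : ℕ) : ℤ))) / (q - 1)) • (vec k (i + 2) 0 ⊗ₜ[k] vec k 2 1))
    ⟨?_, ?_, ?_⟩ (vec_tmul_vec_ne_zero (by omega) (by omega)) ?_ ?_ ⟨0, ?_⟩ ?_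
  · rw [map_sub, map_smul, tensor_vec_b, tensor_vec_b, smul_sub, smul_comm]
    simp
  · rw [map_sub, map_smul, tensor_vec_c, tensor_vec_c, smul_sub, smul_comm]
    have e : ((1 + 0 + 2 : ℕ) : ZMod n) - (r + 0 + ((i + 2 + 2 : ℕ) : ZMod n))
        = 1 - (r + 1 + ((i + 1 : ℕ) : ZMod n)) := by push_cast; ring
    rw [e]
  · have e : qpow q (1 - (0 + ((2 : ℕ) : ZMod n))) = q⁻¹ := by
      rw [show 1 - (0 + ((2 : ℕ) : ZMod n)) = -1 by push_cast; ring, qpow_neg hq,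
        qpow_one hq.pow_eq_one]
    have h1 := tensor_vec_d_succ_zero hq (ℓ := i + 2) (ℓ' := 2) (by omega) (by omega) r 0 0
    have h2 := tensor_vec_d_zero_succ hq (ℓ := i + 2) (ℓ' := 2) (by omega) (by omega) r 0 0
    rw [zero_add, e, alpha_one hq1] at h1
    rw [zero_add, alpha_one hq1] at h2
    have hc : (1 - q ^ (-((i + 1 : ℕ) : ℤ))) / (q - 1) * (1 - q ^ (-((1 : ℕ) : ℤ)))
        = (1 - q ^ (-((i + 1 : ℕ) : ℤ))) * q⁻¹ := by
      rw [Nat.cast_one, zpow_neg_one]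
      field_simp
    rw [map_sub, map_smul, h1, h2, smul_smul, hc, sub_self]
  · intro h
    have := congrArg (tensorCoord k (⟨1, by omega⟩ : Fin (i + 2)) (⟨0, by omega⟩ : Fin 2)) h
    simp [tensorCoord_tmul, vec] at this
  · rw [pow_a_tensor_two_zero hq _ r hq1, vec_eq_zero (k := k) (ℓ := i + 2) (i := i + 2 + 1 + 0) (by omega),
      vec_eq_zero (k := k) (ℓ := i + 2) (i := i + 2 + 0) (by omega),
      TensorProduct.zero_tmul, TensorProduct.zero_tmul, smul_zero, add_zero]
  · have hc : (1 - q ^ (-((i + 1 : ℕ) : ℤ))) / (q - 1) * q ^ (i + 1) = (q ^ (i + 1) - 1) / (q - 1) := by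
      rw [zpow_neg, zpow_natCast]
      field_simp
    rw [map_sub, map_smul, pow_a_tensor_two_zero hq _ r hq1, pow_a_tensor_two_one,
      vec_eq_zero (k := k) (ℓ := i + 2) (i := i + 1 + 1) le_rfl, TensorProduct.zero_tmul, zero_add,
      smul_smul, add_zero, zero_smul, hc, sub_self]
  · rw [Module.finrank_tensorProduct]
    simp
    omega

/-- In the Grothendieck group, `V(2, 0) ⊗ V(ℓ, s) = V(ℓ + 1, s) + V(ℓ - 1, s + 1)` for
`1 < ℓ < n`. -/
theorem IsAdditive.two_tensor (hf : IsAdditive f) (hq1 : q ≠ 1) (i : ℕ) (hi : i + 3 ≤ n) :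
    f _ (tensorRep hq (simpleRep hq 2 (by omega) 0) (simpleRep hq (i + 2) (by omega) s))
      = f _ (simpleRep hq (i + 3) hi s) + f _ (simpleRep hq (i + 1) (by omega) (s + 1)) := by
  have hq0 : q ≠ 0 := hq.ne_zero (NeZero.ne n)
  have hq1' : q - 1 ≠ 0 := sub_ne_zero.mpr hq1
  have : Fact (1 < n) := ⟨by omega⟩
  have hw := isHighestWeight_tmul hq (ℓ := 2) (ℓ' := i + 2) (by omega) (by omega) 0 s (i + 3)
    (by push_cast; ring)
  rw [zero_add] at hw
  -- The coefficient in `u₂` is the one appearing in `pow_a_two_zero_tensor`, so that `a ^ (i + 1)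
  -- u₂ = 0`; the same value makes `d u₂` vanish.
  refine hf.eq_add_of_isHighestWeight hq hq1 (by omega) (by omega) hi (by omega) (by simp) hw
    (u₂ := vec k 2 0 ⊗ₜ vec k (i + 2) 1
      - (qpow q (s + 1) * ((q ^ (i + 1) - 1) / (q - 1))) • (vec k 2 1 ⊗ₜ[k] vec k (i + 2) 0))
    ⟨?_, ?_, ?_⟩ (vec_tmul_vec_ne_zero (by omega) (by omega)) ?_ ?_ ⟨0, ?_⟩ ?_
  · rw [map_sub, map_smul, tensor_vec_b, tensor_vec_b, smul_sub, smul_comm]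
    simp
  · rw [map_sub, map_smul, tensor_vec_c, tensor_vec_c, smul_sub, smul_comm]
    have e : ((0 + 1 + 2 : ℕ) : ZMod n) - (0 + s + ((2 + (i + 2) : ℕ) : ZMod n))
        = 1 - (s + 1 + ((i + 1 : ℕ) : ZMod n)) := by push_cast; ring
    rw [e]
  · have h1 := tensor_vec_d_succ_zero hq (ℓ := 2) (ℓ' := i + 2) (by omega) (by omega) 0 s 0
    have h2 := tensor_vec_d_zero_succ hq (ℓ := 2) (ℓ' := i + 2) (by omega) (by omega) 0 s 0
    rw [zero_add, alpha_one hq1] at h1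
    rw [zero_add, alpha_one hq1] at h2
    have e : qpow q (s + 1) * qpow q (1 - (s + ((i + 2 : ℕ) : ZMod n))) = (q ^ i)⁻¹ := by
      rw [← qpow_add hq.pow_eq_one, ← qpow_natCast (n := n) hq.pow_eq_one i, ← qpow_neg hq]
      congr 1
      push_cast
      ring
    have hc : qpow q (s + 1) * ((q ^ (i + 1) - 1) / (q - 1)) *
        ((1 - q ^ (-((1 : ℕ) : ℤ))) * qpow q (1 - (s + ((i + 2 : ℕ) : ZMod n))))
        = 1 - q ^ (-((i + 1 : ℕ) : ℤ)) := by
      rw [Nat.cast_one, zpow_neg_one, zpow_neg, zpow_natCast]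
      calc _ = (q ^ (i + 1) - 1) / (q - 1) * (1 - q⁻¹) *
            (qpow q (s + 1) * qpow q (1 - (s + ((i + 2 : ℕ) : ZMod n)))) := by ring
        _ = _ := by
          rw [e]
          field_simp
          ring
    rw [map_sub, map_smul, h1, h2, smul_smul, hc, sub_self]
  · intro h
    have := congrArg (tensorCoord k (⟨0, by omega⟩ : Fin 2) (⟨1, by omega⟩ : Fin (i + 2))) h
    simp [tensorCoord_tmul, vec] at this
  · rw [pow_a_two_zero_tensor hq _ s hq1, vec_eq_zero (k := k) (ℓ := i + 2) (i := i + 2 + 1 + 0) (by omega),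
      vec_eq_zero (k := k) (ℓ := i + 2) (i := i + 2 + 0) (by omega),
      TensorProduct.tmul_zero, TensorProduct.tmul_zero, smul_zero, add_zero]
  · rw [map_sub, map_smul, pow_a_two_zero_tensor hq _ s hq1, pow_a_two_one_tensor,
      vec_eq_zero (k := k) (ℓ := i + 2) (i := i + 1 + 1) le_rfl, TensorProduct.tmul_zero, zero_add,
      add_zero, zero_smul, Nat.cast_one, sub_self]
  · rw [Module.finrank_tensorProduct]
    simp
    omega

/-- In the Grothendieck group, `V(n, r) ⊗ V(2, 0) = 2 V(1, r) + 2 V(n - 1, r + 1)`. -/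
theorem IsAdditive.top_tensor_two (hf : IsAdditive f) (hq1 : q ≠ 1) (m : ℕ) (hm : m + 2 = n) :
    f _ (tensorRep hq (simpleRep hq n le_rfl r) (simpleRep hq 2 (by omega) 0))
      = 2 * f _ (simpleRep hq 1 (by omega) r) + 2 * f _ (simpleRep hq (m + 1) (by omega) (r + 1)) := by
  have hq0 : q ≠ 0 := hq.ne_zero (NeZero.ne n)
  have hcast : (m : ZMod n) + 2 = 0 := by
    have h : ((m + 2 : ℕ) : ZMod n) = 0 := by rw [hm]; exact ZMod.natCast_self n
    simpa using h
  set ρ := tensorRep hq (simpleRep hq n le_rfl r) (simpleRep hq 2 (by omega) 0) with hρ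
  have hw : IsHighestWeight ρ 1 r (vec k n 0 ⊗ₜ[k] vec k 2 0) := by
    have := isHighestWeight_tmul hq (ℓ := n) (ℓ' := 2) le_rfl (by omega) r 0 1 (by simp; ring)
    rwa [add_zero] at this
  have hpow : ∀ i, (ρ (gen k n q .a) ^ (i + 1)) (vec k n 0 ⊗ₜ[k] vec k 2 0)
      = vec k n (i + 1) ⊗ₜ[k] vec k 2 0
        + ((q ^ (i + 1) - 1) / (q - 1)) • (vec k n i ⊗ₜ[k] vec k 2 1) := fun i => by
    rw [hρ, pow_a_tensor_two_zero hq _ r hq1, add_zero, add_zero]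
  -- The component at the first basis vector of `V(2, 0)`. It sends the string of the top vector to
  -- the basis of `k ^ n`, so this string is independent and spans a submodule `K` of dimension `n`.
  let p : (Fin n → k) ⊗[k] (Fin 2 → k) →ₗ[k] (Fin n → k) :=
    (TensorProduct.rid k (Fin n → k)).toLinearMap.comp
      ((LinearMap.proj (0 : Fin 2) : (Fin 2 → k) →ₗ[k] k).lTensor (Fin n → k))
  have hp0 : ∀ v : Fin n → k, p (v ⊗ₜ vec k 2 0) = v := fun v => by simp [p, vec]
  have hp1 : ∀ v : Fin n → k, p (v ⊗ₜ vec k 2 1) = 0 := fun v => by simp [p, vec]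
  have hph : p.comp (hwMap ρ n (vec k n 0 ⊗ₜ[k] vec k 2 0)) = LinearMap.id := by
    refine linearMap_ext fun i hi => ?_
    rw [LinearMap.comp_apply, hwMap_vec_of_lt hi, LinearMap.id_apply]
    cases i with
    | zero => rw [pow_zero, Module.End.one_apply, hp0]
    | succ i => rw [hpow, map_add, map_smul, hp0, hp1, smul_zero, add_zero]
  have hinj : Function.Injective (hwMap ρ n (vec k n 0 ⊗ₜ[k] vec k 2 0)) :=
    Function.LeftInverse.injective (g := p) fun x => DFunLike.congr_fun hph x
  set K := hwSubmodule hq hq1 hw with hK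
  have hmem : ∀ z : (Fin n → k) ⊗[k] (Fin 2 → k), (z : RepMod ρ) ∈ K ↔
      z ∈ LinearMap.range (hwMap ρ n (vec k n 0 ⊗ₜ[k] vec k 2 0)) := fun _ => Iff.rfl
  have hKdim : Module.finrank k K = n := by
    have := LinearMap.finrank_range_of_inj hinj
    rw [Module.finrank_fintype_fun_eq_card, Fintype.card_fin] at this
    exact this
  have hgen : (vec k n 0 ⊗ₜ[k] vec k 2 0) ∈
      LinearMap.range (hwMap ρ n (vec k n 0 ⊗ₜ[k] vec k 2 0)) :=
    ⟨vec k n 0, by rw [hwMap_vec_of_lt (by omega)]; rfl⟩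
  have := finite_submodule (k := k) (N := RepMod ρ) K
  rw [hf _ _ _ _ _ _ (shortExact_quot ρ K)]
  -- `K` is generated by a vector of weight `(1, r)`, since `n + 1` is `1` modulo `n`, and `a` does
  -- not kill this vector.
  have h1 : f _ (subRep ρ K) = f _ (simpleRep hq (m + 1) (by omega) (r + 1))
      + f _ (simpleRep hq 1 (by omega) r) := by
    let u : K := ⟨vec k n 0 ⊗ₜ[k] vec k 2 0, hgen⟩
    have hi : Intertwines (subRep ρ K) ρ (K.subtype.restrictScalars k) := fun _ _ => rfl
    have hu : IsHighestWeight (subRep ρ K) 1 r u :=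
      ⟨Subtype.ext hw.b, Subtype.ext hw.c, Subtype.ext hw.d⟩
    have := hf.eq_add_of_pow_ne_zero hq hq1 (ℓ := 1) (ℓ' := m + 1) one_pos (by omega) (by omega) hu
      ?_ hKdim.le
    · rw [Nat.cast_one] at this
      exact this
    · intro h0
      have h2 : 0 = (ρ (gen k n q .a) ^ 1) (vec k n 0 ⊗ₜ[k] vec k 2 0) :=
        (congrArg Subtype.val h0).symm.trans (hi.apply_pow .a 1 u)
      have h3 := hpow 0
      rw [zero_add] at h3
      have h4 := congrArg p (h2.trans h3)
      rw [map_zero, map_add, map_smul, hp0, hp1, smul_zero, add_zero] at h4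
      have := congrFun h4 ⟨1, by omega⟩
      simp [vec] at this
  -- In the quotient, also of dimension `n`, the image of the tensor of first and second basis
  -- vectors has weight `(n - 1, r + 1)`: `d` sends the tensor into `K`.
  have h2 : f _ (quotRep ρ K) = f _ (simpleRep hq 1 (by omega) r)
      + f _ (simpleRep hq (m + 1) (by omega) (r + 1)) := by
    have hmk := quotMk_intertwines ρ K
    have hv : IsHighestWeight (quotRep ρ K) (m + 1) (r + 1)
        (quotMk ρ K (vec k n 0 ⊗ₜ[k] vec k 2 1)) := by
      refine ⟨?_, ?_, ?_⟩
      · rw [← hmk]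
        refine (congrArg (quotMk ρ K) (tensor_vec_b hq le_rfl (show 2 ≤ n by omega) r 0 0 1)).trans ?_
        rw [map_smul]
        simp
      · rw [← hmk]
        refine (congrArg (quotMk ρ K) (tensor_vec_c hq le_rfl (show 2 ≤ n by omega) r 0 0 1)).trans ?_
        rw [map_smul]
        congr 2
        push_cast
        rw [ZMod.natCast_self]
        linear_combination hcast
      · rw [← hmk]
        refine (congrArg (quotMk ρ K) (tensor_vec_d_zero_succ hq le_rfl (show 2 ≤ n by omega) r 0 0)).trans ?_
        rw [map_smul, (quotMk_eq_zero ρ K).mpr hgen, smul_zero]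
    have := hf.eq_add_of_pow_ne_zero hq hq1 (ℓ := m + 1) (ℓ' := 1) (by omega) one_pos (by omega) hv
      ?_ ?_
    · rw [show r + 1 + ((m + 1 : ℕ) : ZMod n) = r by push_cast; linear_combination hcast] at this
      exact this
    · rw [← hmk.apply_pow, Ne, quotMk_eq_zero]
      intro hmem'
      replace hmem' : q ^ (m + 1) • (vec k n (m + 1 + 0) ⊗ₜ[k] vec k 2 1) ∈ K := by
        rw [← pow_a_tensor_two_one hq le_rfl r (show 2 ≤ n by omega)]
        exact hmem'
      -- The image under `a ^ (n - 1)` is a nonzero vector killed by `p`, while `p` is injective on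
      -- `K`.
      obtain ⟨x, hx⟩ := (hmem _).mp hmem'
      have hx0 : x = 0 := by
        have := DFunLike.congr_fun hph x
        rw [LinearMap.comp_apply, hx, map_smul, hp1, smul_zero] at this
        exact this.symm
      rw [hx0, map_zero] at hx
      exact smul_ne_zero (pow_ne_zero _ hq0) (vec_tmul_vec_ne_zero (by omega) (by omega)) hx.symm
    · have h3 := (K.restrictScalars k).finrank_quotient_add_finrank
      have h4 : Module.finrank k (K.restrictScalars k) = n := hKdim
      have h5 : Module.finrank k (RepMod ρ) = n * 2 := by
        have : Module.finrank k ((Fin n → k) ⊗[k] (Fin 2 → k)) = n * 2 := by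
          rw [Module.finrank_tensorProduct]; simp
        exact this
      have h6 : Module.finrank k (RepMod ρ ⧸ K)
        = Module.finrank k (RepMod ρ ⧸ K.restrictScalars k) := rfl
      omega
  rw [h1, h2]
  ring

end TensorTwo


/-! ### Composition factors of tensor products of simple modules -/

theorem sum_count_mul {ι R : Type*} [Fintype ι] [DecidableEq ι] [CommSemiring R] (L : Multiset ι)
    (u : ι → R) : ∑ y, (L.count y : R) * u y = (L.map u).sum := by
  induction L using Multiset.induction_on with
  | empty => simp
  | cons a L ih =>
    rw [Multiset.map_cons, Multiset.sum_cons, ← ih]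
    simp [Multiset.count_cons, add_mul, Finset.sum_add_distrib, add_comm]

section Factors

universe u

variable {k : Type u} [Field k] {n : ℕ} [NeZero n] {q : k} (hq : IsPrimitiveRoot q n)
  {U V X : Type u} [AddCommGroup U] [Module k U] [AddCommGroup V] [Module k V]
  [AddCommGroup X] [Module k X]

/-- In the Grothendieck group, `ρ` is the sum of the `V(z)` for `z ∈ L`. -/
def HasFactors (ρ : Dn k n q →ₐ[k] Module.End k U) (L : Multiset (Fin n × ZMod n)) : Prop :=
  ∀ f : ∀ (U : Type u) [AddCommGroup U] [Module k U], (Dn k n q →ₐ[k] Module.End k U) → ℕ,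
    IsAdditive f → f U ρ = (L.map fun z => f _ (simpleAt hq z)).sum

variable {hq}

theorem HasFactors.mult_eq_count [IsAlgClosed k] {ρ : Dn k n q →ₐ[k] Module.End k U}
    {L : Multiset (Fin n × ZMod n)} (h : HasFactors hq ρ L) (y : Fin n × ZMod n) :
    mult hq y _ ρ = L.count y := by
  rw [h _ (isAdditive_mult hq y)]
  simp only [mult_simpleAt]
  clear h
  induction L using Multiset.induction_on with
  | empty => simp
  | cons a L ih =>
    rw [Multiset.map_cons, Multiset.sum_cons, ih, Multiset.count_cons, add_comm]
    simp [eq_comm]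

/-- Applied to the additive function `U ↦ mult (U ⊗ V)`, this expansion turns associativity of the
tensor product into a product of McKay matrices. -/
theorem HasFactors.eq_sum_mult [IsAlgClosed k] {ρ : Dn k n q →ₐ[k] Module.End k U}
    {L : Multiset (Fin n × ZMod n)} (h : HasFactors hq ρ L)
    {f : ∀ (U : Type u) [AddCommGroup U] [Module k U], (Dn k n q →ₐ[k] Module.End k U) → ℕ}
    (hf : IsAdditive f) : f U ρ = ∑ z, mult hq z _ ρ * f _ (simpleAt hq z) := by
  simp only [h.mult_eq_count]
  rw [h f hf]
  exact (sum_count_mul L fun z => f _ (simpleAt hq z)).symm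

theorem HasFactors.mulVec [IsAlgClosed k] {ℓ : ℕ} {hℓ : ℓ ≤ n} {s : ZMod n} {x : Fin n × ZMod n}
    {L : Multiset (Fin n × ZMod n)}
    (h : HasFactors hq (tensorRep hq (simpleAt hq x) (simpleRep hq ℓ hℓ s)) L)
    (u : Fin n × ZMod n → k) :
    Matrix.mulVec (toField k (mcKay hq ℓ hℓ s)) u x = (L.map u).sum := by
  rw [← sum_count_mul]
  refine Finset.sum_congr rfl fun y _ => ?_
  rw [← h.mult_eq_count, ← mcKay_apply]
  rfl

variable (hq)

theorem hasFactors_one_two (hq1 : q ≠ 1) (h2 : 2 ≤ n) (r : ZMod n) :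
    HasFactors hq (tensorRep hq (simpleAt hq (⟨0, by omega⟩, r)) (simpleRep hq 2 h2 0))
      {(⟨1, h2⟩, r)} := fun f hf => by
  rw [Multiset.map_singleton, Multiset.sum_singleton]
  exact hf.one_tensor_two hq r hq1 h2 (by omega)

theorem hasFactors_tensor_two (hq1 : q ≠ 1) (h2 : 2 ≤ n) (i : ℕ) (hi : i + 3 ≤ n) (r : ZMod n) :
    HasFactors hq (tensorRep hq (simpleAt hq (⟨i + 1, by omega⟩, r)) (simpleRep hq 2 h2 0))
      {(⟨i + 2, hi⟩, r), (⟨i, by omega⟩, r + 1)} := fun f hf => by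
  rw [Multiset.insert_eq_cons, Multiset.map_cons, Multiset.sum_cons, Multiset.map_singleton,
    Multiset.sum_singleton]
  exact hf.tensor_two hq r hq1 i hi

theorem hasFactors_top_two (hq1 : q ≠ 1) (h2 : 2 ≤ n) (m : ℕ) (hm : m + 2 = n) (r : ZMod n) :
    HasFactors hq (tensorRep hq (simpleAt hq (⟨m + 1, by omega⟩, r)) (simpleRep hq 2 h2 0))
      (2 • {(⟨0, by omega⟩, r)} + 2 • {(⟨m, by omega⟩, r + 1)}) := fun f hf => by
  rw [Multiset.map_add, Multiset.map_nsmul, Multiset.map_nsmul, Multiset.sum_add,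
    Multiset.sum_nsmul, Multiset.sum_nsmul, Multiset.map_singleton, Multiset.sum_singleton,
    Multiset.map_singleton, Multiset.sum_singleton, smul_eq_mul, smul_eq_mul]
  have := hf.top_tensor_two hq r hq1 m hm
  subst hm
  exact this

theorem exists_hasFactors_tensor_two (hq1 : q ≠ 1) (h2 : 2 ≤ n) (x : Fin n × ZMod n) :
    ∃ L, HasFactors hq (tensorRep hq (simpleAt hq x) (simpleRep hq 2 h2 0)) L := by
  obtain ⟨⟨i, hi⟩, r⟩ := x
  cases i with
  | zero => exact ⟨_, hasFactors_one_two hq hq1 h2 r⟩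
  | succ i =>
    by_cases h : i + 2 = n
    · exact ⟨_, hasFactors_top_two hq hq1 h2 i h r⟩
    · exact ⟨_, hasFactors_tensor_two hq hq1 h2 i (by omega) r⟩

variable [IsAlgClosed k]

/-! ### Relations between the McKay matrices -/

theorem mcKay_one (hq1 : q ≠ 1) (h1 : 1 ≤ n) : mcKay hq 1 h1 0 = 1 := by
  ext x y
  have h := isomorphic_tensor_one hq (Nat.succ_le_of_lt x.1.isLt) x.2 0 hq1 (Nat.succ_pos _) h1
  rw [mcKay_apply, ← (isAdditive_mult hq y).eq_of_isomorphic h, add_zero, mult_simpleAt,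
    Matrix.one_apply]

/-- Write `V(ℓ,s)` as `V(1,s) ⊗ V(ℓ,0)` and let associativity move `V(1,s)` onto `V(x)`, where it
only shifts the second index. -/
theorem mcKay_apply_shift (hq1 : q ≠ 1) {ℓ : ℕ} (h0 : 0 < ℓ) (hℓ : ℓ ≤ n) (s : ZMod n)
    (x y : Fin n × ZMod n) : mcKay hq ℓ hℓ s x y = mcKay hq ℓ hℓ 0 (x.1, x.2 + s) y := by
  have h1 : 1 ≤ n := by omega
  have hf := isAdditive_mult hq y
  rw [mcKay_apply, mcKay_apply]
  calc mult hq y _ (tensorRep hq (simpleAt hq x) (simpleRep hq ℓ hℓ s))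
      = mult hq y _ (tensorRep hq (simpleAt hq x)
          (tensorRep hq (simpleRep hq 1 h1 s) (simpleRep hq ℓ hℓ 0))) :=
        (hf.lTensor hq (simpleAt hq x)).eq_of_isomorphic
          (isomorphic_one_tensor hq hℓ s hq1 h0 h1)
    _ = mult hq y _ (tensorRep hq (tensorRep hq (simpleAt hq x) (simpleRep hq 1 h1 s))
          (simpleRep hq ℓ hℓ 0)) := (hf.eq_of_isomorphic (isomorphic_assoc hq _ _ _)).symm
    _ = _ := ((hf.rTensor hq (simpleRep hq ℓ hℓ 0)).eq_of_isomorphic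
          (isomorphic_tensor_one hq (Nat.succ_le_of_lt x.1.isLt) x.2 s hq1 (Nat.succ_pos _) h1)).symm

/-- `M_{(2,0)} M_{(i+2,s)} = M_{(i+3,s)} + M_{(i+1,s+1)}`. -/
theorem mcKay_two_mul (hq1 : q ≠ 1) (h2 : 2 ≤ n) (i : ℕ) (hi : i + 3 ≤ n) (s : ZMod n) :
    mcKay hq 2 h2 0 * mcKay hq (i + 2) (by omega) s
      = mcKay hq (i + 3) hi s + mcKay hq (i + 1) (by omega) (s + 1) := by
  ext x y
  have hf := isAdditive_mult hq y
  obtain ⟨L, hL⟩ := exists_hasFactors_tensor_two hq hq1 h2 x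
  rw [Matrix.add_apply, Matrix.mul_apply]
  simp only [mcKay_apply]
  -- The matrix product runs over the composition factors of `V(x) ⊗ V(2,0)`; after rebracketing,
  -- the product of the two right factors is decomposed instead.
  rw [← hL.eq_sum_mult (hf.rTensor hq (simpleRep hq (i + 2) (by omega) s)),
    hf.eq_of_isomorphic (isomorphic_assoc hq _ _ _)]
  exact (hf.lTensor hq (simpleAt hq x)).two_tensor hq s hq1 i hi

end Factors

/-! ### The cyclic permutation matrices -/

section Cyc

variable {k : Type*} [Field k] {n : ℕ} [NeZero n]

omit [NeZero n] in
theorem cyc_apply (i j : ZMod n) : cyc n k i j = if j = i + 1 then 1 else 0 := rfl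

theorem cyc_pow_apply (t : ℕ) (i j : ZMod n) :
    (cyc n k ^ t) i j = if j = i + (t : ZMod n) then 1 else 0 := by
  induction t generalizing i with
  | zero => simp [Matrix.one_apply, eq_comm]
  | succ t ih =>
    rw [pow_succ', Matrix.mul_apply]
    simp only [ih, cyc_apply, ite_mul, one_mul, zero_mul, Finset.sum_ite_eq', Finset.mem_univ,
      if_true]
    rw [Nat.cast_succ, add_assoc, add_comm 1]

theorem blockCyc_apply (s : ZMod n) (x y : Fin n × ZMod n) :
    blockCyc n k s x y = if (x.1, x.2 + s) = y then 1 else 0 := by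
  rw [blockCyc, Matrix.kroneckerMap_apply, cyc_pow_apply, ZMod.natCast_zmod_val, Matrix.one_apply]
  by_cases h1 : x.1 = y.1 <;> by_cases h2 : y.2 = x.2 + s <;> simp [Prod.ext_iff, h1, h2, eq_comm]

theorem blockCyc_mul_apply (s : ZMod n) (M : Matrix (Fin n × ZMod n) (Fin n × ZMod n) k)
    (x y : Fin n × ZMod n) : (blockCyc n k s * M) x y = M (x.1, x.2 + s) y := by
  rw [Matrix.mul_apply]
  simp [blockCyc_apply]

theorem blockCyc_mulVec (s : ZMod n) (u : Fin n × ZMod n → k) (x : Fin n × ZMod n) :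
    Matrix.mulVec (blockCyc n k s) u x = u (x.1, x.2 + s) := by
  simp [Matrix.mulVec, dotProduct, blockCyc_apply]

theorem vecMul_blockCyc (s : ZMod n) (w : Fin n × ZMod n → k) (x : Fin n × ZMod n) :
    Matrix.vecMul w (blockCyc n k s) x = w (x.1, x.2 - s) := by
  have h : ∀ y : Fin n × ZMod n, (y.1, y.2 + s) = x ↔ y = (x.1, x.2 - s) := fun y => by
    simp [Prod.ext_iff, eq_sub_iff_add_eq]
  simp [Matrix.vecMul, dotProduct, blockCyc_apply, h]

theorem vecMul_cyc_apply (w : ZMod n → k) (i : ZMod n) :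
    Matrix.vecMul w (cyc n k) i = w (i - 1) := by
  have h : ∀ j : ZMod n, i = j + 1 ↔ j = i - 1 := fun j => by
    rw [eq_sub_iff_add_eq, eq_comm]
  simp [Matrix.vecMul, dotProduct, cyc, h]

end Cyc


/-! ### Chebyshev polynomials -/

section Chebyshev

open Polynomial

variable {k : Type*} [Field k]

theorem chebyshev_C_eval_add_inv {x : k} (hx : x ≠ 0) (m : ℕ) :
    (Chebyshev.C k (m : ℤ)).eval (x + x⁻¹) = x ^ m + x⁻¹ ^ m := by
  induction m using Nat.twoStepInduction with
  | zero => simp; norm_num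
  | one => simp
  | more m ih ih' =>
    push_cast at ih' ⊢
    rw [Chebyshev.C_add_two, eval_sub, eval_mul, eval_X, ih, ih']
    linear_combination (x ^ m + x⁻¹ ^ m) * mul_inv_cancel₀ hx

theorem sub_inv_mul_chebyshev_S_eval {x : k} (hx : x ≠ 0) (m : ℕ) :
    (x - x⁻¹) * (Chebyshev.S k (m : ℤ)).eval (x + x⁻¹) = x ^ (m + 1) - x⁻¹ ^ (m + 1) := by
  induction m using Nat.twoStepInduction with
  | zero => simp
  | one =>
    simp
    ring
  | more m ih ih' =>
    push_cast at ih' ⊢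
    rw [Chebyshev.S_add_two, eval_sub, eval_mul, eval_X, mul_sub, ih, mul_left_comm, ih']
    linear_combination (x ^ (m + 1) - x⁻¹ ^ (m + 1)) * mul_inv_cancel₀ hx

/-- The range is longer than needed: terms with `2 i > m` have a vanishing binomial coefficient.
This avoids a case split on parity in the induction. -/
theorem chebyshev_S_eval_eq_sum_range_succ (t : k) (m : ℕ) :
    (Chebyshev.S k (m : ℤ)).eval t
      = ∑ i ∈ Finset.range (m + 1), (-1 : k) ^ i * ((m - i).choose i : k) * t ^ (m - 2 * i) := by
  induction m using Nat.twoStepInduction with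
  | zero => simp
  | one => simp [Finset.sum_range_succ]
  | more m ih ih' =>
    push_cast at ih' ⊢
    rw [Chebyshev.S_add_two, eval_sub, eval_mul, eval_X, ih, ih', Finset.sum_range_succ' _ (m + 2),
      Finset.sum_range_succ' _ (m + 1), Finset.sum_range_succ _ (m + 1), mul_add, Finset.mul_sum,
      add_sub_right_comm, ← Finset.sum_sub_distrib]
    congr 1
    · rw [Nat.choose_eq_zero_of_lt (show m + 2 - (m + 1 + 1) < m + 1 + 1 by omega)]
      rw [Nat.cast_zero, mul_zero, zero_mul, add_zero]
      refine Finset.sum_congr rfl fun i hi => ?_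
      have hi' : i ≤ m := by simpa [Nat.lt_succ_iff] using hi
      rw [show m + 2 - (i + 1) = m - i + 1 by omega, show m + 1 - (i + 1) = m - i by omega,
        show m + 2 - 2 * (i + 1) = m - 2 * i by omega, Nat.choose_succ_succ, Nat.cast_add]
      -- Truncated subtraction in the exponent of `t` is wrong only where the binomial coefficient
      -- is zero.
      by_cases h : m - i < i + 1
      · rw [Nat.choose_eq_zero_of_lt h, Nat.cast_zero]
        ring
      · rw [show m - 2 * i = m + 1 - 2 * (i + 1) + 1 by omega, pow_succ t, pow_succ (-1 : k)]
        ring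
    · simp
      ring

theorem chebyshev_S_eval_eq_sum (t : k) (m : ℕ) :
    (Chebyshev.S k (m : ℤ)).eval t
      = ∑ i ∈ Finset.range (m / 2 + 1), (-1 : k) ^ i * ((m - i).choose i : k) * t ^ (m - 2 * i) := by
  rw [chebyshev_S_eval_eq_sum_range_succ]
  refine (Finset.sum_subset (Finset.range_mono (by omega)) fun i _ hi => ?_).symm
  rw [Finset.mem_range, not_lt] at hi
  rw [Nat.choose_eq_zero_of_lt (by omega), Nat.cast_zero, mul_zero, zero_mul]

variable {n : ℕ} {q : k}

theorem chebArg_eq (q : k) (j : ℕ) : chebArg q j = q ^ j + (q ^ j)⁻¹ := by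
  rw [chebArg, zpow_neg, zpow_natCast]

theorem chebU_zero (q : k) (j : ℕ) : chebU q j 0 = 1 := by simp [chebU]

theorem chebU_one (q : k) (j : ℕ) : chebU q j 1 = chebArg q j := by simp [chebU]

theorem chebU_add_two (q : k) (j m : ℕ) :
    chebU q j (m + 2) = chebArg q j * chebU q j (m + 1) - chebU q j m := by
  simp [chebU, Chebyshev.S_add_two]

theorem chebL_zero (q : k) (j : ℕ) : chebL q j 0 = 2 := by simp [chebL]

theorem chebL_one (q : k) (j : ℕ) : chebL q j 1 = chebArg q j := by simp [chebL]

theorem chebL_add_two (q : k) (j m : ℕ) :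
    chebL q j (m + 2) = chebArg q j * chebL q j (m + 1) - chebL q j m := by
  simp [chebL, Chebyshev.C_add_two]

theorem chebL_eq_two (hq : q ^ n = 1) (hq0 : q ≠ 0) (j : ℕ) : chebL q j n = 2 := by
  rw [chebL, chebArg_eq, chebyshev_C_eval_add_inv (pow_ne_zero _ hq0), inv_pow, ← pow_mul,
    mul_comm, pow_mul, hq, one_pow, inv_one]
  norm_num

/-- The condition imposed by the last row of `M_{(2,0)}`. With `n = m + 2`, it combines `2 𝒰_n = t
𝒰_{n-1} + ℒ_n`, the value `ℒ_n = 2`, and the recursion for `𝒰_n`. -/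
theorem chebU_periodic {m : ℕ} (hq : q ^ (m + 2) = 1) (hq0 : q ≠ 0) (j : ℕ) :
    chebArg q j * chebU q j (m + 1) = 2 + 2 * chebU q j m := by
  have h1 := congrArg (Polynomial.eval (chebArg q j)) (Chebyshev.S_eq_X_mul_S_add_C k (m + 1))
  have h2 := chebL_eq_two hq hq0 j
  have h3 := chebU_add_two q j m
  rw [eval_mul, eval_add, eval_mul, eval_X, eval_ofNat] at h1
  rw [chebL] at h2
  rw [chebU] at h3
  push_cast at h2 h3
  rw [add_assoc, one_add_one_eq_two, h2, h3] at h1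
  have h4 : eval (chebArg q j) (Chebyshev.S k (m + 1)) = chebU q j (m + 1) := by simp [chebU]
  rw [h4] at h1
  linear_combination h1

/-- From `0 < 2j < n` one gets `q^{2j} ≠ 1`, so the denominator in the standard formula for `𝒰_m(x +
x⁻¹)` is nonzero. -/
theorem chebU_eq_div (hq : IsPrimitiveRoot q n) {j : ℕ} (hj0 : j ≠ 0) (hj : 2 * j < n) (m : ℕ) :
    q ^ (j : ℤ) - q ^ (-(j : ℤ)) ≠ 0 ∧ chebU q j m =
      (q ^ ((j : ℤ) * ((m + 1 : ℕ) : ℤ)) - q ^ (-((j : ℤ) * ((m + 1 : ℕ) : ℤ)))) /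
        (q ^ (j : ℤ) - q ^ (-(j : ℤ))) := by
  have hx : q ^ j ≠ 0 := pow_ne_zero _ (hq.ne_zero (by omega))
  have h : q ^ (j : ℤ) - q ^ (-(j : ℤ)) ≠ 0 := by
    rw [zpow_neg, zpow_natCast, sub_ne_zero]
    intro h
    refine hq.pow_ne_one_of_pos_of_lt (l := 2 * j) (by omega) hj ?_
    rw [two_mul, pow_add]
    nth_rewrite 1 [h]
    exact inv_mul_cancel₀ hx
  refine ⟨h, ?_⟩
  rw [eq_div_iff h, mul_comm, chebU, chebArg_eq, zpow_neg, zpow_neg, zpow_mul, zpow_natCast,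
    zpow_natCast, sub_inv_mul_chebyshev_S_eval hx, inv_pow]

theorem chebU_zero_left (q : k) (m : ℕ) : chebU q 0 m = ((m + 1 : ℕ) : k) := by
  rw [chebU, chebArg_eq, pow_zero, inv_one, one_add_one_eq_two, Chebyshev.S_eval_two]
  simp

end Chebyshev

/-! ### Eigenvectors -/

section Eigen

variable {k : Type*} [Field k] {n : ℕ} [NeZero n] {q : k}

theorem qpow_natCast_mul (hq : q ^ n = 1) (m : ℕ) (r : ZMod n) :
    qpow q ((m : ZMod n) * r) = qpow q r ^ m := by
  induction m with
  | zero => rw [Nat.cast_zero, zero_mul, qpow_zero, pow_zero]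
  | succ m ih => rw [Nat.cast_succ, add_mul, one_mul, qpow_add hq, ih, pow_succ]

theorem qpow_two_mul (hq : q ^ n = 1) (r : ZMod n) : qpow q (2 * r) = qpow q r ^ 2 := by
  simpa using qpow_natCast_mul hq 2 r

theorem toField_mul {ι : Type*} [Fintype ι] (M N : Matrix ι ι ℕ) :
    toField k (M * N) = toField k M * toField k N :=
  Matrix.map_mul (f := Nat.castRingHom k)

theorem toField_add {ι : Type*} (M N : Matrix ι ι ℕ) :
    toField k (M + N) = toField k M + toField k N :=
  Matrix.map_add _ Nat.cast_add _ _

theorem toField_mcKay [IsAlgClosed k] (hq : IsPrimitiveRoot q n) (hq1 : q ≠ 1) {ℓ : ℕ} (h0 : 0 < ℓ)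
    (hℓ : ℓ ≤ n) (s : ZMod n) :
    toField k (mcKay hq ℓ hℓ s) = blockCyc n k s * toField k (mcKay hq ℓ hℓ 0) := by
  ext x y
  rw [blockCyc_mul_apply]
  exact congrArg Nat.cast (mcKay_apply_shift hq hq1 h0 hℓ s x y)

/-- A relation between matrices and scalars which respects products and differences, and which
holds for the `Z^{(s)}` and for `M_{(2,0)}`, holds for all McKay matrices. -/
theorem mcKay_induction [IsAlgClosed k] (hq : IsPrimitiveRoot q n) (h2 : 2 ≤ n) (j : ℕ) (r : ZMod n)
    {P : Matrix (Fin n × ZMod n) (Fin n × ZMod n) k → k → Prop}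
    (hmul : ∀ X Y a b, P X a → P Y b → P (X * Y) (a * b))
    (hsub : ∀ X Y a b, P X a → P Y b → P (X - Y) (a - b))
    (hcyc : ∀ s, P (blockCyc n k s) (qpow q (2 * s * r)))
    (htwo : P (toField k (mcKay hq 2 h2 0)) (qpow q r * chebArg q j))
    (m : ℕ) (hm : m + 1 ≤ n) (s : ZMod n) :
    P (toField k (mcKay hq (m + 1) hm s)) (qpow q (((m : ZMod n) + 2 * s) * r) * chebU q j m) := by
  have hq1 : q ≠ 1 := hq.ne_one (by omega)
  induction m using Nat.twoStepInduction generalizing s with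
  | zero =>
    have h1 : toField k (mcKay hq (0 + 1) hm 0) = 1 := by
      rw [mcKay_one hq hq1 hm]
      exact Matrix.map_one _ Nat.cast_zero Nat.cast_one
    rw [toField_mcKay hq hq1 (Nat.succ_pos _), h1, mul_one, chebU_zero, mul_one, Nat.cast_zero,
      zero_add]
    exact hcyc s
  | one =>
    rw [toField_mcKay hq hq1 (Nat.succ_pos _), chebU_one, Nat.cast_one, add_comm, add_mul, one_mul,
      qpow_add hq.pow_eq_one, mul_assoc]
    exact hmul _ _ _ _ (hcyc s) htwo
  | more i ih ih' =>
    have h := congrArg (toField k) (mcKay_two_mul hq hq1 h2 i hm s)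
    rw [toField_mul, toField_add, ← sub_eq_iff_eq_add] at h
    rw [← h]
    have h3 := hsub _ _ _ _ (hmul _ _ _ _ htwo (ih' (by omega) s)) (ih (by omega) (s + 1))
    convert h3 using 1
    -- Raising `ℓ` by two and raising `s` by one change the exponent equally, so a common power of
    -- `q` factors out and the Chebyshev recursion remains.
    have e1 : ((i + 2 : ℕ) : ZMod n) + 2 * s = 1 + (((i + 1 : ℕ) : ZMod n) + 2 * s) := by
      push_cast; ring
    have e2 : (i : ZMod n) + 2 * (s + 1) = 1 + (((i + 1 : ℕ) : ZMod n) + 2 * s) := by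
      push_cast; ring
    rw [e1, e2, add_mul 1, one_mul, qpow_add hq.pow_eq_one, chebU_add_two]
    ring

theorem vVec_apply (hq : q ^ n = 1) (j : ℕ) (r : ZMod n) (x : Fin n × ZMod n) :
    vVec q j r x = qpow q r ^ x.1.val * chebU q j x.1.val * qpow q (2 * r * x.2) := by
  rw [vVec, qpow_natCast_mul hq]

theorem qpow_two_mul_add_one (hq : q ^ n = 1) (r y : ZMod n) :
    qpow q (2 * r * (y + 1)) = qpow q r ^ 2 * qpow q (2 * r * y) := by
  rw [mul_add, mul_one, qpow_add hq, mul_comm, qpow_two_mul hq]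

theorem vVec_ne_zero (hq : q ^ n = 1) (hn : 0 < n) (j : ℕ) (r : ZMod n) :
    vVec (n := n) q j r ≠ 0 := fun h => by
  have := congrFun h (⟨0, hn⟩, 0)
  rw [vVec_apply hq, mul_zero, qpow_zero, pow_zero, chebU_zero] at this
  simp at this

theorem blockCyc_mulVec_vVec (hq : q ^ n = 1) (j : ℕ) (r s : ZMod n) :
    Matrix.mulVec (blockCyc n k s) (vVec q j r) = qpow q (2 * s * r) • vVec q j r := by
  ext x
  rw [blockCyc_mulVec, Pi.smul_apply, smul_eq_mul, vVec_apply hq, vVec_apply hq, mul_add,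
    qpow_add hq, mul_right_comm 2 s r]
  ring

/-- The first row says `𝒰_1 = t`. In the others the shift `y + 1` contributes `q^{2r}`, giving the
recursion of `𝒰` in interior rows and, with `q^{nr} = 1`, `chebU_periodic` in the last. -/
theorem mcKay_two_mulVec_vVec [IsAlgClosed k] (hq : IsPrimitiveRoot q n) (h2 : 2 ≤ n) (j : ℕ)
    (r : ZMod n) : Matrix.mulVec (toField k (mcKay hq 2 h2 0)) (vVec q j r)
      = (qpow q r * chebArg q j) • vVec q j r := by
  have hq1 : q ≠ 1 := hq.ne_one (by omega)
  have hn := hq.pow_eq_one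
  ext ⟨⟨i, hi⟩, y⟩
  rw [Pi.smul_apply, smul_eq_mul, vVec_apply hn]
  cases i with
  | zero =>
    rw [(hasFactors_one_two hq hq1 h2 y).mulVec, Multiset.map_singleton, Multiset.sum_singleton,
      vVec_apply hn]
    simp [chebU_zero, chebU_one]
  | succ i =>
    by_cases h : i + 2 = n
    · subst h
      rw [(hasFactors_top_two hq hq1 h2 i rfl y).mulVec, Multiset.map_add, Multiset.map_nsmul,
        Multiset.map_nsmul, Multiset.sum_add, Multiset.sum_nsmul, Multiset.sum_nsmul,
        Multiset.map_singleton, Multiset.sum_singleton, Multiset.map_singleton,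
        Multiset.sum_singleton, vVec_apply hn, vVec_apply hn, qpow_two_mul_add_one hn, chebU_zero]
      have h1 := chebU_periodic hn (hq.ne_zero (NeZero.ne _)) j
      have h3 := qpow_pow hn r
      rw [nsmul_eq_mul, nsmul_eq_mul]
      push_cast
      linear_combination (-qpow q (2 * r * y) * qpow q r ^ (i + 2)) * h1
        - (2 * qpow q (2 * r * y)) * h3
    · rw [(hasFactors_tensor_two hq hq1 h2 i (by omega) y).mulVec, Multiset.insert_eq_cons,
        Multiset.map_cons, Multiset.sum_cons, Multiset.map_singleton, Multiset.sum_singleton,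
        vVec_apply hn, vVec_apply hn, qpow_two_mul_add_one hn, chebU_add_two]
      ring

/-! ### Left eigenvectors -/

theorem apply_sub_one {w₀ : ZMod n → k} {μ : k} (h : Matrix.vecMul w₀ (cyc n k) = μ • w₀)
    (y : ZMod n) : w₀ (y - 1) = μ * w₀ y :=
  (vecMul_cyc_apply w₀ y).symm.trans (congrFun h y)

theorem apply_sub_natCast {w₀ : ZMod n → k} {μ : k} (h : Matrix.vecMul w₀ (cyc n k) = μ • w₀)
    (t : ℕ) (y : ZMod n) : w₀ (y - t) = μ ^ t * w₀ y := by
  induction t with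
  | zero => simp
  | succ t ih =>
    rw [Nat.cast_succ, ← sub_sub, apply_sub_one h, ih, pow_succ', mul_assoc]

/-- The scalar `c` with `w_m = c w_0`. -/
theorem wBlock_apply (hq : q ^ n = 1) (j : ℕ) (r : ZMod n) (w₀ : ZMod n → k) (m : ℕ) (y : ZMod n) :
    wBlock q j r w₀ m y = (if m = 0 then 1 else qpow q r ^ m * chebL q j m) * w₀ y := by
  rw [wBlock]
  split_ifs
  · rw [one_mul]
  · rw [Pi.smul_apply, smul_eq_mul, qpow_natCast_mul hq]

theorem vecMul_wVec_blockCyc (hq : q ^ n = 1) (j : ℕ) (r s : ZMod n) {w₀ : ZMod n → k}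
    (h : Matrix.vecMul w₀ (cyc n k) = qpow q (2 * r) • w₀) :
    Matrix.vecMul (wVec q j r w₀) (blockCyc n k s) = qpow q (2 * s * r) • wVec q j r w₀ := by
  ext x
  have hs := apply_sub_natCast h s.val x.2
  rw [ZMod.natCast_zmod_val, ← qpow_natCast_mul hq, ZMod.natCast_zmod_val] at hs
  rw [vecMul_blockCyc, Pi.smul_apply, smul_eq_mul, wVec, wVec, wBlock_apply hq, wBlock_apply hq, hs,
    mul_left_comm, show s * (2 * r) = 2 * s * r by ring]

theorem wVec_ne_zero (j : ℕ) (r : ZMod n) {w₀ : ZMod n → k} (h : w₀ ≠ 0) :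
    wVec q j r w₀ ≠ 0 := fun h' => h <| by
  ext y
  have hn := NeZero.pos n
  have := congrFun h' (⟨n - 1, by omega⟩, y)
  rwa [wVec, Nat.sub_self, wBlock, if_pos rfl] at this

/-- The left eigenvector equation with `n = m + 2`, paired with a test vector: `d i` stands for
`q^{ir} ℒ_i`, `κ` for `q^{2r}`, and `ψ i` for the pairing of `w_0` with block `i`. The coefficient
of each `ψ i` is an instance of the recursion. The last block has coefficient `1`, half of `d 0`,
which matches the doubled entries of the last row; at `ψ 0` the relation closes because `d (m + 2) =
2`. -/
theorem sum_range_pairing {R : Type*} [CommRing R] {d : ℕ → R} {μ κ : R} {m : ℕ} (h0 : d 0 = 2)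
    (h1 : d 1 = μ) (hd : ∀ i, d (i + 2) = μ * d (i + 1) - κ * d i) (hm : d (m + 2) = 2)
    (ψ : ℕ → R) :
    d (m + 1) * ψ 1 + (∑ i ∈ Finset.range m, d (m - i) * (ψ (i + 2) + κ * ψ i)
        + (2 * ψ 0 + 2 * κ * ψ m))
      = μ * (d (m + 1) * ψ 0 + (∑ i ∈ Finset.range m, d (m - i) * ψ (i + 1) + ψ (m + 1))) := by
  have e1 : ∑ i ∈ Finset.range m, d (m - i) * (ψ (i + 2) + κ * ψ i)
      = ∑ i ∈ Finset.range m, d (m - i) * ψ (i + 2) + κ * ∑ i ∈ Finset.range m, d (m - i) * ψ i := by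
    rw [Finset.mul_sum, ← Finset.sum_add_distrib]
    exact Finset.sum_congr rfl fun i _ => by ring
  have e2 : ∀ c (g : ℕ → R), ∑ i ∈ Finset.range (m + 1), d (m + c + 1 - i) * g i
      = d (m + c + 1) * g 0 + ∑ i ∈ Finset.range m, d (m + c - i) * g (i + 1) := fun c g => by
    rw [Finset.sum_range_succ', add_comm, Nat.sub_zero]
    congr 1
    exact Finset.sum_congr rfl fun i _ => by rw [show m + c + 1 - (i + 1) = m + c - i by omega]
  have e3 := e2 0 ψ
  have e4 := e2 0 fun i => ψ (i + 1)
  have e5 : ∑ i ∈ Finset.range (m + 1), d (m - i) * ψ i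
      = ∑ i ∈ Finset.range m, d (m - i) * ψ i + 2 * ψ m := by
    rw [Finset.sum_range_succ, Nat.sub_self, h0]
  have e6 : ∑ i ∈ Finset.range (m + 2), d (m + 2 - i) * ψ i
      = ∑ i ∈ Finset.range (m + 1), d (m + 1 - i) * ψ (i + 1) + 2 * ψ 0 := by
    rw [Finset.sum_range_succ', Nat.sub_zero, hm]
    congr 1
    exact Finset.sum_congr rfl fun i _ => by rw [show m + 2 - (i + 1) = m + 1 - i by omega]
  have e7 : ∑ i ∈ Finset.range (m + 2), d (m + 2 - i) * ψ i
      = μ * ∑ i ∈ Finset.range (m + 1), d (m + 1 - i) * ψ i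
        - κ * ∑ i ∈ Finset.range (m + 1), d (m - i) * ψ i + μ * ψ (m + 1) := by
    rw [Finset.sum_range_succ, show m + 2 - (m + 1) = 1 by omega, h1, Finset.mul_sum,
      Finset.mul_sum, ← Finset.sum_sub_distrib]
    congr 1
    refine Finset.sum_congr rfl fun i hi => ?_
    have hi' : i < m + 1 := Finset.mem_range.mp hi
    rw [show m + 2 - i = m - i + 2 by omega, show m + 1 - i = m - i + 1 by omega, hd]
    ring
  simp only [add_zero] at e3 e4
  rw [e1]
  linear_combination e7 - e6 - e4 + μ * e3 - κ * e5

theorem sum_mul_shift {w₀ : ZMod n → k} {μ : k} (h : Matrix.vecMul w₀ (cyc n k) = μ • w₀)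
    (g : ZMod n → k) : ∑ y, w₀ y * g (y + 1) = μ * ∑ y, w₀ y * g y := by
  rw [← Equiv.sum_comp (Equiv.addRight (1 : ZMod n)) fun y => w₀ y * g y, Finset.mul_sum]
  refine Finset.sum_congr rfl fun y _ => ?_
  rw [Equiv.coe_addRight, ← mul_assoc, ← apply_sub_one h, add_sub_cancel_right]

theorem vecMul_wVec_mcKay_two [IsAlgClosed k] (hq : IsPrimitiveRoot q n) (h2 : 2 ≤ n) (j : ℕ)
    (r : ZMod n) {w₀ : ZMod n → k} (h : Matrix.vecMul w₀ (cyc n k) = qpow q (2 * r) • w₀) :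
    Matrix.vecMul (wVec q j r w₀) (toField k (mcKay hq 2 h2 0))
      = (qpow q r * chebArg q j) • wVec q j r w₀ := by
  obtain ⟨m, rfl⟩ : ∃ m, n = m + 2 := ⟨n - 2, by omega⟩
  have hq1 : q ≠ 1 := hq.ne_one (by omega)
  have hn := hq.pow_eq_one
  rw [qpow_two_mul hn] at h
  -- Testing against an arbitrary `u` makes the matrix act on `u` on the right, where its rows are
  -- known.
  refine dotProduct_eq _ _ fun u => ?_
  rw [← Matrix.dotProduct_mulVec, smul_dotProduct, smul_eq_mul]
  -- The default value `0` is never reached, since only blocks with index below `m + 2` occur.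
  let ψ : ℕ → k := fun i => if hi : i < m + 2 then ∑ y, w₀ y * u (⟨i, hi⟩, y) else 0
  have hψ : ∀ i (hi : i < m + 2), ∑ y, w₀ y * u (⟨i, hi⟩, y) = ψ i := fun i hi => by
    simp only [ψ, dif_pos hi]
  have hψ' : ∀ i (hi : i < m + 2), ∑ y, w₀ y * u (⟨i, hi⟩, y + 1) = qpow q r ^ 2 * ψ i :=
    fun i hi => by rw [sum_mul_shift h fun y => u (⟨i, hi⟩, y), hψ]
  let d : ℕ → k := fun i => qpow q r ^ i * chebL q j i
  have key := sum_range_pairing (d := d) (μ := qpow q r * chebArg q j) (κ := qpow q r ^ 2) (m := m)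
    (by simp [d, chebL_zero]) (by simp [d, chebL_one])
    (fun i => by simp only [d, chebL_add_two]; ring)
    (by simp only [d, chebL_eq_two hn (hq.ne_zero (NeZero.ne _)), qpow_pow hn]; ring) ψ
  have hw : ∀ (i : ℕ) (hi : i < m + 1) (y : ZMod (m + 2)),
      wVec q j r w₀ (⟨i, by omega⟩, y) = d (m + 1 - i) * w₀ y := fun i hi y => by
    rw [wVec, wBlock_apply hn, if_neg (show m + 2 - 1 - i ≠ 0 by omega)]
    rfl
  have hw' : ∀ y : ZMod (m + 2), wVec q j r w₀ (⟨m + 1, by omega⟩, y) = w₀ y := fun y => by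
    rw [wVec, wBlock_apply hn, if_pos (show m + 2 - 1 - (m + 1) = 0 by omega), one_mul]
  have expand : ∀ g : Fin (m + 2) × ZMod (m + 2) → k, wVec q j r w₀ ⬝ᵥ g
      = d (m + 1) * ∑ y, w₀ y * g (⟨0, by omega⟩, y)
        + (∑ i : Fin m, d (m - i) * ∑ y, w₀ y * g (⟨i + 1, by omega⟩, y)
          + ∑ y, w₀ y * g (⟨m + 1, by omega⟩, y)) := fun g => by
    rw [dotProduct, Fintype.sum_prod_type, Fin.sum_univ_succ, Fin.sum_univ_castSucc]
    congr 1
    · rw [Finset.mul_sum]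
      refine Finset.sum_congr rfl fun y _ => ?_
      rw [← mul_assoc]
      exact congrArg (· * _) (hw 0 (by omega) y)
    · congr 1
      · refine Finset.sum_congr rfl fun i _ => ?_
        rw [Finset.mul_sum]
        refine Finset.sum_congr rfl fun y _ => ?_
        have := hw (i + 1) (by omega) y
        rw [show m + 1 - (i.val + 1) = m - i by omega] at this
        rw [← mul_assoc]
        exact congrArg (· * _) this
      · exact Finset.sum_congr rfl fun y _ => congrArg (· * _) (hw' y)
  rw [expand, expand, hψ, hψ]
  simp only [hψ]
  rw [Fin.sum_univ_eq_sum_range (fun i => d (m - i) * ψ (i + 1)) m, ← key,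
    ← Fin.sum_univ_eq_sum_range (fun i => d (m - i) * (ψ (i + 2) + qpow q r ^ 2 * ψ i)) m]
  congr 1
  · rw [← hψ 1 (by omega)]
    congr 1
    refine Finset.sum_congr rfl fun y _ => ?_
    rw [(hasFactors_one_two hq hq1 h2 y).mulVec, Multiset.map_singleton, Multiset.sum_singleton]
  · congr 1
    · refine Finset.sum_congr rfl fun i _ => ?_
      rw [← hψ (i + 2) (by omega), ← hψ' i (by omega), ← Finset.sum_add_distrib]
      congr 1
      refine Finset.sum_congr rfl fun y _ => ?_
      rw [(hasFactors_tensor_two hq hq1 h2 i (by omega) y).mulVec, Multiset.insert_eq_cons,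
        Multiset.map_cons, Multiset.sum_cons, Multiset.map_singleton, Multiset.sum_singleton,
        mul_add]
    · rw [mul_assoc, ← hψ 0 (by omega), ← hψ' m (by omega), ← mul_add, ← Finset.sum_add_distrib,
        Finset.mul_sum]
      refine Finset.sum_congr rfl fun y _ => ?_
      rw [(hasFactors_top_two hq hq1 h2 m rfl y).mulVec, Multiset.map_add, Multiset.map_nsmul,
        Multiset.map_nsmul, Multiset.sum_add, Multiset.sum_nsmul, Multiset.sum_nsmul,
        Multiset.map_singleton, Multiset.sum_singleton, Multiset.map_singleton,
        Multiset.sum_singleton, nsmul_eq_mul, nsmul_eq_mul]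
      push_cast
      ring

/-! ### The eigenvalues of the McKay matrices -/

variable [IsAlgClosed k]

theorem mcKay_mulVec_vVec (hq : IsPrimitiveRoot q n) (h2 : 2 ≤ n) (j : ℕ) (r : ZMod n) (m : ℕ)
    (hm : m + 1 ≤ n) (s : ZMod n) :
    Matrix.mulVec (toField k (mcKay hq (m + 1) hm s)) (vVec q j r)
      = (qpow q (((m : ZMod n) + 2 * s) * r) * chebU q j m) • vVec q j r := by
  refine mcKay_induction hq h2 j r (P := fun X μ => Matrix.mulVec X (vVec q j r) = μ • vVec q j r)
    (fun X Y a b hX hY => ?_) (fun X Y a b hX hY => ?_)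
    (blockCyc_mulVec_vVec hq.pow_eq_one j r) (mcKay_two_mulVec_vVec hq h2 j r) m hm s
  · rw [← Matrix.mulVec_mulVec, hY, Matrix.mulVec_smul, hX, smul_smul, mul_comm]
  · rw [Matrix.sub_mulVec, hX, hY, sub_smul]

theorem vecMul_wVec_mcKay (hq : IsPrimitiveRoot q n) (h2 : 2 ≤ n) (j : ℕ) (r : ZMod n)
    {w₀ : ZMod n → k} (h : Matrix.vecMul w₀ (cyc n k) = qpow q (2 * r) • w₀) (m : ℕ)
    (hm : m + 1 ≤ n) (s : ZMod n) :
    Matrix.vecMul (wVec q j r w₀) (toField k (mcKay hq (m + 1) hm s))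
      = (qpow q (((m : ZMod n) + 2 * s) * r) * chebU q j m) • wVec q j r w₀ := by
  refine mcKay_induction hq h2 j r
    (P := fun X μ => Matrix.vecMul (wVec q j r w₀) X = μ • wVec q j r w₀)
    (fun X Y a b hX hY => ?_) (fun X Y a b hX hY => ?_)
    (fun s => vecMul_wVec_blockCyc hq.pow_eq_one j r s h) (vecMul_wVec_mcKay_two hq h2 j r h) m hm s
  · rw [← Matrix.vecMul_vecMul, hX, Matrix.smul_vecMul, hY, smul_smul]
  · rw [Matrix.vecMul_sub, hX, hY, sub_smul]

theorem toField_projMcKay (hq : IsPrimitiveRoot q n) (ℓ : ℕ) (hℓ : ℓ ≤ n) (s : ZMod n) :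
    toField k (projMcKay hq ℓ hℓ s)
      = (toField k (mcKay hq ℓ hℓ (1 - (ℓ : ZMod n) - s))).transpose := by
  ext x y
  exact congrArg Nat.cast (projMcKay_apply hq ℓ hℓ s x y)

end Eigen

end TaftDouble

/-! ### The main theorem -/

open TaftDouble in
theorem theorem3p13 {k : Type*} [Field k] [IsAlgClosed k] [CharZero k] {n : ℕ} [NeZero n]
    (hn : 3 ≤ n) (hodd : Odd n) {q : k} (hq : IsPrimitiveRoot q n)
    (j : ℕ) (hj : j ≤ (n - 1) / 2) (r : ZMod n)
    (ℓ : ℕ) (hℓ₁ : 1 ≤ ℓ) (hℓ : ℓ ≤ n) (s : ZMod n) :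
    -- `M_{(ℓ,s)} = Z^{(s)} M_{(ℓ,0)}`
    toField k (mcKay hq ℓ hℓ s) = blockCyc n k s * toField k (mcKay hq ℓ hℓ 0) ∧
    -- the action of `M_{(ℓ,0)}` on `v_{j,r}`, through the explicit sum
    Matrix.mulVec (toField k (mcKay hq ℓ hℓ 0)) (vVec q j r) =
      (∑ i ∈ Finset.range ((ℓ - 1) / 2 + 1),
        (-1 : k) ^ i * ((ℓ - 1 - i).choose i : k) * qpow q (2 * (i : ZMod n) * r) *
          qpow q (((ℓ : ZMod n) - 1 - 2 * (i : ZMod n)) * r) *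
          chebArg q j ^ (ℓ - 1 - 2 * i)) • vVec q j r ∧
    Matrix.mulVec (toField k (mcKay hq ℓ hℓ 0)) (vVec q j r) =
      (qpow q (((ℓ : ZMod n) - 1) * r) * ∑ i ∈ Finset.range ((ℓ - 1) / 2 + 1),
        (-1 : k) ^ i * ((ℓ - 1 - i).choose i : k) *
          chebArg q j ^ (ℓ - 1 - 2 * i)) • vVec q j r ∧
    Matrix.mulVec (toField k (mcKay hq ℓ hℓ 0)) (vVec q j r) =
      (qpow q (((ℓ : ZMod n) - 1) * r) * chebU q j (ℓ - 1)) • vVec q j r ∧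
    -- the values of `𝒰_{ℓ-1}(q^j + q^{-j})`
    (j ≠ 0 → q ^ (j : ℤ) - q ^ (-(j : ℤ)) ≠ 0 ∧
      chebU q j (ℓ - 1) =
        (q ^ ((j : ℤ) * (ℓ : ℤ)) - q ^ (-((j : ℤ) * (ℓ : ℤ)))) /
          (q ^ (j : ℤ) - q ^ (-(j : ℤ)))) ∧
    (j = 0 → chebU q j (ℓ - 1) = (ℓ : k)) ∧
    -- right and left eigenvectors of `M_{(ℓ,s)}`
    IsRightEigenvector (toField k (mcKay hq ℓ hℓ s)) (vVec q j r)
      (qpow q (((ℓ : ZMod n) - 1 + 2 * s) * r) * chebU q j (ℓ - 1)) ∧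
    (∀ w₀ : ZMod n → k, IsLeftEigenvector (cyc n k) w₀ (qpow q (2 * r)) →
      IsLeftEigenvector (toField k (mcKay hq ℓ hℓ s)) (wVec q j r w₀)
        (qpow q (((ℓ : ZMod n) - 1 + 2 * s) * r) * chebU q j (ℓ - 1))) ∧
    -- left and right eigenvectors of `Q_{(ℓ,s)}`
    IsLeftEigenvector (toField k (projMcKay hq ℓ hℓ s)) (vVec q j r)
      (qpow q ((1 - (ℓ : ZMod n) - 2 * s) * r) * chebU q j (ℓ - 1)) ∧
    (∀ w₀ : ZMod n → k, IsLeftEigenvector (cyc n k) w₀ (qpow q (2 * r)) →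
      IsRightEigenvector (toField k (projMcKay hq ℓ hℓ s)) (wVec q j r w₀)
        (qpow q ((1 - (ℓ : ZMod n) - 2 * s) * r) * chebU q j (ℓ - 1))) := by
  have hn0 := hq.pow_eq_one
  have hq1 : q ≠ 1 := hq.ne_one (by omega)
  obtain ⟨m, rfl⟩ : ∃ m, ℓ = m + 1 := ⟨ℓ - 1, by omega⟩
  rw [Nat.add_sub_cancel]
  have hm : ((m + 1 : ℕ) : ZMod n) - 1 = m := by push_cast; ring
  -- The exponent for `Q_{(ℓ,s)}` is the one for `M` at the dual parameter `1 - ℓ - s`.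
  have hm' : 1 - ((m + 1 : ℕ) : ZMod n) - 2 * s = m + 2 * (1 - ((m + 1 : ℕ) : ZMod n) - s) := by
    push_cast
    ring
  rw [hm, hm']
  have hsum := chebyshev_S_eval_eq_sum (chebArg q j) m
  have hv := mcKay_mulVec_vVec hq (by omega) j r m hℓ 0
  rw [mul_zero, add_zero] at hv
  refine ⟨toField_mcKay hq hq1 hℓ₁ hℓ s, ?_, ?_, hv, fun hj0 => chebU_eq_div hq hj0 (by omega) m,
    ?_, ⟨vVec_ne_zero hn0 (by omega) j r, mcKay_mulVec_vVec hq (by omega) j r m hℓ s⟩,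
    fun w₀ hw => ⟨wVec_ne_zero j r hw.1, vecMul_wVec_mcKay hq (by omega) j r hw.2 m hℓ s⟩,
    ⟨vVec_ne_zero hn0 (by omega) j r, ?_⟩, fun w₀ hw => ⟨wVec_ne_zero j r hw.1, ?_⟩⟩
  · rw [hv, chebU, hsum, Finset.mul_sum]
    congr 1
    refine Finset.sum_congr rfl fun i _ => ?_
    -- The factor `q^{mr}` is split differently in each summand, as `q^{2ir}` times `q^{(m-2i)r}`.
    have e : (m : ZMod n) * r = 2 * (i : ZMod n) * r + ((m : ZMod n) - 2 * (i : ZMod n)) * r := by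
      ring
    rw [e, qpow_add hn0]
    ring
  · rw [hv, chebU, hsum]
  · rintro rfl
    exact chebU_zero_left q m
  · rw [toField_projMcKay, Matrix.vecMul_transpose]
    exact mcKay_mulVec_vVec hq (by omega) j r m hℓ _
  · rw [toField_projMcKay, Matrix.mulVec_transpose]
    exact vecMul_wVec_mcKay hq (by omega) j r hw.2 m hℓ _
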